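/- **Asymptotics of the refracted wave when $\gamma_+<\gamma_-$.** Let $0<\gamma_+<\gamma_-$ be constants, $\mathbb R^3_-=\{x\in\mathbb R^3 : x_3<0\}$, and for $x=(x_1,x_2,x_3)$ write $x'=(x_1,x_2)$; for $z'=(z_1,z_2)\in\mathbb R^2$ write $\tilde z'=(z_1,z_2,0)$. Put $a_0=\sqrt{\gamma_- /\gamma_+}>1$ and, for $\rho\ge 0$, $$R_-(\rho)=\frac{4\gamma_+\gamma_-\sqrt{1/\gamma_++\rho^2}\,\sqrt{1/\gamma_-+\rho^2}}{\gamma_+\sqrt{1/\gamma_++\rho^2}+\gamma_-\sqrt{1/\gamma_-+\rho^2}} .$$ For $\tau>0$, $x\in\mathbb R^3_-$, $z'\in\mathbb R^2$ the refracted wave is the oscillatory integral $$E^{\gamma_-}_\tau(x,z')=\lim_{\varepsilon\to+0}\frac{\tau}{(2\pi)^3}\int_{\mathbb R^3}e^{-\varepsilon|\xi'|^2}\,e^{i\tau\xi\cdot(x-\tilde z')}\,\frac{R_-(|\xi'|)}{\gamma_-|\xi|^2+1}\,d\xi .$$ Then the integrals (for $\varepsilon>0$) converge absolutely, the limit exists,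 and $E^{\gamma_-}_\tau(\cdot,z')$ is differentiable in $\mathbb R^3_-$. Moreover there are $C^\infty$ functions $E_j$ and $G_{k,j}$ on $\mathbb R^3_-$ ($k=1,2,3$; $j=0,1,2,\dots$), depending only on $\gamma_\pm$, such that for every integer $N\ge1$ and all $\tau>0$, $x\in\mathbb R^3_-$, $z'\in\mathbb R^2$, $$E^{\gamma_-}_\tau(x,z')=\frac{e^{-\tau|x-\tilde z'|/\sqrt{\gamma_-}}}{4\pi\gamma_-|x-\tilde z'|}\Big(\sum_{j=0}^{N-1}E_j(x-\tilde z')\Big(\frac{\sqrt{\gamma_-}}{\tau|x-\tilde z'|}\Big)^j+\tilde E_N(x,z';\tau)\Big),$$ $$\partial_{x_k}E^{\gamma_-}_\tau(x,z')=\frac{-\tau e^{-\tau|x-\tilde z'|/\sqrt{\gamma_-}}}{4\pi\gamma_-^{3/2}|x-\tilde z'|}\Big(\sum_{j=0}^{N-1}G_{k,j}(x-\tilde z')\Big(\frac{\sqrt{\gamma_-}}{\tau|x-\tilde z'|}\Big)^j+\tilde G_{k,N}(x,z';\tau)\Big)\quad(k=1,2,3),$$ with remainders that satisfy the following. * For every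 $N\ge2$ there is a constant $C_N>0$ (independent of $\tau,x,z'$) such that for all $\tau>0$, $x\in\mathbb R^3_-$, $z'\in\mathbb R^2$, $$|\tilde E_N(x,z';\tau)|+\sum_{k=1}^3|\tilde G_{k,N}(x,z';\tau)|\le C_N\Big(\frac{\sqrt{\gamma_-}}{\tau|x-\tilde z'|}\Big)^N .$$ * For $N=1$ there is a constant $C_1>0$ such that $|\tilde E_1(x,z';\tau)|\le C_1\dfrac{\sqrt{\gamma_-}}{\tau|x-\tilde z'|}$ for all $\tau>0$, $x\in\mathbb R^3_-$, $z'\in\mathbb R^2$; and for every $\delta>0$ there is a constant $C_{1,\delta}>0$ such that $$|\tilde E_1(x,z';\tau)|+\sum_{k=1}^3|\tilde G_{k,1}(x,z';\tau)|\le C_{1,\delta}\,\frac{\sqrt{\gamma_-}}{\tau|x-\tilde z'|}$$ for all $\tau>0$, $x\in\mathbb R^3_-$, $z'\in\mathbb R^2$ with $\tau|x-\tilde z'|/\sqrt{\gamma_-}\ge\delta$. The leading coefficients are $$E_0(x-\tilde z')=\frac{4\sqrt{\gamma_-}\,|x_3|\sqrt{a_0^2|x-\tilde z'|^2-|x'-z'|^2}}{|x-\tilde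 z'|\big(\sqrt{a_0^2|x-\tilde z'|^2-|x'-z'|^2}+a_0^2|x_3|\big)},$$ $$G_{k,0}(x-\tilde z')=E_0(x-\tilde z')\frac{x_k-z_k}{|x-\tilde z'|}\ (k=1,2),\qquad G_{3,0}(x-\tilde z')=E_0(x-\tilde z')\frac{x_3}{|x-\tilde z'|}.$$ -/

import Mathlib

open Real Filter Topology MeasureTheory
open scoped ContDiff

/-- The lower half-space `ℝ³₋ = {x | x₃ < 0}`. -/
def lowerHalfSpace : Set (EuclideanSpace ℝ (Fin 3)) := {x | x 2 < 0}

/-- The tangential part `x' = (x₁, x₂)` of `x = (x₁, x₂, x₃)`. -/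
noncomputable def tangential (x : EuclideanSpace ℝ (Fin 3)) : EuclideanSpace ℝ (Fin 2) :=
  !₂[x 0, x 1]

/-- The boundary point `(z', 0)` for `z' ∈ ℝ²`. -/
noncomputable def boundaryPoint (z : EuclideanSpace ℝ (Fin 2)) : EuclideanSpace ℝ (Fin 3) :=
  !₂[z 0, z 1, 0]

/-- The transmission coefficient `R₋(ρ)`, with `γp = γ₊` and `γm = γ₋`. -/
noncomputable def transmissionCoeff (γp γm ρ : ℝ) : ℝ :=
  (4 * γp * γm * √(1 / γp + ρ ^ 2) * √(1 / γm + ρ ^ 2)) /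
    (γp * √(1 / γp + ρ ^ 2) + γm * √(1 / γm + ρ ^ 2))

/-- The integrand of the refracted wave, with the damping factor `exp (-ε |ξ'|²)`. -/
noncomputable def refractedIntegrand (γp γm τ ε : ℝ) (x : EuclideanSpace ℝ (Fin 3))
    (z : EuclideanSpace ℝ (Fin 2)) (ξ : EuclideanSpace ℝ (Fin 3)) : ℂ :=
  (Real.exp (-ε * ‖tangential ξ‖ ^ 2) : ℂ) *
    Complex.exp (Complex.I * ((τ * inner ℝ ξ (x - boundaryPoint z) : ℝ) : ℂ)) *
    ((1 / (γm * ‖ξ‖ ^ 2 + 1) * transmissionCoeff γp γm ‖tangential ξ‖ : ℝ) : ℂ)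

/-- The damped integral `τ / (2π)³ ∫ (damped integrand) dξ`, for `ε > 0`. -/
noncomputable def dampedRefractedWave (γp γm τ ε : ℝ) (x : EuclideanSpace ℝ (Fin 3))
    (z : EuclideanSpace ℝ (Fin 2)) : ℂ :=
  ((τ / (2 * π) ^ 3 : ℝ) : ℂ) * ∫ ξ, refractedIntegrand γp γm τ ε x z ξ

/-- The refracted wave `E^{γ₋}_τ(x, z')`: its Fourier integral does not converge absolutely and
is an oscillatory integral, the limit `ε → +0` of the damped integrals. -/
noncomputable def refractedWave (γp γm τ : ℝ) (x : EuclideanSpace ℝ (Fin 3))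
    (z : EuclideanSpace ℝ (Fin 2)) : ℂ :=
  limUnder (𝓝[>] (0 : ℝ)) (fun ε => dampedRefractedWave γp γm τ ε x z)

/-- The partial derivative `∂_{x_k} E^{γ₋}_τ(x, z')`. -/
noncomputable def refractedWavePartial (γp γm τ : ℝ) (k : Fin 3) (x : EuclideanSpace ℝ (Fin 3))
    (z : EuclideanSpace ℝ (Fin 2)) : ℂ :=
  fderiv ℝ (fun y => refractedWave γp γm τ y z) x (EuclideanSpace.single k (1 : ℝ))

/-- The closed form of the leading amplitude as a function of `w = x - (z', 0)`,
with `a₀ = √(γ₋ / γ₊)`. -/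
noncomputable def leadingAmplitude (γp γm : ℝ) (w : EuclideanSpace ℝ (Fin 3)) : ℝ :=
  (4 * √γm * |w 2| * √(√(γm / γp) ^ 2 * ‖w‖ ^ 2 - ‖tangential w‖ ^ 2)) /
    (‖w‖ * (√(√(γm / γp) ^ 2 * ‖w‖ ^ 2 - ‖tangential w‖ ^ 2) + √(γm / γp) ^ 2 * |w 2|))

/-!
Write `w = x - (z', 0)`, `μ = τ / √γ₋` and `lam = μ ‖w‖`; everything is a statement about
functions of `lam` and of the direction `w / ‖w‖`.

*Reduction to the plane.* In `ξ₃` the integrand is a Lorentzian times an exponential, whose Fourier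
transform is `exp (-a |k|)` up to a factor (`integral_exp_mul_div_sq_add_sq`). Since `w₃ < 0`, the
remaining integral over the tangential frequencies decays exponentially, so that the damping is
removed by dominated convergence (`tendsto_dampedRefractedWave`) and differentiation under the
integral only multiplies the amplitude by an affine function of the frequencies
(`hasFDerivAt_integral_waveIntegrand`). The wave and its gradient are therefore treated together, as
plane integrals with amplitude `f · affineSymbol l`.

*Contour shift.* Let `c` and `s` be the cosine and the sine of the angle between `w` and the
downward vertical. After a rotation of the plane the phase is `-lam (t c - i x s)` with
`t = √(1 + x² + y²)`. In the rapidity `v`, where `x = √(1 + y²) sinh v`, it becomes a multiple of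
`cosh (v - i α)` with `c = cos α`, and the shift `v ↦ v + i α` turns it into `-lam t`
(`integral_phase_eq_integral_rotated`). In polar coordinates with `u = t - 1` the integral is then
`exp (-lam)` times a Laplace transform over `u > 0`, whose density is an angular mean of the
amplitude at the complex point `c (1 + u) + i s √(u² + 2u) cos θ`
(`integral_planeIntegrand_eq_laplace`).

*Expansion of the density.* The amplitude is `√γ₋ R₋` as a function of `t`. Because `γ₊ < γ₋`, its
branch points `± i √(γ₋/γ₊ - 1)` lie on the imaginary axis at a distance from `[0, 1]` and its
denominator does not vanish nearby (`isAmplitude_refractedAmplitude`). Hence its Taylor expansion at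
`c` has uniform remainders up to the grazing directions `c → 0`. The angular mean removes the odd
powers of `√(u² + 2u)`, and what is left is an expansion in integral powers of `u` whose
coefficients are smooth in `w` (`IsAmplitude.hasUniformExpansion_angularMean`).

*Watson's lemma.* With the polynomial growth of the density the local expansion becomes a global
estimate, and integration against `exp (-lam u)` gives the expansion in powers of `1 / lam`
(`exists_expansion_waveLaplace`). The density grows at most linearly for the wave and at most
quadratically for its derivatives. For an order `N` below the growth exponent a multiple of
`lam ^ (-N)` need not bound the remainder as `lam → 0`, which is why `N = 1` is exceptional for the
derivatives. The leading terms are the values of the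
density at `u = 0`, that is of the amplitude at `c`.
-/

/-! ### Holomorphic amplitudes -/

/-- `f` is an admissible amplitude: holomorphic on the right half-plane with growth of order `p`,
and bounded and holomorphic on discs of a fixed radius `R` around the points of `[0, 1]`. The discs
reach across the imaginary axis, which makes the estimates uniform up to grazing directions. -/
structure IsAmplitude (f : ℂ → ℂ) (R M : ℝ) (p : ℕ) : Prop where
  radius_pos : 0 < R
  radius_le : R ≤ 1
  bound_nonneg : 0 ≤ M
  differentiableAt : ∀ t : ℂ, 0 < t.re → DifferentiableAt ℂ f t
  differentiableOn_ball : ∀ c ∈ Set.Icc (0 : ℝ) 1, DifferentiableOn ℂ f (Metric.ball (c : ℂ) R)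
  norm_le_of_mem_ball : ∀ c ∈ Set.Icc (0 : ℝ) 1, ∀ t ∈ Metric.ball (c : ℂ) R, ‖f t‖ ≤ M
  norm_le : ∀ t : ℂ, 0 < t.re → ‖f t‖ ≤ M * (1 + ‖t‖) ^ p

/-- The `m`-th Taylor coefficient of `f` at `c`. -/
noncomputable def taylorCoeff (f : ℂ → ℂ) (m : ℕ) (c : ℂ) : ℂ :=
  iteratedDeriv m f c / (m.factorial : ℂ)

namespace IsAmplitude

variable {f : ℂ → ℂ} {R M : ℝ} {p : ℕ}

/-- Cauchy's estimate on the disc of radius `R / 2`. -/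
theorem norm_taylorCoeff_le (hf : IsAmplitude f R M p) (m : ℕ) {c : ℝ}
    (hc : c ∈ Set.Icc (0 : ℝ) 1) : ‖taylorCoeff f m c‖ ≤ M / (R / 2) ^ m := by
  have hR := hf.radius_pos
  have hsub : Metric.closedBall (c : ℂ) (R / 2) ⊆ Metric.ball (c : ℂ) R :=
    Metric.closedBall_subset_ball (by linarith)
  have h := Complex.norm_iteratedDeriv_le_of_forall_mem_sphere_norm_le (f := f) (c := (c : ℂ))
    (R := R / 2) (C := M) m (by positivity)
    (((hf.differentiableOn_ball c hc).mono
      ((closure_minimal Metric.ball_subset_closedBall Metric.isClosed_closedBall).trans hsub)).diffContOnCl)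
    (fun z hz => hf.norm_le_of_mem_ball c hc z (hsub (Metric.sphere_subset_closedBall hz)))
  rw [taylorCoeff, norm_div, Complex.norm_natCast, div_le_iff₀ (by positivity)]
  calc _ ≤ _ := h
    _ = _ := by ring

/-- Taylor's formula with a remainder that is uniform in the base point. -/
theorem norm_sub_taylor_le (hf : IsAmplitude f R M p) (n : ℕ) {c : ℝ}
    (hc : c ∈ Set.Icc (0 : ℝ) 1) {h : ℂ} (hh : ‖h‖ ≤ R / 4) :
    ‖f (c + h) - ∑ m ∈ Finset.range n, taylorCoeff f m c * h ^ m‖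
      ≤ 2 * M * (2 / R) ^ n * ‖h‖ ^ n := by
  have hR := hf.radius_pos
  have hM := hf.bound_nonneg
  have hmem : (c : ℂ) + h ∈ Metric.ball (c : ℂ) R := by
    rw [Metric.mem_ball, dist_eq_norm, add_sub_cancel_left]; linarith
  have hs := Complex.hasSum_taylorSeries_on_ball (hf.differentiableOn_ball c hc) hmem
  have hs' : HasSum (fun m => taylorCoeff f m c * h ^ m) (f (c + h)) := by
    refine hs.congr_fun fun m => ?_
    rw [taylorCoeff, smul_eq_mul, smul_eq_mul, add_sub_cancel_left]
    field_simp
  set x : ℝ := 2 / R * ‖h‖ with hx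
  have hx0 : 0 ≤ x := by positivity
  have hx1 : x ≤ 1 / 2 := by
    rw [hx, div_mul_eq_mul_div, div_le_iff₀ hR]; linarith
  have hb : ∀ m, ‖taylorCoeff f m c * h ^ m‖ ≤ M * x ^ m := fun m => by
    rw [norm_mul, norm_pow]
    calc _ ≤ M / (R / 2) ^ m * ‖h‖ ^ m := by gcongr; exact hf.norm_taylorCoeff_le m hc
      _ = _ := by rw [hx, mul_pow, div_pow, div_pow]; field_simp
  have hs2 := (hasSum_nat_add_iff' n).mpr hs'
  have hg : HasSum (fun m => M * x ^ (m + n)) (M * x ^ n * (1 - x)⁻¹) := by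
    have := (hasSum_geometric_of_lt_one hx0 (by linarith)).mul_left (M * x ^ n)
    refine this.congr_fun fun m => ?_
    ring
  rw [← hs2.tsum_eq]
  calc _ ≤ M * x ^ n * (1 - x)⁻¹ := tsum_of_norm_bounded hg (fun m => hb (m + n))
    _ ≤ M * x ^ n * 2 := by
      gcongr
      rw [inv_le_comm₀ (by linarith) (by norm_num)]; linarith
    _ = _ := by rw [hx, mul_pow]; ring

theorem continuous_comp (hf : IsAmplitude f R M p) {X : Type*} [TopologicalSpace X] {T : X → ℂ}
    (hT : Continuous T) (hpos : ∀ x, 0 < (T x).re) : Continuous fun x => f (T x) := by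
  rw [continuous_iff_continuousAt]
  exact fun x => ContinuousAt.comp (hf.differentiableAt _ (hpos x)).continuousAt hT.continuousAt

theorem mul_id (hf : IsAmplitude f R M p) :
    IsAmplitude (fun t => f t * t) R (2 * M) (p + 1) where
  radius_pos := hf.radius_pos
  radius_le := hf.radius_le
  bound_nonneg := by linarith [hf.bound_nonneg]
  differentiableAt t ht := (hf.differentiableAt t ht).mul differentiableAt_id
  differentiableOn_ball c hc := (hf.differentiableOn_ball c hc).mul differentiableOn_id
  norm_le_of_mem_ball c hc t ht := by
    have h1 : ‖t‖ ≤ 2 := by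
      have : ‖t‖ ≤ ‖(c : ℂ)‖ + ‖t - c‖ := by simpa using norm_add_le (c : ℂ) (t - c)
      rw [Metric.mem_ball, dist_eq_norm] at ht
      rw [Complex.norm_real, Real.norm_of_nonneg hc.1] at this
      linarith [hc.2, hf.radius_le]
    rw [norm_mul, mul_comm]
    exact mul_le_mul h1 (hf.norm_le_of_mem_ball c hc t ht) (norm_nonneg _) (by norm_num)
  norm_le t ht := by
    have h1 := hf.norm_le t ht
    have h2 := hf.bound_nonneg
    rw [norm_mul]
    calc _ ≤ M * (1 + ‖t‖) ^ p * (1 + ‖t‖) := by gcongr; linarith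
      _ ≤ 2 * M * (1 + ‖t‖) ^ (p + 1) := by
        have : 0 ≤ M * (1 + ‖t‖) ^ (p + 1) := by positivity
        rw [mul_assoc, ← pow_succ]; linarith

theorem differentiableOn_iteratedDeriv (hf : IsAmplitude f R M p) (m : ℕ) :
    DifferentiableOn ℂ (iteratedDeriv m f) {t | 0 < t.re} := by
  have ho : IsOpen {t : ℂ | 0 < t.re} := isOpen_lt continuous_const Complex.continuous_re
  induction m with
  | zero =>
    rw [iteratedDeriv_zero]
    exact fun t ht => (hf.differentiableAt t ht).differentiableWithinAt
  | succ n ih => rw [iteratedDeriv_succ]; exact ih.deriv ho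

theorem contDiffOn_taylorCoeff (hf : IsAmplitude f R M p) (m : ℕ) :
    ContDiffOn ℝ ∞ (taylorCoeff f m) {t | 0 < t.re} := by
  have ho : IsOpen {t : ℂ | 0 < t.re} := isOpen_lt continuous_const Complex.continuous_re
  have h : ContDiffOn ℂ ∞ (taylorCoeff f m) {t | 0 < t.re} :=
    ((hf.differentiableOn_iteratedDeriv m).contDiffOn ho).div_const _
  exact h.restrict_scalars ℝ

end IsAmplitude

/-- The square root `√(t² + b²)`, holomorphic off the cuts from `± i b` along the imaginary axis. -/
noncomputable def shiftedSqrt (b : ℝ) (t : ℂ) : ℂ := (t ^ 2 + (b : ℂ) ^ 2) ^ (2⁻¹ : ℂ)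

theorem shiftedSqrt_sq (b : ℝ) (t : ℂ) : shiftedSqrt b t ^ 2 = t ^ 2 + (b : ℂ) ^ 2 := by
  rw [shiftedSqrt, ← Complex.cpow_ofNat_inv_pow (t ^ 2 + (b : ℂ) ^ 2) 2]; simp

theorem re_shiftedSqrt_nonneg (b : ℝ) (t : ℂ) : 0 ≤ (shiftedSqrt b t).re := by
  rw [shiftedSqrt, Complex.cpow_inv_two_re]; positivity

theorem sq_add_sq_mem_slitPlane {b : ℝ} (hb : 0 < b) {t : ℂ} (ht : 0 < t.re ∨ |t.im| < b) :
    t ^ 2 + (b : ℂ) ^ 2 ∈ Complex.slitPlane := by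
  rw [Complex.mem_slitPlane_iff]
  have hre : (t ^ 2 + (b : ℂ) ^ 2).re = t.re ^ 2 - t.im ^ 2 + b ^ 2 := by
    simp [pow_two]
  have him : (t ^ 2 + (b : ℂ) ^ 2).im = 2 * (t.re * t.im) := by
    simp [pow_two]; ring
  rw [hre, him]
  by_contra! hcon
  obtain ⟨h1, h2⟩ := hcon
  have h2' : t.re = 0 ∨ t.im = 0 := by
    rcases mul_eq_zero.1 h2 with h | h
    · norm_num at h
    · exact mul_eq_zero.1 h
  rcases h2' with h3 | h3
  · rcases ht with h4 | h4
    · linarith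
    · rw [h3] at h1
      have := sq_lt_sq' (by linarith [abs_lt.1 h4]) (abs_lt.1 h4).2
      nlinarith
  · rw [h3] at h1
    nlinarith [sq_nonneg t.re, pow_pos hb 2]

theorem differentiableAt_shiftedSqrt {b : ℝ} (hb : 0 < b) {t : ℂ} (ht : 0 < t.re ∨ |t.im| < b) :
    DifferentiableAt ℂ (shiftedSqrt b) t := by
  unfold shiftedSqrt
  exact DifferentiableAt.cpow (by fun_prop) (by fun_prop) (sq_add_sq_mem_slitPlane hb ht)

theorem re_shiftedSqrt_pos {b : ℝ} (hb : 0 < b) {t : ℂ} (ht : 0 < t.re ∨ |t.im| < b) :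
    0 < (shiftedSqrt b t).re := by
  rw [shiftedSqrt, Complex.cpow_inv_two_re]
  apply Real.sqrt_pos.2
  have := Complex.mem_slitPlane_iff_not_le_zero.1 (sq_add_sq_mem_slitPlane hb ht)
  set z := t ^ 2 + (b : ℂ) ^ 2
  have h1 := Complex.abs_re_le_norm z
  have h2 := neg_abs_le z.re
  rcases (show 0 ≤ ‖z‖ + z.re by linarith).lt_or_eq with h | h
  · linarith
  · exfalso
    apply this
    have h3 : ‖z‖ = |z.re| := le_antisymm (by linarith) h1
    have h4 : z.im = 0 := by
      rw [Eq.comm, Complex.abs_re_eq_norm] at h3; exact h3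
    rw [Complex.le_def]
    refine ⟨?_, by simp [h4]⟩
    simp; linarith [norm_nonneg z]

theorem norm_shiftedSqrt_le {b : ℝ} (hb : 0 ≤ b) (t : ℂ) : ‖shiftedSqrt b t‖ ≤ ‖t‖ + b := by
  have h : ‖shiftedSqrt b t‖ ^ 2 ≤ (‖t‖ + b) ^ 2 := by
    rw [← norm_pow, shiftedSqrt_sq]
    calc _ ≤ ‖t ^ 2‖ + ‖(b : ℂ) ^ 2‖ := norm_add_le _ _
      _ = ‖t‖ ^ 2 + b ^ 2 := by simp
      _ ≤ _ := by nlinarith [norm_nonneg t]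
  exact le_of_sq_le_sq h (by positivity)

theorem shiftedSqrt_ofReal (b : ℝ) (t : ℝ) : shiftedSqrt b t = (√(t ^ 2 + b ^ 2) : ℂ) := by
  rw [shiftedSqrt, Real.sqrt_eq_rpow, Complex.ofReal_cpow (by positivity)]
  simp

/-- The transmission coefficient as a function of the normalized vertical frequency
`t = √(1 + γ₋ ρ²)`, multiplied by `√γ₋` and continued to complex `t`. -/
noncomputable def refractedAmplitude (γp γm : ℝ) (t : ℂ) : ℂ :=
  4 * γp * γm * shiftedSqrt (√(γm / γp - 1)) t /
    (γp * shiftedSqrt (√(γm / γp - 1)) t + γm * t) * t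

/-- The radius of the discs on which the refracted amplitude is controlled: the branch points of
`√(t² + b²)` and the zero of the denominator keep a distance from `[0, 1]` because `γ₊ < γ₋`. -/
noncomputable def amplitudeRadius (γp γm : ℝ) : ℝ :=
  min 1 (γp * √(γm / γp - 1) / (4 * γm))

theorem isAmplitude_refractedAmplitude {γp γm : ℝ} (hγp : 0 < γp) (hγ : γp < γm) :
    ∃ M, IsAmplitude (refractedAmplitude γp γm) (amplitudeRadius γp γm) M 1 := by
  have hγm : 0 < γm := hγp.trans hγ
  set b := √(γm / γp - 1) with hb_def
  have hb : 0 < b := Real.sqrt_pos.2 (by rw [sub_pos, lt_div_iff₀ hγp]; linarith)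
  set R := amplitudeRadius γp γm with hR_def
  have hR : 0 < R := lt_min one_pos (by positivity)
  have hR1 : R ≤ 1 := min_le_left _ _
  have hR2 : γm * R ≤ γp * b / 4 := by
    have : R ≤ γp * b / (4 * γm) := min_le_right _ _
    rw [le_div_iff₀ (by positivity)] at this
    linarith
  have hRb : R ≤ b / 4 := by
    have : γp * R ≤ γm * R := by gcongr
    have : γp * R ≤ γp * (b / 4) := by linarith
    exact le_of_mul_le_mul_left this hγp
  have hdiff : ∀ t : ℂ, (0 < t.re ∨ |t.im| < b) →
      (γp : ℂ) * shiftedSqrt b t + γm * t ≠ 0 →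
      DifferentiableAt ℂ (refractedAmplitude γp γm) t := by
    intro t ht hne
    have := differentiableAt_shiftedSqrt hb ht
    unfold refractedAmplitude
    fun_prop (disch := assumption)
  -- On the discs around `[0, 1]` the root has real part at least `b / 2`, whereas the real part of
  -- `γm * t` is at least `-γm * R ≥ -γp * b / 4`.
  have hball : ∀ c ∈ Set.Icc (0 : ℝ) 1, ∀ t ∈ Metric.ball (c : ℂ) R,
      |t.im| < b ∧ ‖t‖ ≤ 2 ∧ γp * b / 4 ≤ ‖(γp : ℂ) * shiftedSqrt b t + γm * t‖ := by
    intro c hc t ht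
    rw [Metric.mem_ball, dist_eq_norm] at ht
    have him : |t.im| < R := by
      have := Complex.abs_im_le_norm (t - c)
      simp at this; linarith
    have hre : -R < t.re := by
      have := (abs_le.1 (Complex.abs_re_le_norm (t - c))).1
      simp at this; linarith [hc.1]
    refine ⟨by linarith, ?_, ?_⟩
    · have : ‖t‖ ≤ ‖(c : ℂ)‖ + ‖t - c‖ := by simpa using norm_add_le (c : ℂ) (t - c)
      rw [Complex.norm_real, Real.norm_of_nonneg hc.1] at this
      linarith [hc.2]
    · have h1 : b / 2 ≤ (shiftedSqrt b t).re := by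
        have h2 : (shiftedSqrt b t ^ 2).re = t.re ^ 2 - t.im ^ 2 + b ^ 2 := by
          rw [shiftedSqrt_sq]; simp [pow_two]
        have h3 : (shiftedSqrt b t ^ 2).re
            = (shiftedSqrt b t).re ^ 2 - (shiftedSqrt b t).im ^ 2 := by simp [pow_two]
        have h4 : t.im ^ 2 ≤ (b / 4) ^ 2 := sq_le_sq' (by linarith [abs_lt.1 him])
          (by linarith [(abs_lt.1 him).2])
        refine le_of_sq_le_sq ?_ (re_shiftedSqrt_nonneg b t)
        nlinarith [sq_nonneg t.re, sq_nonneg (shiftedSqrt b t).im]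
      refine le_trans ?_ (Complex.re_le_norm _)
      simp only [Complex.add_re, Complex.mul_re, Complex.ofReal_re, Complex.ofReal_im, zero_mul,
        sub_zero]
      nlinarith
  -- In the right half-plane the root lies in the quadrant of `t`, so that the two summands of the
  -- denominator do not cancel.
  have hright : ∀ t : ℂ, 0 < t.re →
      ‖(γp : ℂ) * shiftedSqrt b t‖ ≤ ‖(γp : ℂ) * shiftedSqrt b t + γm * t‖ := by
    intro t ht
    set q := shiftedSqrt b t with hq
    have hqre : 0 < q.re := re_shiftedSqrt_pos hb (Or.inl ht)
    have h2 : 2 * (q.re * q.im) = 2 * (t.re * t.im) := by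
      have := congrArg Complex.im (shiftedSqrt_sq b t)
      rw [← hq] at this
      simp [pow_two] at this; linarith
    have h3 : 0 ≤ q.im * t.im := by
      have : q.re * (q.im * t.im) = t.re * t.im ^ 2 := by
        linear_combination t.im / 2 * h2
      nlinarith [show 0 ≤ t.re * t.im ^ 2 by positivity]
    rw [← sq_le_sq₀ (norm_nonneg _) (norm_nonneg _), Complex.sq_norm, Complex.sq_norm,
      Complex.normSq_apply, Complex.normSq_apply]
    simp only [Complex.add_re, Complex.mul_re, Complex.ofReal_re, Complex.ofReal_im, zero_mul,
      sub_zero, Complex.add_im, Complex.mul_im, add_zero]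
    have h4 : 0 ≤ γp * γm * (q.re * t.re) := by positivity
    have h5 : 0 ≤ γp * γm * (q.im * t.im) := by positivity
    nlinarith [sq_nonneg (γm * t.re), sq_nonneg (γm * t.im)]
  set M := 4 * γm + 4 * γp * γm * (2 + b) / (γp * b / 4) * 2 with hM
  have hM1 : 4 * γm ≤ M := le_add_of_nonneg_right (by positivity)
  have hM2 : 4 * γp * γm * (2 + b) / (γp * b / 4) * 2 ≤ M := le_add_of_nonneg_left (by positivity)
  refine ⟨M, hR, hR1, by positivity, fun t ht => ?_, fun c hc t ht => ?_,
    fun c hc t ht => ?_, fun t ht => ?_⟩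
  · refine hdiff t (Or.inl ht) fun h0 => ?_
    have h1 := hright t ht
    rw [h0, norm_zero, norm_mul, Complex.norm_real, Real.norm_of_nonneg hγp.le] at h1
    have h2 : 0 < (shiftedSqrt b t).re := re_shiftedSqrt_pos hb (Or.inl ht)
    have h3 := Complex.re_le_norm (shiftedSqrt b t)
    nlinarith
  · obtain ⟨h1, -, h3⟩ := hball c hc t ht
    refine (hdiff t (Or.inr h1) fun h0 => ?_).differentiableWithinAt
    rw [h0, norm_zero] at h3
    have : 0 < γp * b / 4 := by positivity
    linarith
  · obtain ⟨h1, h2, h3⟩ := hball c hc t ht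
    refine le_trans ?_ hM2
    have h4 := norm_shiftedSqrt_le hb.le t
    rw [refractedAmplitude, norm_mul, norm_div, norm_mul, norm_mul, norm_mul]
    simp only [Complex.norm_real, Real.norm_of_nonneg hγp.le, Real.norm_of_nonneg hγm.le,
      Complex.norm_ofNat]
    rw [← hb_def]
    gcongr
    linarith
  · have h1 := hright t ht
    have h2 : 0 < (shiftedSqrt b t).re := re_shiftedSqrt_pos hb (Or.inl ht)
    have h3 := Complex.re_le_norm (shiftedSqrt b t)
    have h4 : 0 < ‖(γp : ℂ) * shiftedSqrt b t‖ := by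
      rw [norm_mul, Complex.norm_real, Real.norm_of_nonneg hγp.le]
      exact mul_pos hγp (by linarith)
    rw [refractedAmplitude, norm_mul, norm_div, ← hb_def, pow_one]
    have h5 : ‖(4 * γp * γm * shiftedSqrt b t : ℂ)‖ = 4 * γm * ‖(γp : ℂ) * shiftedSqrt b t‖ := by
      simp only [norm_mul, Complex.norm_real, Real.norm_of_nonneg hγp.le,
        Real.norm_of_nonneg hγm.le, Complex.norm_ofNat]
      ring
    have h6 : ‖(4 * γp * γm * shiftedSqrt b t : ℂ)‖ /
        ‖(γp : ℂ) * shiftedSqrt b t + γm * t‖ ≤ 4 * γm := by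
      rw [div_le_iff₀ (by linarith), h5]
      gcongr
    calc _ ≤ 4 * γm * (1 + ‖t‖) := by gcongr; linarith
      _ ≤ M * (1 + ‖t‖) := by gcongr

/-! ### Uniform expansions with smooth coefficients -/

/-- A coefficient function that is smooth and bounded on the lower half-space. -/
def IsBoundedSmooth (κ : EuclideanSpace ℝ (Fin 3) → ℂ) : Prop :=
  ContDiffOn ℝ ∞ κ lowerHalfSpace ∧ ∃ C, ∀ w ∈ lowerHalfSpace, ‖κ w‖ ≤ C

namespace IsBoundedSmooth

variable {κ κ' : EuclideanSpace ℝ (Fin 3) → ℂ}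

theorem const (a : ℂ) : IsBoundedSmooth fun _ => a :=
  ⟨contDiffOn_const, ‖a‖, fun _ _ => le_rfl⟩

theorem add (h : IsBoundedSmooth κ) (h' : IsBoundedSmooth κ') :
    IsBoundedSmooth fun w => κ w + κ' w := by
  obtain ⟨h1, C, hC⟩ := h
  obtain ⟨h2, C', hC'⟩ := h'
  exact ⟨h1.add h2, C + C', fun w hw => norm_add_le_of_le (hC w hw) (hC' w hw)⟩

theorem mul (h : IsBoundedSmooth κ) (h' : IsBoundedSmooth κ') :
    IsBoundedSmooth fun w => κ w * κ' w := by
  obtain ⟨h1, C, hC⟩ := h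
  obtain ⟨h2, C', hC'⟩ := h'
  refine ⟨h1.mul h2, C * C', fun w hw => ?_⟩
  rw [norm_mul]
  exact mul_le_mul (hC w hw) (hC' w hw) (norm_nonneg _) ((norm_nonneg _).trans (hC w hw))

theorem pow (h : IsBoundedSmooth κ) (n : ℕ) : IsBoundedSmooth fun w => κ w ^ n := by
  induction n with
  | zero => simpa using const 1
  | succ n ih => simpa only [pow_succ] using ih.mul h

theorem congr (h : IsBoundedSmooth κ) (h' : ∀ w ∈ lowerHalfSpace, κ' w = κ w) :
    IsBoundedSmooth κ' := by
  obtain ⟨h1, C, hC⟩ := h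
  exact ⟨h1.congr h', C, fun w hw => by rw [h' w hw]; exact hC w hw⟩

end IsBoundedSmooth

/-- `h w u` has an expansion in powers of `u` up to order `N` on `[0, u₀]`, with coefficients that
are smooth in `w` and with a remainder that is uniform in `w`. -/
def HasUniformExpansion (u₀ : ℝ) (N : ℕ) (h : EuclideanSpace ℝ (Fin 3) → ℝ → ℂ) : Prop :=
  ∃ κ : ℕ → EuclideanSpace ℝ (Fin 3) → ℂ, (∀ j, IsBoundedSmooth (κ j)) ∧
    ∃ C : ℝ, 0 ≤ C ∧ ∀ w ∈ lowerHalfSpace, ∀ u ∈ Set.Icc 0 u₀,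
      ‖h w u - ∑ j ∈ Finset.range N, κ j w * (u : ℂ) ^ j‖ ≤ C * u ^ N

namespace HasUniformExpansion

variable {u₀ : ℝ} {N : ℕ} {h h' : EuclideanSpace ℝ (Fin 3) → ℝ → ℂ}

/-- An error of order `u ^ N` does not affect an expansion. -/
theorem congr_of_le (hh : HasUniformExpansion u₀ N h) {C' : ℝ} (hC' : 0 ≤ C')
    (hle : ∀ w ∈ lowerHalfSpace, ∀ u ∈ Set.Icc 0 u₀, ‖h' w u - h w u‖ ≤ C' * u ^ N) :
    HasUniformExpansion u₀ N h' := by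
  obtain ⟨κ, hκ, C, hC, hb⟩ := hh
  refine ⟨κ, hκ, C' + C, by positivity, fun w hw u hu => ?_⟩
  rw [add_mul, ← sub_add_sub_cancel _ (h w u)]
  exact norm_add_le_of_le (hle w hw u hu) (hb w hw u hu)

theorem congr (hh : HasUniformExpansion u₀ N h)
    (he : ∀ w ∈ lowerHalfSpace, ∀ u ∈ Set.Icc 0 u₀, h' w u = h w u) :
    HasUniformExpansion u₀ N h' :=
  hh.congr_of_le le_rfl fun w hw u hu => by rw [he w hw u hu]; simp

theorem zero : HasUniformExpansion u₀ N fun _ _ => 0 :=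
  ⟨fun _ _ => 0, fun _ => .const 0, 0, le_rfl, by simp⟩

theorem add (hh : HasUniformExpansion u₀ N h) (hh' : HasUniformExpansion u₀ N h') :
    HasUniformExpansion u₀ N fun w u => h w u + h' w u := by
  obtain ⟨κ, hκ, C, hC, hb⟩ := hh
  obtain ⟨κ', hκ', C', hC', hb'⟩ := hh'
  refine ⟨fun j w => κ j w + κ' j w, fun j => (hκ j).add (hκ' j), C + C', by positivity,
    fun w hw u hu => ?_⟩
  simp only [add_mul, Finset.sum_add_distrib]
  rw [add_sub_add_comm]
  exact norm_add_le_of_le (hb w hw u hu) (hb' w hw u hu)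

theorem sum {ι : Type*} (s : Finset ι) {H : ι → EuclideanSpace ℝ (Fin 3) → ℝ → ℂ}
    (hH : ∀ i ∈ s, HasUniformExpansion u₀ N (H i)) :
    HasUniformExpansion u₀ N fun w u => ∑ i ∈ s, H i w u := by
  classical
  induction s using Finset.induction_on with
  | empty => simpa using zero
  | insert a s ha ih =>
    simp only [Finset.sum_insert ha]
    exact (hH a (Finset.mem_insert_self _ _)).add
      (ih fun i hi => hH i (Finset.mem_insert_of_mem hi))

theorem const_mul {g : EuclideanSpace ℝ (Fin 3) → ℂ} (hg : IsBoundedSmooth g)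
    (hh : HasUniformExpansion u₀ N h) : HasUniformExpansion u₀ N fun w u => g w * h w u := by
  obtain ⟨κ, hκ, C, hC, hb⟩ := hh
  obtain ⟨B, hB⟩ := hg.2
  refine ⟨fun j w => g w * κ j w, fun j => hg.mul (hκ j), |B| * C, by positivity,
    fun w hw u hu => ?_⟩
  simp only [mul_assoc, ← Finset.mul_sum]
  rw [← mul_sub, norm_mul]
  exact mul_le_mul ((hB w hw).trans (le_abs_self B)) (hb w hw u hu) (norm_nonneg _) (abs_nonneg _)

theorem one : HasUniformExpansion u₀ N fun _ _ => 1 := by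
  cases N with
  | zero => exact ⟨fun _ _ => 0, fun _ => .const 0, 1, zero_le_one, by simp⟩
  | succ N =>
    refine ⟨fun j _ => if j = 0 then 1 else 0, fun j => .const _, 0, le_rfl, fun w hw u hu => ?_⟩
    simp

theorem mul_u (hh : HasUniformExpansion u₀ N h) :
    HasUniformExpansion u₀ N fun w u => (u : ℂ) * h w u := by
  obtain ⟨κ, hκ, C, hC, hb⟩ := hh
  cases N with
  | zero =>
    refine ⟨κ, hκ, |u₀| * C, by positivity, fun w hw u hu => ?_⟩
    have := hb w hw u hu
    simp only [Finset.range_zero, Finset.sum_empty, sub_zero, pow_zero, mul_one, norm_mul,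
      Complex.norm_real, Real.norm_of_nonneg hu.1] at this ⊢
    exact mul_le_mul (hu.2.trans (le_abs_self _)) this (norm_nonneg _) (abs_nonneg _)
  | succ n =>
    obtain ⟨B, hB⟩ := (hκ n).2
    refine ⟨fun j => if j = 0 then fun _ => 0 else κ (j - 1), fun j => ?_, C * |u₀| + |B|,
      by positivity, fun w hw u hu => ?_⟩
    · by_cases hj : j = 0
      · simpa [hj] using IsBoundedSmooth.const 0
      · simpa [hj] using hκ (j - 1)
    · have h1 := hb w hw u hu
      rw [Finset.sum_range_succ']
      simp only [Nat.add_eq_zero_iff, one_ne_zero, and_false, if_false, if_true, zero_mul, add_zero,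
        Nat.add_sub_cancel]
      have h2 : (u : ℂ) * h w u - ∑ k ∈ Finset.range n, κ k w * (u : ℂ) ^ (k + 1)
          = u * (h w u - ∑ k ∈ Finset.range (n + 1), κ k w * (u : ℂ) ^ k)
            + κ n w * (u : ℂ) ^ (n + 1) := by
        rw [Finset.sum_range_succ, mul_sub, mul_add, Finset.mul_sum]
        have : ∀ k, (u : ℂ) * (κ k w * (u : ℂ) ^ k) = κ k w * (u : ℂ) ^ (k + 1) := fun k => by ring
        simp only [this]
        ring
      rw [h2, add_mul]
      have hu0 : 0 ≤ u := hu.1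
      refine norm_add_le_of_le ?_ ?_
      · rw [norm_mul, Complex.norm_real, Real.norm_of_nonneg hu0]
        calc _ ≤ |u₀| * (C * u ^ (n + 1)) :=
              mul_le_mul (hu.2.trans (le_abs_self _)) h1 (norm_nonneg _) (abs_nonneg _)
          _ = _ := by ring
      · rw [norm_mul, norm_pow, Complex.norm_real, Real.norm_of_nonneg hu0]
        gcongr
        exact (hB w hw).trans (le_abs_self _)

theorem mul_u_pow (hh : HasUniformExpansion u₀ N h) (k : ℕ) :
    HasUniformExpansion u₀ N fun w u => (u : ℂ) ^ k * h w u := by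
  induction k with
  | zero => simpa using hh
  | succ k ih => simpa only [pow_succ', mul_assoc] using ih.mul_u

theorem mul_quadratic_pow (hh : HasUniformExpansion u₀ N h) (k : ℕ) :
    HasUniformExpansion u₀ N fun w u => ((u : ℂ) ^ 2 + 2 * u) ^ k * h w u := by
  induction k with
  | zero => simpa using hh
  | succ k ih =>
    refine ((ih.mul_u_pow 2).add ((ih.mul_u).const_mul (.const 2))).congr fun w _ u _ => ?_
    ring

/-- The order of an expansion can be lowered. -/
theorem exists_bound_of_le {κ : ℕ → EuclideanSpace ℝ (Fin 3) → ℂ} (hκ : ∀ j, IsBoundedSmooth (κ j))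
    (hu₀ : u₀ ≤ 1) {n : ℕ} (hn : n ≤ N)
    (hb : ∃ C : ℝ, 0 ≤ C ∧ ∀ w ∈ lowerHalfSpace, ∀ u ∈ Set.Icc 0 u₀,
      ‖h w u - ∑ j ∈ Finset.range N, κ j w * (u : ℂ) ^ j‖ ≤ C * u ^ N) :
    ∃ C : ℝ, 0 ≤ C ∧ ∀ w ∈ lowerHalfSpace, ∀ u ∈ Set.Icc 0 u₀,
      ‖h w u - ∑ j ∈ Finset.range n, κ j w * (u : ℂ) ^ j‖ ≤ C * u ^ n := by
  induction N, hn using Nat.le_induction with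
  | base => exact hb
  | succ N hN ih =>
    refine ih ?_
    obtain ⟨C, hC, hb⟩ := hb
    obtain ⟨B, hB⟩ := (hκ N).2
    refine ⟨C + |B|, by positivity, fun w hw u hu => ?_⟩
    have h1 := hb w hw u hu
    rw [Finset.sum_range_succ, ← sub_sub] at h1
    have h2 : ‖κ N w * (u : ℂ) ^ N‖ ≤ |B| * u ^ N := by
      rw [norm_mul, norm_pow, Complex.norm_real, Real.norm_of_nonneg hu.1]
      have := hu.1
      gcongr
      exact (hB w hw).trans (le_abs_self _)
    have h3 : C * u ^ (N + 1) ≤ C * u ^ N :=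
      mul_le_mul_of_nonneg_left (pow_le_pow_of_le_one hu.1 (hu.2.trans hu₀) (Nat.le_succ N)) hC
    calc _ ≤ ‖h w u - ∑ j ∈ Finset.range N, κ j w * (u : ℂ) ^ j - κ N w * (u : ℂ) ^ N‖
          + ‖κ N w * (u : ℂ) ^ N‖ := by
            simpa using norm_add_le (h w u - ∑ j ∈ Finset.range N, κ j w * (u : ℂ) ^ j
              - κ N w * (u : ℂ) ^ N) (κ N w * (u : ℂ) ^ N)
      _ ≤ _ := by rw [add_mul]; linarith

end HasUniformExpansion

/-- A polynomial of degree less than `N` that is `O(u ^ N)` at `0` vanishes. -/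
theorem eq_zero_of_sum_mul_pow_le {u₀ : ℝ} (hu₀ : 0 < u₀) {a : ℕ → ℂ} {N : ℕ} {C : ℝ}
    (h : ∀ u ∈ Set.Ioc 0 u₀, ‖∑ j ∈ Finset.range N, a j * (u : ℂ) ^ j‖ ≤ C * u ^ N) :
    ∀ j < N, a j = 0 := by
  induction N generalizing C with
  | zero => simp
  | succ n ih =>
    have h1 : ∀ j < n, a j = 0 := by
      refine ih (C := |C| * u₀ + ‖a n‖) fun u hu => ?_
      have h2 := h u hu
      have hu0 := hu.1.le
      rw [Finset.sum_range_succ] at h2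
      have h3 := norm_sub_le (∑ j ∈ Finset.range n, a j * (u : ℂ) ^ j + a n * (u : ℂ) ^ n)
        (a n * (u : ℂ) ^ n)
      rw [add_sub_cancel_right, norm_mul (a n), norm_pow, Complex.norm_real,
        Real.norm_of_nonneg hu.1.le] at h3
      have h4 : C * u ^ (n + 1) ≤ |C| * u₀ * u ^ n := by
        rw [pow_succ', ← mul_assoc]
        gcongr
        · exact le_abs_self C
        · exact hu.2
      rw [add_mul]; linarith
    have h2 : ∀ u ∈ Set.Ioc 0 u₀, ‖a n‖ ≤ C * u := by
      intro u hu
      have h3 := h u hu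
      rw [Finset.sum_range_succ, Finset.sum_eq_zero (fun j hj => by
        rw [h1 j (Finset.mem_range.1 hj), zero_mul]), zero_add, norm_mul, norm_pow,
        Complex.norm_real, Real.norm_of_nonneg hu.1.le, pow_succ', ← mul_assoc] at h3
      exact le_of_mul_le_mul_right h3 (pow_pos hu.1 n)
    have h3 : a n = 0 := by
      rw [← norm_le_zero_iff]
      have ht : Tendsto (fun u : ℝ => C * u) (𝓝[>] 0) (𝓝 0) := by
        have : Tendsto (fun u : ℝ => C * u) (𝓝 0) (𝓝 (C * 0)) := by
          exact (continuous_const.mul continuous_id).tendsto 0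
        rw [mul_zero] at this
        exact this.mono_left nhdsWithin_le_nhds
      exact ge_of_tendsto ht (by
        filter_upwards [Ioc_mem_nhdsGT hu₀] with u hu using h2 u hu)
    intro j hj
    rcases Nat.lt_succ_iff_lt_or_eq.1 hj with hj | rfl
    · exact h1 j hj
    · exact h3

/-- Expansions of all orders have a common sequence of coefficients, since the coefficients of an
asymptotic expansion are unique. -/
theorem exists_coeff_of_hasUniformExpansion {u₀ : ℝ} (hu₀ : 0 < u₀) (hu₁ : u₀ ≤ 1)
    {h : EuclideanSpace ℝ (Fin 3) → ℝ → ℂ} (hh : ∀ N, HasUniformExpansion u₀ N h) :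
    ∃ κ : ℕ → EuclideanSpace ℝ (Fin 3) → ℂ, (∀ j, IsBoundedSmooth (κ j)) ∧
      (∀ w ∈ lowerHalfSpace, κ 0 w = h w 0) ∧
      ∀ N, ∃ C : ℝ, 0 ≤ C ∧ ∀ w ∈ lowerHalfSpace, ∀ u ∈ Set.Icc 0 u₀,
        ‖h w u - ∑ j ∈ Finset.range N, κ j w * (u : ℂ) ^ j‖ ≤ C * u ^ N := by
  choose κ hκ hb using hh
  have hkey : ∀ N j, j < N → ∀ w ∈ lowerHalfSpace, κ N j w = κ (j + 1) j w := by
    intro N j hj w hw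
    obtain ⟨C, hC, h1⟩ := HasUniformExpansion.exists_bound_of_le (hκ N) hu₁ (Nat.succ_le_of_lt hj) (hb N)
    obtain ⟨C', hC', h2⟩ := hb (j + 1)
    have := eq_zero_of_sum_mul_pow_le hu₀ (a := fun i => κ (j + 1) i w - κ N i w) (N := j + 1)
      (C := C + C') (fun u hu => ?_) j (Nat.lt_succ_self j)
    · exact (sub_eq_zero.1 this).symm
    · have hu' : u ∈ Set.Icc 0 u₀ := ⟨hu.1.le, hu.2⟩
      have h3 := norm_sub_le_of_le (h1 w hw u hu') (h2 w hw u hu')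
      rw [sub_sub_sub_cancel_left, ← Finset.sum_sub_distrib] at h3
      simp only [sub_mul, add_mul]
      exact h3
  have hex : ∀ N, ∃ C : ℝ, 0 ≤ C ∧ ∀ w ∈ lowerHalfSpace, ∀ u ∈ Set.Icc 0 u₀,
        ‖h w u - ∑ j ∈ Finset.range N, κ (j + 1) j w * (u : ℂ) ^ j‖ ≤ C * u ^ N := by
    intro N
    obtain ⟨C, hC, h1⟩ := hb N
    refine ⟨C, hC, fun w hw u hu => ?_⟩
    have he : ∑ j ∈ Finset.range N, κ (j + 1) j w * (u : ℂ) ^ j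
        = ∑ j ∈ Finset.range N, κ N j w * (u : ℂ) ^ j :=
      Finset.sum_congr rfl fun j hj => by rw [hkey N j (Finset.mem_range.1 hj) w hw]
    rw [he]
    exact h1 w hw u hu
  refine ⟨fun j => κ (j + 1) j, fun j => hκ _ _, fun w hw => ?_, hex⟩
  obtain ⟨C, hC, h1⟩ := hex 1
  have := h1 w hw 0 ⟨le_rfl, hu₀.le⟩
  simp only [Finset.range_one, Finset.sum_singleton, Complex.ofReal_zero, pow_zero, mul_one,
    pow_one, mul_zero, norm_le_zero_iff] at this
  exact (sub_eq_zero.1 this).symm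

/-! ### Angular means of an amplitude -/

/-- The cosine of the angle between `w` and the downward vertical. -/
noncomputable def verticalCos (w : EuclideanSpace ℝ (Fin 3)) : ℝ := -(w 2) / ‖w‖

/-- The sine of the angle between `w` and the downward vertical. -/
noncomputable def verticalSin (w : EuclideanSpace ℝ (Fin 3)) : ℝ := ‖tangential w‖ / ‖w‖

theorem norm_tangential_sq (w : EuclideanSpace ℝ (Fin 3)) :
    ‖tangential w‖ ^ 2 = w 0 ^ 2 + w 1 ^ 2 := by
  simp [tangential, EuclideanSpace.norm_sq_eq, Fin.sum_univ_two]

theorem norm_sq_fin_three (w : EuclideanSpace ℝ (Fin 3)) :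
    ‖w‖ ^ 2 = w 0 ^ 2 + w 1 ^ 2 + w 2 ^ 2 := by
  simp [EuclideanSpace.norm_sq_eq, Fin.sum_univ_three]

theorem norm_pos_of_mem_lowerHalfSpace {w : EuclideanSpace ℝ (Fin 3)}
    (hw : w ∈ lowerHalfSpace) : 0 < ‖w‖ := by
  rw [norm_pos_iff]
  rintro rfl
  simp [lowerHalfSpace] at hw

theorem verticalCos_pos {w : EuclideanSpace ℝ (Fin 3)} (hw : w ∈ lowerHalfSpace) :
    0 < verticalCos w :=
  div_pos (neg_pos.2 hw) (norm_pos_of_mem_lowerHalfSpace hw)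

theorem verticalSin_nonneg (w : EuclideanSpace ℝ (Fin 3)) : 0 ≤ verticalSin w := by
  unfold verticalSin; positivity

theorem verticalCos_sq_add_verticalSin_sq {w : EuclideanSpace ℝ (Fin 3)}
    (hw : w ∈ lowerHalfSpace) : verticalCos w ^ 2 + verticalSin w ^ 2 = 1 := by
  have := norm_pos_of_mem_lowerHalfSpace hw
  rw [verticalCos, verticalSin, div_pow, div_pow, ← add_div, norm_tangential_sq,
    div_eq_one_iff_eq (by positivity), norm_sq_fin_three]
  ring

theorem verticalCos_le_one {w : EuclideanSpace ℝ (Fin 3)} (hw : w ∈ lowerHalfSpace) :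
    verticalCos w ≤ 1 := by
  nlinarith [verticalCos_sq_add_verticalSin_sq hw, sq_nonneg (verticalSin w)]

theorem verticalSin_le_one {w : EuclideanSpace ℝ (Fin 3)} (hw : w ∈ lowerHalfSpace) :
    verticalSin w ≤ 1 := by
  nlinarith [verticalCos_sq_add_verticalSin_sq hw, sq_nonneg (verticalCos w)]

theorem isBoundedSmooth_coord_div_norm (k : Fin 3) :
    IsBoundedSmooth fun w => ((w k / ‖w‖ : ℝ) : ℂ) := by
  refine ⟨?_, 1, fun w hw => ?_⟩
  · refine Complex.ofRealCLM.contDiff.comp_contDiffOn ?_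
    refine ContDiffOn.div ?_ ?_ fun w hw => (norm_pos_of_mem_lowerHalfSpace hw).ne'
    · exact (EuclideanSpace.proj (𝕜 := ℝ) k).contDiff.contDiffOn
    · exact contDiffOn_id.norm ℝ fun w hw => norm_pos_iff.1 (norm_pos_of_mem_lowerHalfSpace hw)
  · rw [Complex.norm_real, norm_div, norm_norm]
    exact div_le_one_of_le₀ (PiLp.norm_apply_le w k) (norm_nonneg _)

theorem isBoundedSmooth_verticalCos : IsBoundedSmooth fun w => (verticalCos w : ℂ) :=
  ((IsBoundedSmooth.const (-1)).mul (isBoundedSmooth_coord_div_norm 2)).congr fun w _ => by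
    simp [verticalCos, neg_div]

theorem isBoundedSmooth_verticalSin_sq : IsBoundedSmooth fun w => (verticalSin w : ℂ) ^ 2 :=
  ((IsBoundedSmooth.const 1).add ((IsBoundedSmooth.const (-1)).mul
    (isBoundedSmooth_verticalCos.pow 2))).congr fun w hw => by
    have := verticalCos_sq_add_verticalSin_sq hw
    have h2 : ((verticalCos w : ℂ)) ^ 2 + (verticalSin w : ℂ) ^ 2 = 1 := by exact_mod_cast this
    linear_combination h2

theorem IsAmplitude.isBoundedSmooth_taylorCoeff {f : ℂ → ℂ} {R M : ℝ} {p : ℕ}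
    (hf : IsAmplitude f R M p) (m : ℕ) :
    IsBoundedSmooth fun w => taylorCoeff f m (verticalCos w) := by
  refine ⟨(hf.contDiffOn_taylorCoeff m).comp isBoundedSmooth_verticalCos.1 fun w hw => ?_,
    M / (R / 2) ^ m, fun w hw => hf.norm_taylorCoeff_le m
      ⟨(verticalCos_pos hw).le, verticalCos_le_one hw⟩⟩
  simpa using verticalCos_pos hw

/-- The argument of the amplitude after the contour shift, in polar coordinates: `1 + u` is the
vertical and `√(u² + 2u)` the tangential frequency, `θ` the polar angle. -/
noncomputable def obliqueArg (c s u θ : ℝ) : ℂ :=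
  c * (1 + u) + Complex.I * (s * √(u ^ 2 + 2 * u) * Real.cos θ)

/-- The mean over `θ` of `f T * (i √(u² + 2u) cos θ) ^ e` with `T = obliqueArg c s u θ`. The factor
with `e = 1` is a tangential frequency, which enters through the derivatives of the wave. -/
noncomputable def angularMean (f : ℂ → ℂ) (e : ℕ) (c s u : ℝ) : ℂ :=
  ((2 * π)⁻¹ : ℂ) * ∫ θ in -π..π, f (obliqueArg c s u θ) *
    (Complex.I * (√(u ^ 2 + 2 * u) * Real.cos θ)) ^ e

theorem re_obliqueArg (c s u θ : ℝ) : (obliqueArg c s u θ).re = c * (1 + u) := by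
  simp [obliqueArg]

theorem continuous_obliqueArg (c s u : ℝ) : Continuous (obliqueArg c s u) := by
  unfold obliqueArg; fun_prop

theorem IsAmplitude.continuous_comp_obliqueArg {f : ℂ → ℂ} {R M : ℝ} {p : ℕ}
    (hf : IsAmplitude f R M p) {c u : ℝ} (s : ℝ) (hc : 0 < c) (hu : 0 ≤ u) :
    Continuous fun θ => f (obliqueArg c s u θ) :=
  hf.continuous_comp (continuous_obliqueArg c s u) fun θ => by rw [re_obliqueArg]; positivity

theorem norm_integral_neg_pi_pi_le {g : ℝ → ℂ} {C : ℝ} (hg : ∀ θ, ‖g θ‖ ≤ C) :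
    ‖((2 * π)⁻¹ : ℂ) * ∫ θ in -π..π, g θ‖ ≤ C := by
  have h := intervalIntegral.norm_integral_le_of_norm_le_const (a := -π) (b := π) (f := g)
    fun θ _ => hg θ
  have hpi := Real.pi_pos
  rw [norm_mul, norm_inv, norm_mul, Complex.norm_real, Complex.norm_ofNat,
    Real.norm_of_nonneg hpi.le]
  rw [sub_neg_eq_add, abs_of_pos (by positivity)] at h
  rw [inv_mul_le_iff₀ (by positivity)]
  linarith

theorem sqrt_quadratic_le {u : ℝ} (hu : 0 ≤ u) : √(u ^ 2 + 2 * u) ≤ 1 + u := by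
  rw [Real.sqrt_le_left (by positivity)]; nlinarith

theorem norm_angularFactor_le {u : ℝ} (hu : 0 ≤ u) (θ : ℝ) :
    ‖Complex.I * (√(u ^ 2 + 2 * u) * Real.cos θ : ℂ)‖ ≤ 1 + u := by
  rw [norm_mul, norm_mul, Complex.norm_I, one_mul, Complex.norm_real, Complex.norm_real,
    Real.norm_of_nonneg (Real.sqrt_nonneg _)]
  calc _ ≤ (1 + u) * 1 := mul_le_mul (sqrt_quadratic_le hu) (Real.abs_cos_le_one θ)
        (abs_nonneg _) (by positivity)
    _ = _ := mul_one _

theorem norm_obliqueArg_le {c s u : ℝ} (hc : c ∈ Set.Icc (0 : ℝ) 1) (hs : s ∈ Set.Icc (0 : ℝ) 1)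
    (hu : 0 ≤ u) (θ : ℝ) : ‖obliqueArg c s u θ‖ ≤ 2 * (1 + u) := by
  have h1 : ‖(c * (1 + u) : ℂ)‖ ≤ 1 + u := by
    have : ((c * (1 + u) : ℝ) : ℂ) = c * (1 + u) := by push_cast; rfl
    rw [← this, Complex.norm_real, Real.norm_of_nonneg (mul_nonneg hc.1 (by positivity))]
    exact mul_le_of_le_one_left (by positivity) hc.2
  have h2 : ‖Complex.I * (s * √(u ^ 2 + 2 * u) * Real.cos θ : ℂ)‖ ≤ 1 + u := by
    have : Complex.I * (s * √(u ^ 2 + 2 * u) * Real.cos θ : ℂ)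
        = s * (Complex.I * (√(u ^ 2 + 2 * u) * Real.cos θ : ℂ)) := by ring
    rw [this, norm_mul, Complex.norm_real, Real.norm_of_nonneg hs.1]
    calc _ ≤ 1 * (1 + u) := mul_le_mul hs.2 (norm_angularFactor_le hu θ) (norm_nonneg _) zero_le_one
      _ = _ := one_mul _
  unfold obliqueArg
  linarith [norm_add_le_of_le h1 h2]

/-- Growth of the angular means. -/
theorem IsAmplitude.norm_angularMean_le {f : ℂ → ℂ} {R M : ℝ} {p : ℕ}
    (hf : IsAmplitude f R M p) (e : ℕ) {c s u : ℝ} (hc : c ∈ Set.Ioc (0 : ℝ) 1)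
    (hs : s ∈ Set.Icc (0 : ℝ) 1) (hu : 0 ≤ u) :
    ‖angularMean f e c s u‖ ≤ M * 3 ^ p * (1 + u) ^ (p + e) := by
  refine norm_integral_neg_pi_pi_le fun θ => ?_
  have hM := hf.bound_nonneg
  have h1 : ‖f (obliqueArg c s u θ)‖ ≤ M * (3 * (1 + u)) ^ p := by
    refine (hf.norm_le _ (by rw [re_obliqueArg]; have := hc.1; positivity)).trans ?_
    gcongr
    linarith [norm_obliqueArg_le ⟨hc.1.le, hc.2⟩ hs hu θ]
  rw [norm_mul, norm_pow]
  calc _ ≤ M * (3 * (1 + u)) ^ p * (1 + u) ^ e := by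
        gcongr
        exact norm_angularFactor_le hu θ
    _ = _ := by rw [mul_pow, pow_add]; ring

/-- The odd moments of the cosine vanish. -/
theorem integral_cos_pow_odd {k : ℕ} (hk : Odd k) :
    ∫ θ in -π..π, (Real.cos θ : ℂ) ^ k = 0 := by
  have hper : Function.Periodic (fun θ : ℝ => (Real.cos θ : ℂ) ^ k) (2 * π) := fun θ => by
    simp only [Real.cos_add_two_pi]
  have h1 : ∫ θ in -π..π, (Real.cos θ : ℂ) ^ k = ∫ θ in 0..(2 * π), (Real.cos θ : ℂ) ^ k := by
    have := hper.intervalIntegral_add_eq (-π) 0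
    rw [show -π + 2 * π = π by ring, zero_add] at this
    exact this
  have h2 : ∫ θ in -π..π, (Real.cos (θ + π) : ℂ) ^ k = ∫ θ in 0..(2 * π), (Real.cos θ : ℂ) ^ k := by
    rw [intervalIntegral.integral_comp_add_right (fun θ : ℝ => (Real.cos θ : ℂ) ^ k)]
    congr 1 <;> ring
  rw [← h1] at h2
  simp only [Real.cos_add_pi, Complex.ofReal_neg, hk.neg_pow, intervalIntegral.integral_neg] at h2
  have h3 : (2 : ℂ) * ∫ θ in -π..π, (Real.cos θ : ℂ) ^ k = 0 := by linear_combination -h2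
  simpa using h3

/-- Expansion of the angular means. The factor `σ` provides the smoothness of the odd powers of the
sine of the angle that occur for `e = 1`. -/
theorem IsAmplitude.hasUniformExpansion_angularMean {f : ℂ → ℂ} {R M : ℝ} {p : ℕ}
    (hf : IsAmplitude f R M p) (e : ℕ) {σ : EuclideanSpace ℝ (Fin 3) → ℂ}
    (hσ : ∀ w, ‖σ w‖ ≤ 1)
    (hsm : ∀ k, Even (k + e) → IsBoundedSmooth fun w => σ w * (verticalSin w : ℂ) ^ k) (N : ℕ) :
    HasUniformExpansion ((R / 12) ^ 2) N
      fun w u => σ w * angularMean f e (verticalCos w) (verticalSin w) u := by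
  have hR := hf.radius_pos
  have hR1 := hf.radius_le
  have hM := hf.bound_nonneg
  -- The displacement `obliqueArg - c` is only `O(√u)`, so Taylor's formula is used to order `2 * N`.
  have hpoly : HasUniformExpansion ((R / 12) ^ 2) N fun w u =>
      ∑ m ∈ Finset.range (2 * N), ∑ k ∈ Finset.range (m + 1),
        (taylorCoeff f m (verticalCos w) * (verticalCos w : ℂ) ^ (m - k) *
          (σ w * (verticalSin w : ℂ) ^ k) * (Complex.I ^ (k + e) * (m.choose k) *
            (((2 * π)⁻¹ : ℂ) * ∫ θ in -π..π, (Real.cos θ : ℂ) ^ (k + e)))) *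
          ((u : ℂ) ^ (m - k) * (√(u ^ 2 + 2 * u) : ℂ) ^ (k + e)) := by
    refine .sum _ fun m _ => .sum _ fun k _ => ?_
    -- Even powers of `√(u² + 2u)` are polynomials in `u`; odd powers come with odd moments of the
    -- cosine.
    rcases Nat.even_or_odd (k + e) with hk | hk
    · refine HasUniformExpansion.const_mul
        ((((hf.isBoundedSmooth_taylorCoeff m).mul (isBoundedSmooth_verticalCos.pow _)).mul
          (hsm k hk)).mul (.const _)) ?_
      obtain ⟨i, hi⟩ := hk
      refine ((HasUniformExpansion.one.mul_quadratic_pow i).mul_u_pow (m - k)).congr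
        fun w _ u hu => ?_
      have h1 : (√(u ^ 2 + 2 * u) : ℂ) ^ 2 = (u : ℂ) ^ 2 + 2 * u := by
        have := Real.sq_sqrt (show 0 ≤ u ^ 2 + 2 * u by have := hu.1; positivity)
        exact_mod_cast this
      rw [hi, ← two_mul, pow_mul, h1, mul_one]
    · refine HasUniformExpansion.zero.congr fun w _ u _ => ?_
      rw [integral_cos_pow_odd hk]; ring
  refine hpoly.congr_of_le (C' := 2 * M * (2 / R) ^ (2 * N) * 3 ^ (2 * N) * 2 ^ e)
    (by positivity) fun w hw u hu => ?_
  set c := verticalCos w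
  set s := verticalSin w
  have hc0 : 0 < c := verticalCos_pos hw
  have hc1 : c ≤ 1 := verticalCos_le_one hw
  have hs0 : 0 ≤ s := verticalSin_nonneg w
  have hs1 : s ≤ 1 := verticalSin_le_one hw
  have hu0 : 0 ≤ u := hu.1
  have hsu : √u ≤ R / 12 := by
    rw [Real.sqrt_le_left (by positivity)]; exact hu.2
  have hsu1 : √u ≤ 1 := by linarith
  have huu : u = √u * √u := (Real.mul_self_sqrt hu0).symm
  have hu1 : u ≤ √u := by nlinarith [Real.sqrt_nonneg u]
  have hQ : √(u ^ 2 + 2 * u) ≤ 2 * √u := by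
    rw [Real.sqrt_le_left (by positivity), mul_pow, Real.sq_sqrt hu0]; nlinarith
  set q := √(u ^ 2 + 2 * u) with hq
  have hq0 : 0 ≤ q := Real.sqrt_nonneg _
  set h : ℝ → ℂ := fun θ => u * c + Complex.I * (s * q * Real.cos θ) with hh
  -- With `√u ≤ R / 12` the displacement is at most `R / 4`, as Taylor's formula requires.
  have hhn : ∀ θ, ‖h θ‖ ≤ 3 * √u := by
    intro θ
    have h1 : ‖(u * c : ℂ)‖ ≤ √u := by
      rw [norm_mul, Complex.norm_real, Complex.norm_real, Real.norm_of_nonneg hu0,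
        Real.norm_of_nonneg hc0.le]
      nlinarith
    have h2 : ‖Complex.I * (s * q * Real.cos θ : ℂ)‖ ≤ 2 * √u := by
      rw [norm_mul, norm_mul, norm_mul, Complex.norm_I, one_mul, Complex.norm_real,
        Complex.norm_real, Complex.norm_real, Real.norm_of_nonneg hs0, Real.norm_of_nonneg hq0]
      calc _ ≤ 1 * (2 * √u) * 1 := by
            gcongr
            exact Real.abs_cos_le_one θ
        _ = _ := by ring
    simp only [hh]
    linarith [norm_add_le_of_le h1 h2]
  have hT : ∀ θ, obliqueArg c s u θ = c + h θ := fun θ => by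
    simp only [obliqueArg, hh]; ring
  have hgn : ∀ θ, ‖Complex.I * (q * Real.cos θ : ℂ)‖ ≤ 2 := fun θ =>
    (norm_angularFactor_le hu0 θ).trans (by linarith)
  have hfc : Continuous fun θ => f (obliqueArg c s u θ) :=
    hf.continuous_comp_obliqueArg s hc0 hu0
  have hhc : Continuous h := by simp only [hh]; fun_prop
  have hsum : ∑ m ∈ Finset.range (2 * N), ∑ k ∈ Finset.range (m + 1),
        (taylorCoeff f m c * (c : ℂ) ^ (m - k) *
          (σ w * (s : ℂ) ^ k) * (Complex.I ^ (k + e) * (m.choose k) *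
            (((2 * π)⁻¹ : ℂ) * ∫ θ in -π..π, (Real.cos θ : ℂ) ^ (k + e)))) *
          ((u : ℂ) ^ (m - k) * (q : ℂ) ^ (k + e))
      = σ w * (((2 * π)⁻¹ : ℂ) * ∫ θ in -π..π, (∑ m ∈ Finset.range (2 * N),
          taylorCoeff f m c * h θ ^ m) * (Complex.I * (q * Real.cos θ)) ^ e) := by
    simp_rw [Finset.sum_mul]
    rw [intervalIntegral.integral_finsetSum fun m _ =>
      Continuous.intervalIntegrable (by fun_prop) _ _, Finset.mul_sum, Finset.mul_sum]
    refine Finset.sum_congr rfl fun m _ => ?_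
    have hexp : ∀ θ, taylorCoeff f m c * h θ ^ m * (Complex.I * (q * Real.cos θ)) ^ e
        = ∑ k ∈ Finset.range (m + 1), (taylorCoeff f m c * (c : ℂ) ^ (m - k) * (s : ℂ) ^ k *
          (Complex.I ^ (k + e) * (m.choose k)) * ((u : ℂ) ^ (m - k) * (q : ℂ) ^ (k + e))) *
            (Real.cos θ : ℂ) ^ (k + e) := fun θ => by
      simp only [hh]
      rw [add_comm, add_pow, Finset.mul_sum, Finset.sum_mul]
      refine Finset.sum_congr rfl fun k _ => ?_
      ring
    simp_rw [hexp]
    rw [intervalIntegral.integral_finsetSum fun k _ =>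
      Continuous.intervalIntegrable (by fun_prop) _ _, Finset.mul_sum, Finset.mul_sum]
    refine Finset.sum_congr rfl fun k _ => ?_
    rw [intervalIntegral.integral_const_mul]
    ring
  have hfc' : Continuous fun θ => f (obliqueArg c s u θ) *
      (Complex.I * (√(u ^ 2 + 2 * u) * Real.cos θ)) ^ e := hfc.mul (by fun_prop)
  rw [hsum, angularMean, ← mul_sub, ← mul_sub, ← intervalIntegral.integral_sub
    (hfc'.intervalIntegrable _ _)
    (Continuous.intervalIntegrable (by fun_prop) _ _), norm_mul]
  refine (mul_le_of_le_one_left (norm_nonneg _) (hσ w)).trans ?_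
  refine norm_integral_neg_pi_pi_le fun θ => ?_
  rw [← sub_mul, norm_mul, norm_pow, hT]
  have h1 := hf.norm_sub_taylor_le (2 * N) (c := c) ⟨hc0.le, hc1⟩ (h := h θ)
    ((hhn θ).trans (by linarith))
  calc _ ≤ (2 * M * (2 / R) ^ (2 * N) * (3 * √u) ^ (2 * N)) * 2 ^ e := by
        gcongr
        · refine h1.trans ?_
          gcongr
          exact hhn θ
        · exact hgn θ
    _ = _ := by
        rw [mul_pow, pow_mul (√u), Real.sq_sqrt hu0]; ring

/-! ### The contour shift -/

/-- Shift of a horizontal line of integration inside a strip of holomorphy. -/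
theorem integral_eq_integral_add_mul_I {g : ℂ → ℂ} {α C : ℝ} (hα : 0 ≤ α)
    (hd : ∀ z : ℂ, z.im ∈ Set.Icc 0 α → DifferentiableAt ℂ g z)
    (hb : ∀ z : ℂ, z.im ∈ Set.Icc 0 α → ‖g z‖ ≤ C * (1 + z.re ^ 2)⁻¹) :
    ∫ x : ℝ, g x = ∫ x : ℝ, g (x + α * Complex.I) := by
  have hline : ∀ y ∈ Set.Icc 0 α, Integrable fun x : ℝ => g (x + y * Complex.I) := by
    intro y hy
    have hcont : Continuous fun x : ℝ => g (x + y * Complex.I) := by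
      rw [continuous_iff_continuousAt]
      intro x
      refine ContinuousAt.comp (f := fun x : ℝ => (x + y * Complex.I : ℂ)) ?_ (by fun_prop)
      exact (hd _ (by simpa using hy)).continuousAt
    refine (integrable_inv_one_add_sq.const_mul C).mono' hcont.aestronglyMeasurable
      (Eventually.of_forall fun x => ?_)
    simpa using hb (x + y * Complex.I) (by simpa using hy)
  have h0 := intervalIntegral_tendsto_integral (hline 0 ⟨le_rfl, hα⟩)
    (tendsto_neg_atTop_atBot.comp tendsto_natCast_atTop_atTop)
    (tendsto_natCast_atTop_atTop (R := ℝ))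
  have h1 := intervalIntegral_tendsto_integral (hline α ⟨hα, le_rfl⟩)
    (tendsto_neg_atTop_atBot.comp tendsto_natCast_atTop_atTop)
    (tendsto_natCast_atTop_atTop (R := ℝ))
  -- The vertical sides of the rectangle contribute nothing in the limit.
  have hvert : ∀ σ : ℝ, σ ^ 2 = 1 → Tendsto (fun n : ℕ =>
      ∫ y : ℝ in 0..α, g (((σ * n : ℝ) : ℂ) + y * Complex.I)) atTop (𝓝 0) := by
    intro σ hσ
    have hlim : Tendsto (fun n : ℕ => C * (1 + (n : ℝ) ^ 2)⁻¹ * α) atTop (𝓝 0) := by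
      have : Tendsto (fun n : ℕ => (1 + (n : ℝ) ^ 2)) atTop atTop :=
        tendsto_atTop_add_const_left _ _
          ((tendsto_pow_atTop two_ne_zero).comp tendsto_natCast_atTop_atTop)
      simpa using (this.inv_tendsto_atTop.const_mul C).mul_const α
    refine squeeze_zero_norm (fun n => ?_) hlim
    have := intervalIntegral.norm_integral_le_of_norm_le_const (a := 0) (b := α)
      (f := fun y : ℝ => g (((σ * n : ℝ) : ℂ) + y * Complex.I)) (C := C * (1 + (n : ℝ) ^ 2)⁻¹) ?_
    · simpa [abs_of_nonneg hα] using this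
    · intro y hy
      rw [Set.uIoc_of_le hα] at hy
      have := hb (((σ * n : ℝ) : ℂ) + y * Complex.I) (by simpa using ⟨hy.1.le, hy.2⟩)
      simpa [mul_pow, hσ] using this
  have hv1 := hvert 1 (by norm_num)
  have hv2 := hvert (-1) (by norm_num)
  have hrect : ∀ n : ℕ, (∫ x : ℝ in -(n : ℝ)..n, g (x + (0 : ℝ) * Complex.I))
      - (∫ x : ℝ in -(n : ℝ)..n, g (x + α * Complex.I))
      + Complex.I • (∫ y : ℝ in 0..α, g (((1 * n : ℝ) : ℂ) + y * Complex.I))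
      - Complex.I • (∫ y : ℝ in 0..α, g (((-1 * n : ℝ) : ℂ) + y * Complex.I)) = 0 := by
    intro n
    have := Complex.integral_boundary_rect_eq_zero_of_differentiableOn g
      ((-(n : ℝ) : ℝ) : ℂ) ((n : ℝ) + α * Complex.I) (fun z hz => by
        refine (hd z ?_).differentiableWithinAt
        have := hz.2
        simpa [Set.uIcc_of_le hα] using this)
    simpa using this
  have hlim := ((h0.sub h1).add (hv1.const_smul Complex.I)).sub (hv2.const_smul Complex.I)
  have := tendsto_nhds_unique hlim (tendsto_const_nhds.congr fun n => (hrect n).symm)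
  simp only [smul_zero, add_zero, sub_zero] at this
  have h3 := sub_eq_zero.1 this
  simpa using h3

theorem norm_cosh_le (z : ℂ) : ‖Complex.cosh z‖ ≤ Real.cosh z.re := by
  rw [Complex.cosh, norm_div, Real.cosh_eq, Complex.norm_ofNat]
  gcongr
  refine (norm_add_le _ _).trans_eq ?_
  rw [Complex.norm_exp, Complex.norm_exp, Complex.neg_re]

theorem norm_sinh_le (z : ℂ) : ‖Complex.sinh z‖ ≤ Real.cosh z.re := by
  rw [Complex.sinh, norm_div, Real.cosh_eq, Complex.norm_ofNat]
  gcongr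
  refine (norm_sub_le _ _).trans_eq ?_
  rw [Complex.norm_exp, Complex.norm_exp, Complex.neg_re]

theorem re_cosh (z : ℂ) : (Complex.cosh z).re = Real.cosh z.re * Real.cos z.im := by
  conv_lhs => rw [← Complex.re_add_im z, Complex.cosh_add, Complex.cosh_mul_I, Complex.sinh_mul_I]
  rw [← Complex.ofReal_cosh, ← Complex.ofReal_sinh, ← Complex.ofReal_cos, ← Complex.ofReal_sin]
  simp only [Complex.add_re, Complex.mul_re, Complex.ofReal_re, Complex.ofReal_im, Complex.I_re,
    Complex.mul_im, Complex.I_im]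
  ring

theorem one_add_sq_div_two_le_cosh (x : ℝ) : 1 + x ^ 2 / 2 ≤ Real.cosh x := by
  have h1 : |x / 2| ≤ |Real.sinh (x / 2)| := by
    rw [Real.abs_sinh]; exact Real.self_le_sinh_iff.2 (abs_nonneg _)
  have h2 := sq_le_sq.2 h1
  have h3 := Real.cosh_two_mul (x / 2)
  rw [mul_div_cancel₀ x two_ne_zero, Real.cosh_sq] at h3
  linarith

/-- An exponential beats a power. -/
theorem exists_one_add_pow_mul_exp_le (n : ℕ) {κ : ℝ} (hκ : 0 < κ) :
    ∃ C : ℝ, 0 < C ∧ ∀ x : ℝ, 0 ≤ x → (1 + x) ^ n * Real.exp (-(κ * x)) ≤ C := by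
  refine ⟨n.factorial * Real.exp κ / κ ^ n, by positivity, fun x hx => ?_⟩
  have h := Real.pow_div_factorial_le_exp (κ * (1 + x)) (by positivity) n
  rw [le_div_iff₀ (by positivity), Real.exp_neg, mul_assoc, ← div_eq_inv_mul, ← mul_div_assoc,
    div_le_iff₀ (Real.exp_pos _)]
  rw [mul_add, mul_one, Real.exp_add, div_le_iff₀ (by positivity), ← mul_one_add, mul_pow] at h
  linarith

/-- Substitution of the rapidity `v`, where `x = m sinh v`. -/
theorem integral_comp_sinh {m : ℝ} (hm : 0 < m) (φ : ℝ → ℝ → ℂ) :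
    ∫ x : ℝ, φ (√(m ^ 2 + x ^ 2)) x / (√(m ^ 2 + x ^ 2) : ℂ)
      = ∫ v : ℝ, φ (m * Real.cosh v) (m * Real.sinh v) := by
  have himg : (fun v : ℝ => m * Real.sinh v) '' Set.univ = Set.univ := by
    rw [Set.image_univ, Set.range_eq_univ]
    intro y
    obtain ⟨v, hv⟩ := Real.sinh_surjective (y / m)
    exact ⟨v, by simp only [hv]; field_simp⟩
  have h := integral_image_eq_integral_abs_deriv_smul (s := Set.univ)
    (f := fun v : ℝ => m * Real.sinh v) (f' := fun v => m * Real.cosh v) MeasurableSet.univ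
    (fun v _ => ((Real.hasDerivAt_sinh v).const_mul m).hasDerivWithinAt)
    (fun v _ v' _ hv => Real.sinh_injective (mul_left_cancel₀ hm.ne' hv))
    (fun x => φ (√(m ^ 2 + x ^ 2)) x / (√(m ^ 2 + x ^ 2) : ℂ))
  rw [himg, setIntegral_univ, setIntegral_univ] at h
  rw [h]
  congr 1 with v
  have hpos : 0 < m * Real.cosh v := mul_pos hm (Real.cosh_pos v)
  have hs : √(m ^ 2 + (m * Real.sinh v) ^ 2) = m * Real.cosh v := by
    rw [show m ^ 2 + (m * Real.sinh v) ^ 2 = (m * Real.cosh v) ^ 2 by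
      rw [mul_pow, mul_pow, Real.cosh_sq]; ring]
    exact Real.sqrt_sq hpos.le
  rw [hs, abs_of_pos hpos, Complex.real_smul]
  have : ((m * Real.cosh v : ℝ) : ℂ) ≠ 0 := by exact_mod_cast hpos.ne'
  field_simp

/-- The contour shift. In the rapidity variable `x = m sinh v` the phase is
`m cosh (v - i α)`, and the shift `v ↦ v + i α` makes it real; on the amplitude it acts as a
rotation by the imaginary angle `i α`. -/
theorem integral_phase_eq_integral_rotated {A : ℂ → ℂ → ℂ} {m l c s B : ℝ} {k : ℕ} (hm : 0 < m)
    (hl : 0 < l) (hc : 0 < c) (hs : 0 ≤ s) (hcs : c ^ 2 + s ^ 2 = 1)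
    (hd : ∀ z : ℂ, |z.im| < π / 2 →
      DifferentiableAt ℂ (fun z => A (m * Complex.cosh z) (m * Complex.sinh z)) z)
    (hb : ∀ z : ℂ, |z.im| < π / 2 →
      ‖A (m * Complex.cosh z) (m * Complex.sinh z)‖ ≤ B * (1 + m * Real.cosh z.re) ^ k) :
    ∫ x : ℝ, Complex.exp (-(l * (√(m ^ 2 + x ^ 2) * c - Complex.I * (x * s)))) *
        A (√(m ^ 2 + x ^ 2)) x / (√(m ^ 2 + x ^ 2) : ℂ)
      = ∫ x : ℝ, Complex.exp (-(l * √(m ^ 2 + x ^ 2))) *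
        A (√(m ^ 2 + x ^ 2) * c + Complex.I * (x * s)) (x * c + Complex.I * (√(m ^ 2 + x ^ 2) * s))
          / (√(m ^ 2 + x ^ 2) : ℂ) := by
  have hc1 : c ≤ 1 := by nlinarith
  set α := Real.arccos c with hα
  have hcos : Real.cos α = c := Real.cos_arccos (by linarith) hc1
  have hsin : Real.sin α = s := by
    rw [hα, Real.sin_arccos, show 1 - c ^ 2 = s ^ 2 by linarith, Real.sqrt_sq hs]
  have hα0 : 0 ≤ α := Real.arccos_nonneg c
  have hα1 : α < π / 2 := Real.arccos_lt_pi_div_two.2 hc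
  have hcos' : Complex.cos α = c := by rw [← Complex.ofReal_cos, hcos]
  have hsin' : Complex.sin α = s := by rw [← Complex.ofReal_sin, hsin]
  rw [integral_comp_sinh hm (fun t x => Complex.exp (-(l * (t * c - Complex.I * (x * s)))) *
    A t x), integral_comp_sinh hm (fun t x => Complex.exp (-(l * t)) *
    A (t * c + Complex.I * (x * s)) (x * c + Complex.I * (t * s)))]
  set g : ℂ → ℂ := fun z => Complex.exp (-(l * (m * Complex.cosh z * c -
    Complex.I * (m * Complex.sinh z * s)))) * A (m * Complex.cosh z) (m * Complex.sinh z) with hg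
  have hg' : ∀ z : ℂ, g z = Complex.exp (-(l * (m * Complex.cosh (z - α * Complex.I)))) *
      A (m * Complex.cosh z) (m * Complex.sinh z) := by
    intro z
    simp only [hg]
    rw [Complex.cosh_sub, Complex.cosh_mul_I, Complex.sinh_mul_I, hcos', hsin']
    congr 3
    ring
  have hstrip : ∀ z : ℂ, z.im ∈ Set.Icc 0 α → |z.im| < π / 2 := fun z hz => by
    rw [abs_of_nonneg hz.1]; exact hz.2.trans_lt hα1
  obtain ⟨C, hC, hexp⟩ := exists_one_add_pow_mul_exp_le (k + 1) (mul_pos hl hc)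
  have hB : 0 ≤ B := by
    have h0 := hb 0 (by simpa using by positivity)
    have hp : (0 : ℝ) < (1 + m * Real.cosh (0 : ℂ).re) ^ k := by positivity
    by_contra! hneg
    nlinarith [norm_nonneg (A (m * Complex.cosh 0) (m * Complex.sinh 0)),
      mul_neg_of_neg_of_pos hneg hp]
  have hbound : ∀ z : ℂ, z.im ∈ Set.Icc 0 α →
      ‖g z‖ ≤ B * C * (max 1 (2 / m)) * (1 + z.re ^ 2)⁻¹ := by
    intro z hz
    set X := m * Real.cosh z.re with hX
    have hX0 : 0 ≤ X := by positivity
    have h1 : ‖Complex.exp (-(l * (m * Complex.cosh (z - α * Complex.I))))‖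
        ≤ Real.exp (-(l * c * X)) := by
      rw [Complex.norm_exp, Real.exp_le_exp, Complex.neg_re, Complex.re_ofReal_mul,
        Complex.re_ofReal_mul, re_cosh, neg_le_neg_iff]
      have h2 : (z - α * Complex.I).re = z.re := by simp
      have h3 : (z - α * Complex.I).im = z.im - α := by simp
      have h4 : c ≤ Real.cos (z.im - α) := by
        rw [← hcos, ← Real.cos_neg (z.im - α)]
        exact Real.cos_le_cos_of_nonneg_of_le_pi (by linarith [hz.2]) (by linarith [Real.pi_pos])
          (by linarith [hz.1])
      rw [h2, h3, hX]
      have : 0 ≤ l * m * Real.cosh z.re := by positivity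
      nlinarith
    have h2 := hb z (hstrip z hz)
    have h3 := hexp X hX0
    have h4 : (1 + z.re ^ 2) ≤ max 1 (2 / m) * (1 + X) := by
      have hcosh : 1 + z.re ^ 2 / 2 ≤ Real.cosh z.re := one_add_sq_div_two_le_cosh _
      have h5 : z.re ^ 2 ≤ 2 / m * X := by
        rw [hX]; field_simp; linarith
      have h6 : 2 / m * X ≤ max 1 (2 / m) * X := by gcongr; exact le_max_right _ _
      linarith [le_max_left 1 (2 / m)]
    rw [hg' z, norm_mul, ← div_eq_mul_inv, le_div_iff₀ (by positivity)]
    calc _ ≤ Real.exp (-(l * c * X)) * (B * (1 + X) ^ k) * (max 1 (2 / m) * (1 + X)) := by gcongr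
      _ = B * ((1 + X) ^ (k + 1) * Real.exp (-(l * c * X))) * max 1 (2 / m) := by ring
      _ ≤ B * C * max 1 (2 / m) := by gcongr
  have hshift := integral_eq_integral_add_mul_I (g := g) hα0 (fun z hz => by
    have := hd z (hstrip z hz)
    exact DifferentiableAt.mul (by fun_prop) this) hbound
  convert hshift using 2
  · funext v
    simp [hg]
  · funext v
    rw [hg']
    simp only [add_sub_cancel_right]
    rw [Complex.cosh_add, Complex.sinh_add, Complex.cosh_mul_I, Complex.sinh_mul_I, hcos', hsin']
    push_cast
    congr 2 <;> ring

/-! ### The plane integral as a Laplace transform -/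

/-- The normalized vertical frequency `√(1 + |p|²)` at the tangential frequency `p`. -/
noncomputable def bracket (p : ℝ × ℝ) : ℝ := √(1 + p.1 ^ 2 + p.2 ^ 2)

theorem continuous_bracket : Continuous bracket := by unfold bracket; fun_prop

theorem bracket_pos (p : ℝ × ℝ) : 0 < bracket p := by unfold bracket; positivity

theorem bracket_sq (p : ℝ × ℝ) : bracket p ^ 2 = 1 + p.1 ^ 2 + p.2 ^ 2 := by
  unfold bracket; exact Real.sq_sqrt (by positivity)

theorem abs_fst_le_bracket (p : ℝ × ℝ) : |p.1| ≤ bracket p :=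
  abs_le_of_sq_le_sq (by nlinarith [bracket_sq p, sq_nonneg p.2]) (bracket_pos p).le

theorem abs_snd_le_bracket (p : ℝ × ℝ) : |p.2| ≤ bracket p :=
  abs_le_of_sq_le_sq (by nlinarith [bracket_sq p, sq_nonneg p.1]) (bracket_pos p).le

theorem integrable_of_norm_le_bracket {F : ℝ × ℝ → ℂ} (hF : Continuous F) {C κ : ℝ} {k : ℕ}
    (hκ : 0 < κ) (hC : 0 ≤ C)
    (hb : ∀ p, ‖F p‖ ≤ C * (1 + bracket p) ^ k * Real.exp (-(κ * bracket p))) :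
    Integrable F := by
  obtain ⟨B, hB, hexp⟩ := exists_one_add_pow_mul_exp_le (k + 3) hκ
  have hint : Integrable fun p : ℝ × ℝ => C * B * (1 + ‖p‖) ^ (-(3 : ℝ)) := by
    refine (integrable_one_add_norm ?_).const_mul _
    simp
    norm_num
  refine hint.mono' hF.aestronglyMeasurable (Eventually.of_forall fun p => (hb p).trans ?_)
  have hp := bracket_pos p
  have hn : ‖p‖ ≤ bracket p := max_le (abs_fst_le_bracket p) (abs_snd_le_bracket p)
  have h3 : (1 + ‖p‖) ^ (-(3 : ℝ)) = ((1 + ‖p‖) ^ 3)⁻¹ := by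
    rw [Real.rpow_neg (by positivity)]; norm_cast
  rw [h3, ← div_eq_mul_inv, le_div_iff₀ (by positivity)]
  calc _ ≤ C * (1 + bracket p) ^ k * Real.exp (-(κ * bracket p)) * (1 + bracket p) ^ 3 := by gcongr
    _ = C * ((1 + bracket p) ^ (k + 3) * Real.exp (-(κ * bracket p))) := by ring
    _ ≤ C * B := by gcongr; exact hexp _ hp.le

/-- An affine function of the vertical frequency `t` and the tangential frequencies `x`, `y`; it
distinguishes the wave from its partial derivatives. -/
def affineSymbol (l : Fin 4 → ℂ) (t x y : ℂ) : ℂ := l 0 + l 1 * t + l 2 * x + l 3 * y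

theorem norm_affineSymbol_le (l : Fin 4 → ℂ) {t x y : ℂ} {r : ℝ} (ht : ‖t‖ ≤ r) (hx : ‖x‖ ≤ r)
    (hy : ‖y‖ ≤ r) : ‖affineSymbol l t x y‖ ≤ (∑ i, ‖l i‖) * (1 + r) := by
  have hr : 0 ≤ r := (norm_nonneg _).trans ht
  unfold affineSymbol
  refine (norm_add₄_le).trans ?_
  simp only [norm_mul, Fin.sum_univ_four]
  nlinarith [norm_nonneg (l 0), norm_nonneg (l 1), norm_nonneg (l 2), norm_nonneg (l 3),
    mul_le_mul_of_nonneg_left ht (norm_nonneg (l 1)),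
    mul_le_mul_of_nonneg_left hx (norm_nonneg (l 2)),
    mul_le_mul_of_nonneg_left hy (norm_nonneg (l 3)), mul_nonneg (norm_nonneg (l 0)) hr]

theorem continuous_affineSymbol (l : Fin 4 → ℂ) {X : Type*} [TopologicalSpace X] {T U V : X → ℂ}
    (hT : Continuous T) (hU : Continuous U) (hV : Continuous V) :
    Continuous fun x => affineSymbol l (T x) (U x) (V x) := by
  unfold affineSymbol; fun_prop

section Rotation

variable {f : ℂ → ℂ} {R M : ℝ} {p : ℕ} (l : Fin 4 → ℂ) {lam c s : ℝ}

/-- The integrand after the contour shift: the phase is real, and the frequencies `(t, x)` are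
replaced by `(c t + i s x, c x + i s t)`. -/
noncomputable def rotatedIntegrand (f : ℂ → ℂ) (l : Fin 4 → ℂ) (lam c s : ℝ) (q : ℝ × ℝ) : ℂ :=
  Complex.exp (-(lam * bracket q)) *
    (f (bracket q * c + Complex.I * (q.1 * s)) *
      affineSymbol l (bracket q * c + Complex.I * (q.1 * s))
        (q.1 * c + Complex.I * (bracket q * s)) q.2) / (bracket q : ℂ)

theorem continuous_rotatedIntegrand (hf : IsAmplitude f R M p) (hc : 0 < c) :
    Continuous (rotatedIntegrand f l lam c s) := by
  have hbc := continuous_bracket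
  have h1 : Continuous fun q : ℝ × ℝ => f (bracket q * c + Complex.I * (q.1 * s)) :=
    hf.continuous_comp (by fun_prop) fun q => by
      simpa using mul_pos (bracket_pos q) hc
  have h2 : Continuous fun q : ℝ × ℝ => affineSymbol l (bracket q * c + Complex.I * (q.1 * s))
        (q.1 * c + Complex.I * (bracket q * s)) q.2 :=
    continuous_affineSymbol l (by fun_prop) (by fun_prop) (by fun_prop)
  unfold rotatedIntegrand
  exact Continuous.div (Continuous.mul (by fun_prop) (h1.mul h2)) (by fun_prop)
    fun q => by exact_mod_cast (bracket_pos q).ne'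

theorem norm_div_bracket_le (z : ℂ) (q : ℝ × ℝ) : ‖z / (bracket q : ℂ)‖ ≤ ‖z‖ := by
  rw [norm_div, Complex.norm_real, Real.norm_of_nonneg (bracket_pos q).le]
  refine div_le_self (norm_nonneg _) ?_
  nlinarith [bracket_sq q, sq_nonneg q.1, sq_nonneg q.2, bracket_pos q]

theorem norm_rotatedIntegrand_le (hf : IsAmplitude f R M p) (hc : c ∈ Set.Ioc (0 : ℝ) 1)
    (hs : s ∈ Set.Icc (0 : ℝ) 1) (q : ℝ × ℝ) :
    ‖rotatedIntegrand f l lam c s q‖ ≤ M * 2 ^ (p + 1) * (∑ i, ‖l i‖) *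
      (1 + bracket q) ^ (p + 1) * Real.exp (-(lam * bracket q)) := by
  have hq := bracket_pos q
  have hM := hf.bound_nonneg
  have hq1 := abs_fst_le_bracket q
  have hq2 := abs_snd_le_bracket q
  have h1 : ∀ a b : ℝ, |a| ≤ bracket q → |b| ≤ bracket q →
      ‖(a * c + Complex.I * (b * s) : ℂ)‖ ≤ 2 * bracket q := by
    intro a b ha hb
    have e1 : ‖(a * c : ℂ)‖ ≤ bracket q := by
      rw [norm_mul, Complex.norm_real, Complex.norm_real, Real.norm_of_nonneg hc.1.le]
      exact (mul_le_of_le_one_right (norm_nonneg _) hc.2).trans ha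
    have e2 : ‖(Complex.I * (b * s) : ℂ)‖ ≤ bracket q := by
      rw [norm_mul, norm_mul, Complex.norm_I, one_mul, Complex.norm_real, Complex.norm_real,
        Real.norm_of_nonneg hs.1]
      exact (mul_le_of_le_one_right (norm_nonneg _) hs.2).trans hb
    linarith [norm_add_le_of_le e1 e2]
  have hbq : |bracket q| ≤ bracket q := (abs_of_pos hq).le
  have hT := h1 (bracket q) q.1 hbq hq1
  have hX := h1 q.1 (bracket q) hq1 hbq
  have hre : 0 < (bracket q * c + Complex.I * (q.1 * s) : ℂ).re := by
    simpa using mul_pos hq hc.1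
  have hF := hf.norm_le _ hre
  have hL := norm_affineSymbol_le l hT hX (y := (q.2 : ℂ)) (by
    rw [Complex.norm_real]; exact hq2.trans (by linarith))
  refine (norm_div_bracket_le _ q).trans ?_
  rw [norm_mul, norm_mul, Complex.norm_exp]
  have hexp : (-(lam * bracket q) : ℂ).re = -(lam * bracket q) := by
    simp
  rw [hexp]
  calc _ ≤ Real.exp (-(lam * bracket q)) * ((M * (2 * (1 + bracket q)) ^ p) *
        ((∑ i, ‖l i‖) * (2 * (1 + bracket q)))) := by
        gcongr
        · refine hF.trans ?_
          gcongr
          linarith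
        · refine hL.trans ?_
          gcongr
          linarith
    _ = _ := by rw [mul_pow]; ring

theorem integrable_rotatedIntegrand (hf : IsAmplitude f R M p) (hl : 0 < lam)
    (hc : c ∈ Set.Ioc (0 : ℝ) 1) (hs : s ∈ Set.Icc (0 : ℝ) 1) :
    Integrable (rotatedIntegrand f l lam c s) :=
  integrable_of_norm_le_bracket (continuous_rotatedIntegrand l hf hc.1) hl
    (by have := hf.bound_nonneg; positivity) (norm_rotatedIntegrand_le l hf hc hs)

/-- The integrand before the contour shift, with the tangential direction of `w` along the first
axis. -/
noncomputable def planeIntegrand (f : ℂ → ℂ) (l : Fin 4 → ℂ) (lam c s : ℝ) (q : ℝ × ℝ) : ℂ :=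
  Complex.exp (-(lam * (bracket q * c - Complex.I * (q.1 * s)))) *
    (f (bracket q) * affineSymbol l (bracket q) q.1 q.2) / (bracket q : ℂ)

theorem integrable_planeIntegrand (hf : IsAmplitude f R M p) (hl : 0 < lam)
    (hc : c ∈ Set.Ioc (0 : ℝ) 1) : Integrable (planeIntegrand f l lam c s) := by
  have hbc := continuous_bracket
  have hM := hf.bound_nonneg
  refine integrable_of_norm_le_bracket (C := M * ∑ i, ‖l i‖) (κ := lam * c) (k := p + 1) ?_
    (mul_pos hl hc.1) (by positivity) fun q => ?_
  · have h1 : Continuous fun q : ℝ × ℝ => f (bracket q) :=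
      hf.continuous_comp (by fun_prop) fun q => by simpa using bracket_pos q
    have h2 : Continuous fun q : ℝ × ℝ => affineSymbol l (bracket q) q.1 q.2 :=
      continuous_affineSymbol l (by fun_prop) (by fun_prop) (by fun_prop)
    unfold planeIntegrand
    exact Continuous.div (Continuous.mul (by fun_prop) (h1.mul h2)) (by fun_prop)
      fun q => by exact_mod_cast (bracket_pos q).ne'
  · have hq := bracket_pos q
    have hbq : ‖(bracket q : ℂ)‖ = bracket q := by
      rw [Complex.norm_real, Real.norm_of_nonneg hq.le]
    have hF := hf.norm_le (bracket q) (by simpa using hq)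
    have hL := norm_affineSymbol_le l hbq.le (x := (q.1 : ℂ)) (y := (q.2 : ℂ))
      (by rw [Complex.norm_real]; exact abs_fst_le_bracket q)
      (by rw [Complex.norm_real]; exact abs_snd_le_bracket q)
    rw [hbq] at hF
    refine (norm_div_bracket_le _ q).trans ?_
    rw [norm_mul, norm_mul, Complex.norm_exp]
    have hexp : (-(lam * (bracket q * c - Complex.I * (q.1 * s))) : ℂ).re
        = -(lam * c * bracket q) := by
      simp; ring
    rw [hexp]
    calc _ ≤ Real.exp (-(lam * c * bracket q)) * (M * (1 + bracket q) ^ p *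
          ((∑ i, ‖l i‖) * (1 + bracket q))) := by gcongr
      _ = _ := by ring

/-- The contour shift in the first variable, for each value of the second. -/
theorem integral_planeIntegrand (hf : IsAmplitude f R M p) (hl : 0 < lam)
    (hc : 0 < c) (hs : 0 ≤ s) (hcs : c ^ 2 + s ^ 2 = 1) :
    ∫ q, planeIntegrand f l lam c s q = ∫ q, rotatedIntegrand f l lam c s q := by
  have hc' : c ∈ Set.Ioc (0 : ℝ) 1 := ⟨hc, by nlinarith⟩
  have hs' : s ∈ Set.Icc (0 : ℝ) 1 := ⟨hs, by nlinarith⟩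
  have hM := hf.bound_nonneg
  have e1 := integral_prod_symm (μ := (volume : Measure ℝ)) (ν := (volume : Measure ℝ)) _
    (integrable_planeIntegrand (s := s) l hf hl hc')
  have e2 := integral_prod_symm (μ := (volume : Measure ℝ)) (ν := (volume : Measure ℝ)) _
    (integrable_rotatedIntegrand l hf hl hc' hs')
  rw [Measure.volume_eq_prod, e1, e2]
  congr 1 with y
  set m := √(1 + y ^ 2) with hm
  have hm0 : 0 < m := by positivity
  have hm2 : m ^ 2 = 1 + y ^ 2 := Real.sq_sqrt (by positivity)
  have hym : |y| ≤ m := Real.abs_le_sqrt (by linarith)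
  have hbr : ∀ x : ℝ, bracket (x, y) = √(m ^ 2 + x ^ 2) := fun x => by
    rw [bracket, hm2]; congr 1; ring
  have h := integral_phase_eq_integral_rotated
    (A := fun t x => f t * affineSymbol l t x y) (B := M * ∑ i, ‖l i‖) (k := p + 1)
    hm0 hl hc hs hcs (fun z hz => ?_) (fun z hz => ?_)
  · simp only [planeIntegrand, rotatedIntegrand, hbr]
    exact h
  · have hre : 0 < ((m : ℂ) * Complex.cosh z).re := by
      rw [Complex.re_ofReal_mul, re_cosh]
      exact mul_pos hm0 (mul_pos (Real.cosh_pos _)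
        (Real.cos_pos_of_mem_Ioo ⟨by linarith [(abs_lt.1 hz).1], (abs_lt.1 hz).2⟩))
    have h1 : DifferentiableAt ℂ (fun z => f (m * Complex.cosh z)) z :=
      DifferentiableAt.comp (f := fun z => (m : ℂ) * Complex.cosh z) z
        (hf.differentiableAt _ hre) (by fun_prop)
    refine h1.mul ?_
    unfold affineSymbol
    fun_prop
  · have hre : 0 < ((m : ℂ) * Complex.cosh z).re := by
      rw [Complex.re_ofReal_mul, re_cosh]
      exact mul_pos hm0 (mul_pos (Real.cosh_pos _)
        (Real.cos_pos_of_mem_Ioo ⟨by linarith [(abs_lt.1 hz).1], (abs_lt.1 hz).2⟩))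
    have hch := Real.one_le_cosh z.re
    have n1 : ‖(m : ℂ) * Complex.cosh z‖ ≤ m * Real.cosh z.re := by
      rw [norm_mul, Complex.norm_real, Real.norm_of_nonneg hm0.le]
      gcongr
      exact norm_cosh_le z
    have n2 : ‖(m : ℂ) * Complex.sinh z‖ ≤ m * Real.cosh z.re := by
      rw [norm_mul, Complex.norm_real, Real.norm_of_nonneg hm0.le]
      gcongr
      exact norm_sinh_le z
    have n3 : ‖(y : ℂ)‖ ≤ m * Real.cosh z.re := by
      rw [Complex.norm_real]
      exact hym.trans (le_mul_of_one_le_right hm0.le hch)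
    rw [norm_mul]
    calc _ ≤ M * (1 + m * Real.cosh z.re) ^ p * ((∑ i, ‖l i‖) * (1 + m * Real.cosh z.re)) := by
          gcongr
          · refine (hf.norm_le _ hre).trans ?_
            gcongr
          · exact norm_affineSymbol_le l n1 n2 n3
      _ = _ := by ring

/-- Substitution of `u = √(1 + r²) - 1` for the radial variable. -/
theorem integral_radial_substitution (φ : ℝ → ℂ) :
    ∫ r in Set.Ioi (0 : ℝ), ((r / √(1 + r ^ 2) : ℝ) : ℂ) * φ (√(1 + r ^ 2) - 1)
      = ∫ u in Set.Ioi (0 : ℝ), φ u := by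
  have himg : (fun r : ℝ => √(1 + r ^ 2) - 1) '' Set.Ioi 0 = Set.Ioi 0 := by
    ext u
    simp only [Set.mem_image, Set.mem_Ioi]
    constructor
    · rintro ⟨r, hr, rfl⟩
      rw [sub_pos]
      exact Real.lt_sqrt_of_sq_lt (by nlinarith)
    · intro hu
      refine ⟨√(u ^ 2 + 2 * u), by positivity, ?_⟩
      rw [Real.sq_sqrt (by positivity), show 1 + (u ^ 2 + 2 * u) = (1 + u) ^ 2 by ring,
        Real.sqrt_sq (by positivity)]
      ring
  have h := integral_image_eq_integral_abs_deriv_smul (s := Set.Ioi (0 : ℝ))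
    (f := fun r : ℝ => √(1 + r ^ 2) - 1) (f' := fun r => r / √(1 + r ^ 2)) measurableSet_Ioi
    (fun r _ => ?_) (fun r hr r' hr' he => ?_) φ
  · rw [himg] at h
    rw [h]
    refine setIntegral_congr_fun measurableSet_Ioi fun r hr => ?_
    have hr : 0 < r := hr
    rw [abs_of_pos (by positivity), Complex.real_smul]
  · have h1 : HasDerivAt (fun r : ℝ => 1 + r ^ 2) (2 * r) r := by
      simpa using (hasDerivAt_pow 2 r).const_add 1
    have h2 := (h1.sqrt (by positivity)).sub_const 1
    rw [mul_div_mul_left _ _ two_ne_zero] at h2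
    exact h2.hasDerivWithinAt
  · have hr : 0 < r := hr
    have hr' : 0 < r' := hr'
    have h1 : √(1 + r ^ 2) = √(1 + r' ^ 2) := by simpa using he
    rw [Real.sqrt_inj (by positivity) (by positivity)] at h1
    have h2 : r ^ 2 = r' ^ 2 := by linarith
    exact (pow_left_inj₀ hr.le hr'.le two_ne_zero).1 h2

/-- The angular mean of `f · affineSymbol l` after the contour shift. The summand with `l 3` is absent:
it is odd in the polar angle. -/
noncomputable def laplaceDensity (f : ℂ → ℂ) (l : Fin 4 → ℂ) (c s u : ℝ) : ℂ :=
  l 0 * angularMean f 0 c s u + l 1 * angularMean (fun t => f t * t) 0 c s u +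
    l 2 * (Complex.I * (1 + u) * s * angularMean f 0 c s u
      - Complex.I * c * angularMean f 1 c s u)

theorem integral_angular_affineSymbol (hf : IsAmplitude f R M p) (hc : 0 < c) {u : ℝ}
    (hu : 0 ≤ u) :
    ∫ θ in -π..π, f (obliqueArg c s u θ) * affineSymbol l (obliqueArg c s u θ)
      (√(u ^ 2 + 2 * u) * Real.cos θ * c + Complex.I * ((1 + u) * s))
      (√(u ^ 2 + 2 * u) * Real.sin θ) = 2 * π * laplaceDensity f l c s u := by
  set q := √(u ^ 2 + 2 * u) with hq
  have hfc : Continuous fun θ => f (obliqueArg c s u θ) :=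
    hf.continuous_comp_obliqueArg s hc hu
  have hTc := continuous_obliqueArg c s u
  have hsin : ∫ θ in -π..π, f (obliqueArg c s u θ) * (Real.sin θ : ℂ) = 0 := by
    have h := intervalIntegral.integral_comp_neg (a := -π) (b := π)
      (fun θ => f (obliqueArg c s u θ) * (Real.sin θ : ℂ))
    have hT : ∀ θ, obliqueArg c s u (-θ) = obliqueArg c s u θ := fun θ => by
      simp [obliqueArg]
    simp only [hT, Real.sin_neg, Complex.ofReal_neg, mul_neg, intervalIntegral.integral_neg,
      neg_neg] at h
    have h2 : (2 : ℂ) * ∫ θ in -π..π, f (obliqueArg c s u θ) * (Real.sin θ : ℂ) = 0 := by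
      linear_combination -h
    simpa using h2
  have hsplit : ∀ θ, f (obliqueArg c s u θ) * affineSymbol l (obliqueArg c s u θ)
      (q * Real.cos θ * c + Complex.I * ((1 + u) * s)) (q * Real.sin θ)
      = (l 0 + l 2 * (Complex.I * ((1 + u) * s))) * f (obliqueArg c s u θ) +
        l 1 * (f (obliqueArg c s u θ) * obliqueArg c s u θ) +
        (-l 2 * Complex.I * c) * (f (obliqueArg c s u θ) * (Complex.I * (q * Real.cos θ))) +
        (l 3 * q) * (f (obliqueArg c s u θ) * (Real.sin θ : ℂ)) := fun θ => by
    unfold affineSymbol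
    linear_combination (l 2 * c * f (obliqueArg c s u θ) * q * Real.cos θ) * Complex.I_sq
  simp_rw [hsplit]
  have i1 : IntervalIntegrable (fun θ => (l 0 + l 2 * (Complex.I * ((1 + u) * s))) *
      f (obliqueArg c s u θ)) volume (-π) π := (continuous_const.mul hfc).intervalIntegrable _ _
  have i2 : IntervalIntegrable (fun θ => l 1 * (f (obliqueArg c s u θ) * obliqueArg c s u θ))
      volume (-π) π := (continuous_const.mul (hfc.mul hTc)).intervalIntegrable _ _
  have i3 : IntervalIntegrable (fun θ => (-l 2 * Complex.I * c) * (f (obliqueArg c s u θ) *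
      (Complex.I * (q * Real.cos θ)))) volume (-π) π :=
    (continuous_const.mul (hfc.mul (by fun_prop))).intervalIntegrable _ _
  have i4 : IntervalIntegrable (fun θ => (l 3 * q) * (f (obliqueArg c s u θ) * (Real.sin θ : ℂ)))
      volume (-π) π := (continuous_const.mul (hfc.mul (by fun_prop))).intervalIntegrable _ _
  rw [intervalIntegral.integral_add ((i1.add i2).add i3) i4,
    intervalIntegral.integral_add (i1.add i2) i3, intervalIntegral.integral_add i1 i2]
  simp only [intervalIntegral.integral_const_mul]
  rw [hsin, laplaceDensity, angularMean, angularMean, angularMean]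
  simp only [pow_zero, mul_one, pow_one, ← hq]
  have hpi : (π : ℂ) ≠ 0 := by exact_mod_cast Real.pi_ne_zero
  generalize (∫ θ in -π..π, f (obliqueArg c s u θ)) = J₀
  generalize (∫ θ in -π..π, f (obliqueArg c s u θ) * obliqueArg c s u θ) = J₁
  generalize (∫ θ in -π..π, f (obliqueArg c s u θ) * (Complex.I * (q * Real.cos θ))) = J₂
  field_simp
  ring

theorem integral_rotatedIntegrand (hf : IsAmplitude f R M p) (hl : 0 < lam)
    (hc : c ∈ Set.Ioc (0 : ℝ) 1) (hs : s ∈ Set.Icc (0 : ℝ) 1) :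
    ∫ q, rotatedIntegrand f l lam c s q = 2 * π * ∫ u in Set.Ioi (0 : ℝ),
      (Real.exp (-(lam * (1 + u))) : ℂ) * laplaceDensity f l c s u := by
  have hM := hf.bound_nonneg
  have hbr : ∀ r θ : ℝ, bracket (r * Real.cos θ, r * Real.sin θ) = √(1 + r ^ 2) := fun r θ => by
    rw [bracket]; congr 1
    linear_combination r ^ 2 * Real.cos_sq_add_sin_sq θ
  rw [← integral_comp_polarCoord_symm]
  simp only [polarCoord_target, polarCoord_symm_apply]
  obtain ⟨C, hC, hexp⟩ := exists_one_add_pow_mul_exp_le (p + 1 + 3) hl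
  have hint : IntegrableOn (fun z : ℝ × ℝ =>
      z.1 • rotatedIntegrand f l lam c s (z.1 * Real.cos z.2, z.1 * Real.sin z.2))
      (Set.Ioi (0 : ℝ) ×ˢ Set.Ioo (-π) π) ((volume : Measure ℝ).prod volume) := by
    rw [IntegrableOn, ← Measure.prod_restrict]
    have h0 : Integrable (fun z : ℝ × ℝ => M * 2 ^ (p + 1) * (∑ i, ‖l i‖) * C * (1 + z.1 ^ 2)⁻¹)
        (((volume : Measure ℝ).restrict (Set.Ioi 0)).prod
          ((volume : Measure ℝ).restrict (Set.Ioo (-π) π))) :=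
      ((integrable_inv_one_add_sq.restrict (s := Set.Ioi 0)).const_mul _).comp_fst _
    refine h0.mono' ?_ (Eventually.of_forall fun z => ?_)
    · have := continuous_rotatedIntegrand (lam := lam) (s := s) l hf hc.1
      exact Continuous.aestronglyMeasurable (by fun_prop)
    · have h1 := norm_rotatedIntegrand_le (lam := lam) l hf hc hs
        (z.1 * Real.cos z.2, z.1 * Real.sin z.2)
      rw [hbr] at h1
      set t := √(1 + z.1 ^ 2) with ht
      have ht0 : 0 < t := by positivity
      have ht2 : t ^ 2 = 1 + z.1 ^ 2 := Real.sq_sqrt (by positivity)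
      have hz : |z.1| ≤ t := Real.abs_le_sqrt (by linarith)
      rw [norm_smul, ← div_eq_mul_inv, le_div_iff₀ (by positivity), Real.norm_eq_abs, ← ht2]
      calc _ ≤ (1 + t) * (M * 2 ^ (p + 1) * (∑ i, ‖l i‖) *
            (1 + t) ^ (p + 1) * Real.exp (-(lam * t))) * (1 + t) ^ 2 := by
            gcongr <;> linarith
        _ = M * 2 ^ (p + 1) * (∑ i, ‖l i‖) * ((1 + t) ^ (p + 1 + 3) * Real.exp (-(lam * t))) := by
            ring
        _ ≤ _ := by gcongr; exact hexp t ht0.le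
  rw [Measure.volume_eq_prod, setIntegral_prod _ hint, ← integral_const_mul,
    ← integral_radial_substitution
      fun u => 2 * π * ((Real.exp (-(lam * (1 + u))) : ℂ) * laplaceDensity f l c s u)]
  refine setIntegral_congr_fun measurableSet_Ioi fun r hr => ?_
  have hr : 0 < r := hr
  simp only
  set t := √(1 + r ^ 2) with ht
  have ht0 : 0 < t := by positivity
  have ht2 : t ^ 2 = 1 + r ^ 2 := Real.sq_sqrt (by positivity)
  have ht1 : 1 ≤ t := by nlinarith
  set u := t - 1 with hu
  have hu0 : 0 ≤ u := by linarith
  have htu : (t : ℂ) = 1 + u := by rw [hu]; push_cast; ring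
  have hqr : √(u ^ 2 + 2 * u) = r := by
    rw [show u ^ 2 + 2 * u = r ^ 2 by rw [hu]; linarith, Real.sqrt_sq hr.le]
  have hmain := integral_angular_affineSymbol (s := s) l hf hc.1 hu0
  rw [hqr, intervalIntegral.integral_of_le (by linarith [Real.pi_pos]),
    integral_Ioc_eq_integral_Ioo] at hmain
  have hexpu : (Real.exp (-(lam * (1 + u))) : ℂ) = Complex.exp (-(lam * (1 + u))) := by
    push_cast; rfl
  rw [show (2 * π * ((Real.exp (-(lam * (1 + u))) : ℂ) * laplaceDensity f l c s u))
    = Real.exp (-(lam * (1 + u))) * (2 * π * laplaceDensity f l c s u) by ring, ← hmain,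
    ← integral_const_mul, ← integral_const_mul]
  refine setIntegral_congr_fun measurableSet_Ioo fun θ _ => ?_
  have htne : (t : ℂ) ≠ 0 := by exact_mod_cast ht0.ne'
  simp only [rotatedIntegrand, hbr, obliqueArg, Complex.real_smul, hexpu, hqr]
  rw [← ht]
  push_cast
  have e1 : (t : ℂ) * c + Complex.I * (r * Complex.cos θ * s)
    = c * (1 + u) + Complex.I * (s * r * Complex.cos θ) := by rw [htu]; ring
  rw [e1, ← htu]
  field_simp

/-- The oscillatory plane integral as a Laplace transform. -/
theorem integral_planeIntegrand_eq_laplace (hf : IsAmplitude f R M p) (hl : 0 < lam)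
    (hc : 0 < c) (hs : 0 ≤ s) (hcs : c ^ 2 + s ^ 2 = 1) :
    ∫ q, planeIntegrand f l lam c s q = 2 * π * Real.exp (-lam) * ∫ u in Set.Ioi (0 : ℝ),
      (Real.exp (-(lam * u)) : ℂ) * laplaceDensity f l c s u := by
  rw [integral_planeIntegrand l hf hl hc hs hcs, integral_rotatedIntegrand l hf hl
    ⟨hc, by nlinarith⟩ ⟨hs, by nlinarith⟩]
  have h : ∀ u : ℝ, (Real.exp (-(lam * (1 + u))) : ℂ) * laplaceDensity f l c s u
      = Real.exp (-lam) * ((Real.exp (-(lam * u)) : ℂ) * laplaceDensity f l c s u) := fun u => by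
    rw [← mul_assoc, ← Complex.ofReal_mul, ← Real.exp_add]
    congr 3
    ring
  simp_rw [h]
  rw [integral_const_mul]
  ring

end Rotation

/-! ### The vertical frequency -/

/-- The Fourier transform of the Lorentzian `1 / (y² + a²)`, by Fourier inversion of
`exp (-a |x|)`. -/
theorem integral_exp_mul_div_sq_add_sq {a : ℝ} (ha : 0 < a) (k : ℝ) :
    ∫ y : ℝ, Complex.exp (Complex.I * (k * y)) / ((y ^ 2 + a ^ 2 : ℝ) : ℂ)
      = ((π / a * Real.exp (-(a * |k|)) : ℝ) : ℂ) := by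
  set f : ℝ → ℂ := fun x => (Real.exp (-(a * |x|)) : ℂ) with hf
  have hfc : Continuous f := by simp only [hf]; fun_prop
  have hgen : ∀ w : ℝ, ∫ v : ℝ, Complex.exp (((-2 * π * v * w : ℝ) : ℂ) * Complex.I) • f v
        = ((2 * a / (a ^ 2 + (2 * π * w) ^ 2) : ℝ) : ℂ)
      ∧ Integrable fun v : ℝ => Complex.exp (((-2 * π * v * w : ℝ) : ℂ) * Complex.I) • f v := by
    intro w
    -- The integrals over the two half-lines converge because the exponents have real parts `± a`.
    set bm : ℂ := a - 2 * π * w * Complex.I with hbm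
    set bp : ℂ := -a - 2 * π * w * Complex.I with hbp
    have hbm0 : 0 < bm.re := by simp [hbm, ha]
    have hbp0 : bp.re < 0 := by simp [hbp, ha]
    have e1 : Set.EqOn (fun v : ℝ => Complex.exp (((-2 * π * v * w : ℝ) : ℂ) * Complex.I) • f v)
        (fun v : ℝ => Complex.exp (bm * v)) (Set.Iic 0) := fun v hv => by
      simp only [hf, smul_eq_mul, abs_of_nonpos (show v ≤ 0 from hv), Complex.ofReal_exp]
      rw [← Complex.exp_add, hbm]
      congr 1; push_cast; ring
    have e2 : Set.EqOn (fun v : ℝ => Complex.exp (((-2 * π * v * w : ℝ) : ℂ) * Complex.I) • f v)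
        (fun v : ℝ => Complex.exp (bp * v)) (Set.Ioi 0) := fun v hv => by
      simp only [hf, smul_eq_mul, abs_of_pos (show 0 < v from hv), Complex.ofReal_exp]
      rw [← Complex.exp_add, hbp]
      congr 1; push_cast; ring
    have i1 := (integrableOn_exp_mul_complex_Iic hbm0 0).congr_fun e1.symm measurableSet_Iic
    have i2 := (integrableOn_exp_mul_complex_Ioi hbp0 0).congr_fun e2.symm measurableSet_Ioi
    constructor
    · rw [← intervalIntegral.integral_Iic_add_Ioi i1 i2, setIntegral_congr_fun measurableSet_Iic e1,
        setIntegral_congr_fun measurableSet_Ioi e2, integral_exp_mul_complex_Iic hbm0,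
        integral_exp_mul_complex_Ioi hbp0]
      have hbm1 : bm ≠ 0 := fun h => by rw [h] at hbm0; simp at hbm0
      have hbp1 : bp ≠ 0 := fun h => by rw [h] at hbp0; simp at hbp0
      have hden : ((a ^ 2 + (2 * π * w) ^ 2 : ℝ) : ℂ) ≠ 0 := by
        exact_mod_cast (by positivity : (a ^ 2 + (2 * π * w) ^ 2 : ℝ) ≠ 0)
      have hprod : bm * bp = -((a ^ 2 + (2 * π * w) ^ 2 : ℝ) : ℂ) := by
        rw [hbm, hbp]; push_cast
        linear_combination (2 * π * w : ℂ) ^ 2 * Complex.I_sq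
      rw [Complex.ofReal_div, eq_div_iff hden, ← neg_neg ((a ^ 2 + (2 * π * w) ^ 2 : ℝ) : ℂ),
        ← hprod]
      simp only [Complex.ofReal_zero, mul_zero, Complex.exp_zero]
      field_simp
      rw [hbm, hbp]; push_cast; ring
    · rw [← integrableOn_univ, ← Set.Iic_union_Ioi (a := (0 : ℝ))]
      exact i1.union i2
  have hfi : Integrable f := by simpa using (hgen 0).2
  have hFf : FourierTransform.fourier f
      = fun w : ℝ => ((2 * a / (a ^ 2 + (2 * π * w) ^ 2) : ℝ) : ℂ) := by
    funext w
    rw [Real.fourier_real_eq_integral_exp_smul]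
    exact (hgen w).1
  have hFi : Integrable (FourierTransform.fourier f) := by
    rw [hFf]
    have h1 : Integrable fun w : ℝ => (2 / a) * (1 + (2 * π / a * w) ^ 2)⁻¹ :=
      (integrable_inv_one_add_sq.comp_mul_left' (by positivity : 2 * π / a ≠ 0)).const_mul _
    have h2 : Integrable fun w : ℝ => 2 * a / (a ^ 2 + (2 * π * w) ^ 2) := by
      refine h1.congr (Eventually.of_forall fun w => ?_)
      simp only
      field_simp
    exact h2.ofReal
  have hinv := congrFun (hfc.fourierInv_fourier_eq hfi hFi) k
  rw [Real.fourierInv_eq', hFf] at hinv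
  have hsub := Measure.integral_comp_mul_left
    (fun y : ℝ => Complex.exp (Complex.I * (k * y)) / ((y ^ 2 + a ^ 2 : ℝ) : ℂ)) (2 * π)
  have hcongr : (∫ v : ℝ, Complex.exp (((2 * π * inner ℝ v k : ℝ) : ℂ) * Complex.I) •
      ((2 * a / (a ^ 2 + (2 * π * v) ^ 2) : ℝ) : ℂ))
      = 2 * a * ∫ v : ℝ, Complex.exp (Complex.I * (k * ((2 * π * v : ℝ) : ℂ))) /
        (((2 * π * v) ^ 2 + a ^ 2 : ℝ) : ℂ) := by
    rw [← integral_const_mul]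
    congr 1 with v
    have : ((2 * π * inner ℝ v k : ℝ) : ℂ) * Complex.I
        = Complex.I * (k * ((2 * π * v : ℝ) : ℂ)) := by
      simp; ring
    rw [this, smul_eq_mul]
    push_cast
    rw [add_comm ((a : ℂ) ^ 2)]
    ring
  rw [hcongr, hsub, abs_of_pos (by positivity), Complex.real_smul] at hinv
  rw [Complex.ofReal_mul, show ((Real.exp (-(a * |k|)) : ℝ) : ℂ) = f k from rfl, ← hinv]
  push_cast
  have hpi : (π : ℂ) ≠ 0 := by exact_mod_cast Real.pi_ne_zero
  have ha' : (a : ℂ) ≠ 0 := by exact_mod_cast ha.ne'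
  field_simp

/-- The coordinates `(ξ₃, (ξ₁, ξ₂))`. -/
noncomputable def verticalCoord : EuclideanSpace ℝ (Fin 3) ≃ᵐ ℝ × (ℝ × ℝ) :=
  (MeasurableEquiv.toLp 2 (Fin 3 → ℝ)).symm.trans
    ((MeasurableEquiv.piFinSuccAbove (fun _ => ℝ) (2 : Fin 3)).trans
      (MeasurableEquiv.prodCongr (MeasurableEquiv.refl ℝ)
        (MeasurableEquiv.piFinTwo fun _ => ℝ)))

theorem verticalCoord_apply (ξ : EuclideanSpace ℝ (Fin 3)) :
    verticalCoord ξ = (ξ 2, (ξ 0, ξ 1)) := rfl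

theorem measurePreserving_verticalCoord : MeasurePreserving verticalCoord :=
  (((MeasurePreserving.id volume).prod (volume_preserving_piFinTwo fun _ => ℝ)).comp
    (volume_preserving_piFinSuccAbove (fun _ : Fin 3 => ℝ) 2)).comp
      (EuclideanSpace.volume_preserving_symm_measurableEquiv_toLp (Fin 3))

/-- A rotation of the plane preserves integrals. -/
theorem integral_comp_rotation {a b : ℝ} (hab : a ^ 2 + b ^ 2 = 1) (G : ℝ × ℝ → ℂ) :
    ∫ q : ℝ × ℝ, G (a * q.1 - b * q.2, b * q.1 + a * q.2) = ∫ q, G q := by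
  have hmem : (⟨a, b⟩ : ℂ) ∈ Submonoid.unitSphere ℂ := by
    refine mem_sphere_zero_iff_norm.2 ?_
    rw [← sq_eq_sq₀ (norm_nonneg _) zero_le_one, Complex.sq_norm,
      Complex.normSq_mk]
    linarith
  set ρ : Circle := ⟨⟨a, b⟩, hmem⟩ with hρ
  have e1 := Complex.volume_preserving_equiv_real_prod.integral_comp'
    (g := fun q : ℝ × ℝ => G (a * q.1 - b * q.2, b * q.1 + a * q.2))
  have e2 := Complex.volume_preserving_equiv_real_prod.integral_comp' (g := G)
  have e3 := (LinearIsometryEquiv.measurePreserving (rotation ρ)).integral_comp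
    (rotation ρ).toHomeomorph.measurableEmbedding
    (fun z : ℂ => G (Complex.measurableEquivRealProd z))
  rw [← e1, ← e2, ← e3]
  have hr : ∀ z : ℂ, rotation ρ z = ⟨a, b⟩ * z := fun z => rotation_apply ρ z
  congr 1 with z
  simp only [Complex.measurableEquivRealProd_apply, hr, Complex.mul_re, Complex.mul_im]
  rw [add_comm (b * z.re)]

/-! ### The plane integral and its gradient -/

/-- The integrand of the wave after the vertical frequency has been integrated out, in normalized
tangential frequencies; `μ = τ / √γ₋`. -/
noncomputable def waveIntegrand (f : ℂ → ℂ) (l : Fin 4 → ℂ) (μ : ℝ)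
    (w : EuclideanSpace ℝ (Fin 3)) (q : ℝ × ℝ) : ℂ :=
  Complex.exp (μ * (Complex.I * (q.1 * w 0 + q.2 * w 1) + bracket q * w 2)) *
    (f (bracket q) * affineSymbol l (bracket q) q.1 q.2) / (bracket q : ℂ)

section WaveIntegrand

variable {f : ℂ → ℂ} {R M : ℝ} {p : ℕ} (l : Fin 4 → ℂ) {μ : ℝ}
  {w : EuclideanSpace ℝ (Fin 3)}

theorem continuous_waveIntegrand (hf : IsAmplitude f R M p) :
    Continuous (waveIntegrand f l μ w) := by
  have hbc := continuous_bracket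
  have h1 : Continuous fun q : ℝ × ℝ => f (bracket q) :=
    hf.continuous_comp (by fun_prop) fun q => by simpa using bracket_pos q
  have h2 : Continuous fun q : ℝ × ℝ => affineSymbol l (bracket q) q.1 q.2 :=
    continuous_affineSymbol l (by fun_prop) (by fun_prop) (by fun_prop)
  unfold waveIntegrand
  exact Continuous.div (Continuous.mul (by fun_prop) (h1.mul h2)) (by fun_prop)
    fun q => by exact_mod_cast (bracket_pos q).ne'

theorem norm_waveIntegrand_le (hf : IsAmplitude f R M p) (q : ℝ × ℝ) :
    ‖waveIntegrand f l μ w q‖ ≤ M * (∑ i, ‖l i‖) * (1 + bracket q) ^ (p + 1) *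
      Real.exp (μ * (bracket q * w 2)) := by
  have hM := hf.bound_nonneg
  have hq := bracket_pos q
  have hbq : ‖(bracket q : ℂ)‖ = bracket q := by
    rw [Complex.norm_real, Real.norm_of_nonneg hq.le]
  have hF := hf.norm_le (bracket q) (by simpa using hq)
  have hL := norm_affineSymbol_le l hbq.le (x := (q.1 : ℂ)) (y := (q.2 : ℂ))
    (by rw [Complex.norm_real]; exact abs_fst_le_bracket q)
    (by rw [Complex.norm_real]; exact abs_snd_le_bracket q)
  rw [hbq] at hF
  refine (norm_div_bracket_le _ q).trans ?_
  rw [norm_mul, norm_mul, Complex.norm_exp]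
  have hexp : (μ * (Complex.I * (q.1 * w 0 + q.2 * w 1) + bracket q * w 2) : ℂ).re
      = μ * (bracket q * w 2) := by
    simp
  rw [hexp]
  calc _ ≤ Real.exp (μ * (bracket q * w 2)) * (M * (1 + bracket q) ^ p *
        ((∑ i, ‖l i‖) * (1 + bracket q))) := by gcongr
    _ = _ := by ring

theorem integrable_waveIntegrand (hf : IsAmplitude f R M p) (hμ : 0 < μ)
    (hw : w ∈ lowerHalfSpace) : Integrable (waveIntegrand f l μ w) := by
  have hM := hf.bound_nonneg
  have hw : w 2 < 0 := hw
  refine integrable_of_norm_le_bracket (κ := μ * -(w 2)) (C := M * ∑ i, ‖l i‖) (k := p + 1)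
    (continuous_waveIntegrand l hf) (mul_pos hμ (neg_pos.2 hw)) (by positivity) fun q => ?_
  refine (norm_waveIntegrand_le l hf q).trans_eq ?_
  congr 2; ring

/-- A rotation of the tangential frequencies brings the integral to its normal form. -/
theorem integral_waveIntegrand_eq_planeIntegrand (hw : w ∈ lowerHalfSpace) {a b : ℝ}
    (hab : a ^ 2 + b ^ 2 = 1) (h0 : w 0 = ‖tangential w‖ * a) (h1 : w 1 = ‖tangential w‖ * b) :
    ∫ q, waveIntegrand f l μ w q = ∫ q, planeIntegrand f
      ![l 0, l 1, a * l 2 + b * l 3, -b * l 2 + a * l 3] (μ * ‖w‖) (verticalCos w)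
        (verticalSin w) q := by
  rw [← integral_comp_rotation hab]
  congr 1 with q
  have hn := (norm_pos_of_mem_lowerHalfSpace hw).ne'
  have hbr : bracket (a * q.1 - b * q.2, b * q.1 + a * q.2) = bracket q := by
    simp only [bracket]
    congr 1
    linear_combination (q.1 ^ 2 + q.2 ^ 2) * hab
  simp only [waveIntegrand, planeIntegrand, hbr]
  congr 2
  · congr 1
    have e1 : ‖w‖ * verticalCos w = -(w 2) := by rw [verticalCos]; field_simp
    have e2 : ‖w‖ * verticalSin w = ‖tangential w‖ := by rw [verticalSin]; field_simp
    have e3 : (a * q.1 - b * q.2) * w 0 + (b * q.1 + a * q.2) * w 1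
        = q.1 * (‖w‖ * verticalSin w) := by
      rw [e2, h0, h1]
      linear_combination (q.1 * ‖tangential w‖) * hab
    have e1' : (‖w‖ : ℂ) * verticalCos w = -(w 2 : ℂ) := by exact_mod_cast e1
    have e3' : ((a * q.1 - b * q.2 : ℝ) : ℂ) * w 0 + ((b * q.1 + a * q.2 : ℝ) : ℂ) * w 1
        = q.1 * (‖w‖ * verticalSin w) := by exact_mod_cast e3
    rw [e3']
    push_cast
    linear_combination (μ * bracket q : ℂ) * e1'
  · congr 1
    simp [affineSymbol]
    ring

/-- The phase of the plane integral as a linear function of the position. -/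
noncomputable def phaseCLM (q : ℝ × ℝ) : EuclideanSpace ℝ (Fin 3) →L[ℝ] ℂ :=
  (Complex.I * q.1) • Complex.ofRealCLM.comp (EuclideanSpace.proj (𝕜 := ℝ) (0 : Fin 3)) +
  (Complex.I * q.2) • Complex.ofRealCLM.comp (EuclideanSpace.proj (𝕜 := ℝ) (1 : Fin 3)) +
  (bracket q : ℂ) • Complex.ofRealCLM.comp (EuclideanSpace.proj (𝕜 := ℝ) (2 : Fin 3))

theorem phaseCLM_apply (q : ℝ × ℝ) (v : EuclideanSpace ℝ (Fin 3)) :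
    phaseCLM q v = Complex.I * (q.1 * v 0 + q.2 * v 1) + bracket q * v 2 := by
  simp [phaseCLM]; ring

theorem continuous_phaseCLM : Continuous phaseCLM := by
  have hbc := continuous_bracket
  unfold phaseCLM
  fun_prop

theorem norm_phaseCLM_le (q : ℝ × ℝ) : ‖phaseCLM q‖ ≤ 3 * bracket q := by
  have hq := bracket_pos q
  refine ContinuousLinearMap.opNorm_le_bound _ (by positivity) fun v => ?_
  rw [phaseCLM_apply]
  have hv : ∀ i, |v i| ≤ ‖v‖ := fun i => PiLp.norm_apply_le v i
  have n1 : ‖(q.1 * v 0 : ℂ)‖ ≤ bracket q * ‖v‖ := by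
    rw [norm_mul, Complex.norm_real, Complex.norm_real]
    exact mul_le_mul (abs_fst_le_bracket q) (hv 0) (norm_nonneg _) hq.le
  have n2 : ‖(q.2 * v 1 : ℂ)‖ ≤ bracket q * ‖v‖ := by
    rw [norm_mul, Complex.norm_real, Complex.norm_real]
    exact mul_le_mul (abs_snd_le_bracket q) (hv 1) (norm_nonneg _) hq.le
  have n3 : ‖(bracket q * v 2 : ℂ)‖ ≤ bracket q * ‖v‖ := by
    rw [norm_mul, Complex.norm_real, Complex.norm_real, Real.norm_of_nonneg hq.le]
    exact mul_le_mul_of_nonneg_left (hv 2) hq.le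
  have n4 : ‖Complex.I * (q.1 * v 0 + q.2 * v 1 : ℂ)‖ ≤ bracket q * ‖v‖ + bracket q * ‖v‖ := by
    rw [norm_mul, Complex.norm_I, one_mul]
    exact norm_add_le_of_le n1 n2
  linarith [norm_add_le_of_le n4 n3]

/-- The affine symbols of the partial derivatives: up to the factor `μ`, differentiation multiplies
the integrand by `i q₁`, `i q₂` and `bracket q`. -/
noncomputable def gradientSymbol : Fin 3 → Fin 4 → ℂ :=
  ![![0, 0, Complex.I, 0], ![0, 0, 0, Complex.I], ![0, 1, 0, 0]]

theorem hasFDerivAt_integral_waveIntegrand (hf : IsAmplitude f R M p) (hμ : 0 < μ)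
    (hw : w ∈ lowerHalfSpace) :
    ∃ L : EuclideanSpace ℝ (Fin 3) →L[ℝ] ℂ,
      HasFDerivAt (fun v => ∫ q, waveIntegrand f ![1, 0, 0, 0] μ v q) L w ∧
      ∀ k, L (EuclideanSpace.single k 1) = μ * ∫ q, waveIntegrand f (gradientSymbol k) μ w q := by
  have hM := hf.bound_nonneg
  have hw' : w 2 < 0 := hw
  set l₀ : Fin 4 → ℂ := ![1, 0, 0, 0] with hl₀
  -- Near `w` the third coordinate stays below `w 2 / 2`, which gives a common exponential decay.
  set S : Set (EuclideanSpace ℝ (Fin 3)) := {v | v 2 < w 2 / 2} with hS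
  have hSo : S ∈ 𝓝 w := by
    refine IsOpen.mem_nhds (isOpen_lt ?_ continuous_const) ?_
    · exact (EuclideanSpace.proj (𝕜 := ℝ) (2 : Fin 3)).continuous
    · simp only [hS, Set.mem_ofPred_eq]; linarith
  set F' : EuclideanSpace ℝ (Fin 3) → ℝ × ℝ → EuclideanSpace ℝ (Fin 3) →L[ℝ] ℂ :=
    fun v q => (waveIntegrand f l₀ μ v q * μ) • phaseCLM q with hF'
  have hF'c : ∀ v, Continuous (F' v) := fun v =>
    ((continuous_waveIntegrand l₀ hf).mul continuous_const).smul continuous_phaseCLM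
  set bd : ℝ × ℝ → ℝ := fun q => ‖((M * (∑ i, ‖l₀ i‖) * μ * 3 * (1 + bracket q) ^ (p + 2) *
      Real.exp (-(μ * -(w 2 / 2) * bracket q)) : ℝ) : ℂ)‖ with hbd
  have hbdi : Integrable bd := by
    have hbc := continuous_bracket
    refine (integrable_of_norm_le_bracket (C := M * (∑ i, ‖l₀ i‖) * μ * 3) (k := p + 2)
      (κ := μ * -(w 2 / 2)) (by fun_prop)
      (mul_pos hμ (by linarith)) (by positivity) fun q => ?_).norm
    have hq := bracket_pos q
    rw [Complex.norm_real, Real.norm_of_nonneg (by positivity)]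
  have hbound : ∀ q, ∀ v ∈ S, ‖F' v q‖ ≤ bd q := by
    intro q v hv
    have hq := bracket_pos q
    have hv : v 2 < w 2 / 2 := hv
    simp only [hF', hbd]
    rw [norm_smul, norm_mul, Complex.norm_real, Complex.norm_real, Real.norm_of_nonneg hμ.le,
      Real.norm_of_nonneg (by positivity)]
    have h1 := norm_waveIntegrand_le (μ := μ) (w := v) l₀ hf q
    have h2 : Real.exp (μ * (bracket q * v 2)) ≤ Real.exp (-(μ * -(w 2 / 2) * bracket q)) := by
      rw [Real.exp_le_exp]
      nlinarith [mul_pos hμ hq]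
    calc _ ≤ (M * (∑ i, ‖l₀ i‖) * (1 + bracket q) ^ (p + 1) *
          Real.exp (-(μ * -(w 2 / 2) * bracket q))) * μ * (3 * (1 + bracket q)) := by
          gcongr
          · refine h1.trans ?_
            gcongr
          · exact (norm_phaseCLM_le q).trans (by linarith)
      _ = _ := by ring
  have hdiff : ∀ q, ∀ v ∈ S, HasFDerivAt (fun v => waveIntegrand f l₀ μ v q) (F' v q) v := by
    intro q v _
    have h1 : HasFDerivAt (fun v => (μ : ℂ) * phaseCLM q v) ((μ : ℂ) • phaseCLM q) v :=
      (phaseCLM q).hasFDerivAt.const_mul _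
    have h2 := (h1.cexp.mul_const (f (bracket q) * affineSymbol l₀ (bracket q) q.1 q.2)).mul_const
      ((bracket q : ℂ)⁻¹)
    have h3 : (fun v => waveIntegrand f l₀ μ v q) = fun v => Complex.exp (μ * phaseCLM q v) *
        (f (bracket q) * affineSymbol l₀ (bracket q) q.1 q.2) * (bracket q : ℂ)⁻¹ := by
      funext v
      rw [phaseCLM_apply, waveIntegrand, div_eq_mul_inv]
    have h4 : F' v q = ((bracket q : ℂ)⁻¹) •
        (f (bracket q) * affineSymbol l₀ (bracket q) q.1 q.2) •
          Complex.exp (μ * phaseCLM q v) • (μ : ℂ) • phaseCLM q := by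
      simp only [hF', smul_smul]
      congr 1
      rw [congrFun h3 v]
      ring
    rw [h3, h4]
    exact h2
  have hF'i : Integrable (F' w) := hbdi.mono' (hF'c w).aestronglyMeasurable
    (Eventually.of_forall fun q => hbound q w (mem_of_mem_nhds hSo))
  refine ⟨∫ q, F' w q, hasFDerivAt_integral_of_dominated_of_fderiv_le hSo
    (Eventually.of_forall fun v => (continuous_waveIntegrand l₀ hf).aestronglyMeasurable)
    (integrable_waveIntegrand l₀ hf hμ hw) (hF'c w).aestronglyMeasurable
    (Eventually.of_forall hbound) hbdi (Eventually.of_forall hdiff), fun k => ?_⟩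
  rw [ContinuousLinearMap.integral_apply hF'i, ← integral_const_mul]
  congr 1 with q
  simp only [hF', smul_apply, phaseCLM_apply, waveIntegrand, smul_eq_mul,
    affineSymbol, hl₀, gradientSymbol]
  fin_cases k <;> simp <;> ring

end WaveIntegrand

/-! ### Reduction of the refracted wave to the plane integral -/

section Reduction

variable {γp γm : ℝ}

theorem transmissionCoeff_div_sqrt (hγp : 0 < γp) (hγ : γp < γm) {ρ : ℝ} {q : ℝ × ℝ}
    (hρ : γm * ρ ^ 2 = q.1 ^ 2 + q.2 ^ 2) :
    ((transmissionCoeff γp γm ρ / √(1 / γm + ρ ^ 2) : ℝ) : ℂ)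
      = refractedAmplitude γp γm (bracket q) / bracket q := by
  have hγm : 0 < γm := hγp.trans hγ
  have hq := bracket_pos q
  have hβ : 0 ≤ γm / γp - 1 := by
    rw [sub_nonneg, le_div_iff₀ hγp]; linarith
  have hsγ : 0 < √γm := Real.sqrt_pos.2 hγm
  have hS : √(1 / γm + ρ ^ 2) = bracket q / √γm := by
    rw [bracket, ← Real.sqrt_div (by positivity)]
    congr 1
    field_simp
    linarith
  have hP : √(1 / γp + ρ ^ 2) = √(bracket q ^ 2 + √(γm / γp - 1) ^ 2) / √γm := by
    rw [← Real.sqrt_div (by positivity), Real.sq_sqrt hβ, bracket_sq]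
    congr 1
    field_simp
    linear_combination γp * hρ
  have hne : (bracket q : ℂ) ≠ 0 := by exact_mod_cast hq.ne'
  rw [refractedAmplitude, shiftedSqrt_ofReal, mul_div_assoc, div_self hne, mul_one,
    transmissionCoeff, hS, hP]
  set Q := √(bracket q ^ 2 + √(γm / γp - 1) ^ 2) with hQ
  have hQ0 : 0 < Q := by positivity
  have : 4 * γp * γm * (Q / √γm) * (bracket q / √γm) /
      (γp * (Q / √γm) + γm * (bracket q / √γm)) / (bracket q / √γm)
      = 4 * γp * γm * Q / (γp * Q + γm * bracket q) := by
    have : 0 < γp * Q + γm * bracket q := by positivity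
    field_simp
  rw [this]
  push_cast
  rfl

theorem continuous_transmissionCoeff (hγp : 0 < γp) (hγm : 0 < γm) :
    Continuous (transmissionCoeff γp γm) := by
  unfold transmissionCoeff
  exact Continuous.div (by fun_prop) (by fun_prop) fun ρ => by positivity

theorem abs_transmissionCoeff_le (hγp : 0 < γp) (hγm : 0 < γm) (ρ : ℝ) :
    |transmissionCoeff γp γm ρ| ≤ 4 * γm * √(1 / γm + ρ ^ 2) := by
  have h : 0 ≤ transmissionCoeff γp γm ρ := by unfold transmissionCoeff; positivity
  rw [abs_of_nonneg h, transmissionCoeff, div_le_iff₀ (by positivity)]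
  have h1 : 0 ≤ √(1 / γp + ρ ^ 2) := by positivity
  have h2 : 0 ≤ √(1 / γm + ρ ^ 2) := by positivity
  have : 0 ≤ 4 * γm * √(1 / γm + ρ ^ 2) * (γm * √(1 / γm + ρ ^ 2)) := by positivity
  nlinarith

/-- The integrand of the damped wave in the coordinates `(ξ₃, (ξ₁, ξ₂))`. -/
noncomputable def productIntegrand (γp γm τ ε : ℝ) (w : EuclideanSpace ℝ (Fin 3))
    (z : ℝ × (ℝ × ℝ)) : ℂ :=
  (Real.exp (-ε * (z.2.1 ^ 2 + z.2.2 ^ 2)) : ℂ) *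
    Complex.exp (Complex.I * ((τ * (z.2.1 * w 0 + z.2.2 * w 1 + z.1 * w 2) : ℝ) : ℂ)) *
    ((1 / (γm * (z.2.1 ^ 2 + z.2.2 ^ 2 + z.1 ^ 2) + 1) *
      transmissionCoeff γp γm √(z.2.1 ^ 2 + z.2.2 ^ 2) : ℝ) : ℂ)

theorem refractedIntegrand_eq (τ ε : ℝ) (x : EuclideanSpace ℝ (Fin 3))
    (z : EuclideanSpace ℝ (Fin 2)) :
    refractedIntegrand γp γm τ ε x z =
      fun ξ => productIntegrand γp γm τ ε (x - boundaryPoint z) (verticalCoord ξ) := by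
  funext ξ
  have h1 : ‖tangential ξ‖ = √(ξ 0 ^ 2 + ξ 1 ^ 2) := by
    rw [← norm_tangential_sq, Real.sqrt_sq (norm_nonneg _)]
  have h2 : inner ℝ ξ (x - boundaryPoint z) = ξ 0 * (x - boundaryPoint z) 0
      + ξ 1 * (x - boundaryPoint z) 1 + ξ 2 * (x - boundaryPoint z) 2 := by
    simp only [PiLp.inner_apply, Fin.sum_univ_three, RCLike.inner_apply, conj_trivial]
    ring
  rw [refractedIntegrand, productIntegrand, verticalCoord_apply, h2, norm_tangential_sq,
    norm_sq_fin_three, h1]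

theorem continuous_productIntegrand (hγp : 0 < γp) (hγm : 0 < γm) (τ ε : ℝ)
    (w : EuclideanSpace ℝ (Fin 3)) : Continuous (productIntegrand γp γm τ ε w) := by
  have h1 := continuous_transmissionCoeff hγp hγm
  have h2 : Continuous fun z : ℝ × (ℝ × ℝ) =>
      1 / (γm * (z.2.1 ^ 2 + z.2.2 ^ 2 + z.1 ^ 2) + 1) :=
    Continuous.div (by fun_prop) (by fun_prop) fun z => by positivity
  unfold productIntegrand
  fun_prop

theorem integrable_productIntegrand (hγp : 0 < γp) (hγm : 0 < γm) (τ : ℝ) {ε : ℝ} (hε : 0 < ε)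
    (w : EuclideanSpace ℝ (Fin 3)) :
    Integrable (productIntegrand γp γm τ ε w) ((volume : Measure ℝ).prod volume) := by
  set C := 1 / γm + 1 + 2 / ε with hC
  -- Half of the damping absorbs the growth of the transmission coefficient.
  have hsq : ∀ n : ℝ, 0 ≤ n → √(1 / γm + n) ≤ C * Real.exp (ε / 2 * n) := by
    intro n hn
    have h1 : √(1 / γm + n) ≤ 1 / γm + 1 + n := by
      rw [Real.sqrt_le_left (by positivity)]
      have : 0 ≤ 1 / γm := by positivity
      nlinarith
    have h2 : ε / 2 * n + 1 ≤ Real.exp (ε / 2 * n) := Real.add_one_le_exp _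
    have h3 : n ≤ 2 / ε * Real.exp (ε / 2 * n) := by
      rw [div_mul_eq_mul_div, le_div_iff₀ hε]; linarith
    have h4 : 1 / γm + 1 ≤ (1 / γm + 1) * Real.exp (ε / 2 * n) :=
      le_mul_of_one_le_right (by positivity) (by linarith [show 0 ≤ ε / 2 * n by positivity])
    rw [hC, add_mul]; linarith
  have hgauss : Integrable fun y : ℝ => Real.exp (-(ε / 2) * y ^ 2) :=
    integrable_exp_neg_mul_sq (by positivity)
  have hlor : Integrable fun y : ℝ => (γm * y ^ 2 + 1)⁻¹ := by
    refine (integrable_inv_one_add_sq.comp_mul_left' (Real.sqrt_pos.2 hγm).ne').congr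
      (Eventually.of_forall fun y => ?_)
    simp only [mul_pow, Real.sq_sqrt hγm.le, add_comm]
  have hdom := (hlor.mul_prod (hgauss.mul_prod hgauss)).const_mul (4 * γm * C)
  refine hdom.mono' (continuous_productIntegrand hγp hγm τ ε w).aestronglyMeasurable
    (Eventually.of_forall fun z => ?_)
  set n := z.2.1 ^ 2 + z.2.2 ^ 2 with hn
  have hn0 : 0 ≤ n := by positivity
  rw [productIntegrand, norm_mul, norm_mul, mul_comm Complex.I, Complex.norm_exp_ofReal_mul_I,
    mul_one, Complex.norm_real, Complex.norm_real, norm_mul, Real.norm_of_nonneg (Real.exp_pos _).le,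
    Real.norm_of_nonneg (by positivity), Real.norm_eq_abs]
  have h1 := abs_transmissionCoeff_le hγp hγm √n
  rw [Real.sq_sqrt hn0] at h1
  have h2 : 1 / (γm * (n + z.1 ^ 2) + 1) ≤ (γm * z.1 ^ 2 + 1)⁻¹ := by
    rw [one_div]
    gcongr
    linarith
  have h3 : Real.exp (-ε * n) * Real.exp (ε / 2 * n)
      = Real.exp (-(ε / 2) * z.2.1 ^ 2) * Real.exp (-(ε / 2) * z.2.2 ^ 2) := by
    rw [← Real.exp_add, ← Real.exp_add, hn]; congr 1; ring
  calc _ ≤ Real.exp (-ε * n) * ((γm * z.1 ^ 2 + 1)⁻¹ * (4 * γm * (C * Real.exp (ε / 2 * n)))) := by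
        gcongr
        refine h1.trans ?_
        gcongr
        exact hsq n hn0
    _ = 4 * γm * C * ((γm * z.1 ^ 2 + 1)⁻¹ *
        (Real.exp (-ε * n) * Real.exp (ε / 2 * n))) := by ring
    _ = _ := by rw [h3]

/-- Integration of the damped wave over the vertical frequency. -/
theorem integral_productIntegrand_fst (hγp : 0 < γp) (hγ : γp < γm) {τ : ℝ} (hτ : 0 < τ) (ε : ℝ)
    {w : EuclideanSpace ℝ (Fin 3)} (hw : w ∈ lowerHalfSpace) (q : ℝ × ℝ) :
    ∫ y, productIntegrand γp γm τ ε w (y, ((√γm)⁻¹ • q)) =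
      (π / γm : ℝ) * ((Real.exp (-(ε / γm) * (q.1 ^ 2 + q.2 ^ 2)) : ℂ) *
        waveIntegrand (refractedAmplitude γp γm) ![1, 0, 0, 0] (τ / √γm) w q) := by
  have hγm : 0 < γm := hγp.trans hγ
  have hsγ : 0 < √γm := Real.sqrt_pos.2 hγm
  have hsq : √γm ^ 2 = γm := Real.sq_sqrt hγm.le
  have hq := bracket_pos q
  have hw' : w 2 < 0 := hw
  set n := ((√γm)⁻¹ • q).1 ^ 2 + ((√γm)⁻¹ • q).2 ^ 2 with hn
  have hn' : n = (q.1 ^ 2 + q.2 ^ 2) / γm := by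
    simp only [hn, Prod.smul_fst, Prod.smul_snd, smul_eq_mul, mul_pow, inv_pow, hsq]
    field_simp
  have hn0 : 0 ≤ n := by positivity
  set σ := √(1 / γm + n) with hσ
  have hσ0 : 0 < σ := by positivity
  have hσ2 : σ ^ 2 = 1 / γm + n := Real.sq_sqrt (by positivity)
  have hσb : σ = bracket q / √γm := by
    rw [hσ, bracket, ← Real.sqrt_div (by positivity), hn']
    congr 1
    field_simp
    ring
  have htr := transmissionCoeff_div_sqrt hγp hγ (ρ := √n) (q := q)
    (by rw [Real.sq_sqrt hn0, hn']; field_simp)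
  rw [Real.sq_sqrt hn0, ← hσ] at htr
  have hpt : ∀ y : ℝ, productIntegrand γp γm τ ε w (y, ((√γm)⁻¹ • q))
      = ((Real.exp (-ε * n) : ℂ) * Complex.exp (Complex.I * ((τ * (((√γm)⁻¹ • q).1 * w 0
          + ((√γm)⁻¹ • q).2 * w 1) : ℝ) : ℂ)) * (transmissionCoeff γp γm √n / γm : ℝ)) *
        (Complex.exp (Complex.I * (((τ * w 2 : ℝ) : ℂ) * y)) / ((y ^ 2 + σ ^ 2 : ℝ) : ℂ)) := by
    intro y
    have h1 : 1 / (γm * (n + y ^ 2) + 1) = (1 / γm) / (y ^ 2 + σ ^ 2) := by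
      rw [hσ2]; field_simp; ring
    simp only [productIntegrand, ← hn]
    rw [h1, show Complex.I * ((τ * (((√γm)⁻¹ • q).1 * w 0 + ((√γm)⁻¹ • q).2 * w 1 + y * w 2) : ℝ) : ℂ)
      = Complex.I * ((τ * (((√γm)⁻¹ • q).1 * w 0 + ((√γm)⁻¹ • q).2 * w 1) : ℝ) : ℂ)
        + Complex.I * (((τ * w 2 : ℝ) : ℂ) * y) by push_cast; ring, Complex.exp_add]
    push_cast
    ring
  simp_rw [hpt]
  rw [integral_const_mul, integral_exp_mul_div_sq_add_sq hσ0, abs_of_neg (mul_neg_of_pos_of_neg hτ hw')]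
  have hneg : -ε * n = -(ε / γm) * (q.1 ^ 2 + q.2 ^ 2) := by rw [hn']; ring
  have hwave : waveIntegrand (refractedAmplitude γp γm) ![1, 0, 0, 0] (τ / √γm) w q
      = Complex.exp (Complex.I * ((τ * (((√γm)⁻¹ • q).1 * w 0
          + ((√γm)⁻¹ • q).2 * w 1) : ℝ) : ℂ)) * Real.exp (-(σ * -(τ * w 2))) *
        ((transmissionCoeff γp γm √n / σ : ℝ) : ℂ) := by
    rw [htr, waveIntegrand, Complex.ofReal_exp, ← Complex.exp_add, mul_div_assoc]
    congr 1
    · congr 1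
      rw [hσb]
      simp only [Prod.smul_fst, Prod.smul_snd, smul_eq_mul]
      push_cast
      ring
    · simp [affineSymbol]
  rw [hwave, hneg]
  push_cast
  ring

theorem integrable_refractedIntegrand (hγp : 0 < γp) (hγm : 0 < γm) (τ : ℝ) {ε : ℝ} (hε : 0 < ε)
    (x : EuclideanSpace ℝ (Fin 3)) (z : EuclideanSpace ℝ (Fin 2)) :
    Integrable (refractedIntegrand γp γm τ ε x z) := by
  rw [refractedIntegrand_eq]
  exact (measurePreserving_verticalCoord.integrable_comp_emb
    verticalCoord.measurableEmbedding).2 (integrable_productIntegrand hγp hγm τ hε _)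

/-- The damped wave in the normalized tangential frequencies `q = √γ₋ ξ'`. -/
theorem dampedRefractedWave_eq (hγp : 0 < γp) (hγ : γp < γm) {τ : ℝ} (hτ : 0 < τ) {ε : ℝ}
    (hε : 0 < ε) (x : EuclideanSpace ℝ (Fin 3)) (z : EuclideanSpace ℝ (Fin 2))
    (hw : x - boundaryPoint z ∈ lowerHalfSpace) :
    dampedRefractedWave γp γm τ ε x z = (τ / (8 * π ^ 2 * γm ^ 2) : ℝ) *
      ∫ q : ℝ × ℝ, (Real.exp (-(ε / γm) * (q.1 ^ 2 + q.2 ^ 2)) : ℂ) *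
        waveIntegrand (refractedAmplitude γp γm) ![1, 0, 0, 0] (τ / √γm) (x - boundaryPoint z) q := by
  have hγm : 0 < γm := hγp.trans hγ
  have hsγ : 0 < √γm := Real.sqrt_pos.2 hγm
  have hsq : √γm ^ 2 = γm := Real.sq_sqrt hγm.le
  set w := x - boundaryPoint z with hw_def
  have h1 : ∫ ξ, refractedIntegrand γp γm τ ε x z ξ
      = ∫ p : ℝ × ℝ, ∫ y : ℝ, productIntegrand γp γm τ ε w (y, p) := by
    rw [refractedIntegrand_eq, measurePreserving_verticalCoord.integral_comp', Measure.volume_eq_prod,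
      integral_prod_symm _ (integrable_productIntegrand hγp hγm τ hε w)]
  have h2 := Measure.integral_comp_smul_of_nonneg (volume : Measure (ℝ × ℝ))
    (fun p => ∫ y : ℝ, productIntegrand γp γm τ ε w (y, p)) (√γm)⁻¹ (hR := by positivity)
  have hrank : Module.finrank ℝ (ℝ × ℝ) = 2 := by simp
  simp_rw [integral_productIntegrand_fst hγp hγ hτ ε hw] at h2
  rw [hrank, inv_pow, inv_inv, hsq, integral_const_mul, Complex.real_smul, ← h1] at h2
  rw [dampedRefractedWave]
  have h3 : ∫ ξ, refractedIntegrand γp γm τ ε x z ξ = (π / γm ^ 2 : ℝ) *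
      ∫ q : ℝ × ℝ, (Real.exp (-(ε / γm) * (q.1 ^ 2 + q.2 ^ 2)) : ℂ) *
        waveIntegrand (refractedAmplitude γp γm) ![1, 0, 0, 0] (τ / √γm) w q := by
    have hγc : (γm : ℂ) ≠ 0 := by exact_mod_cast hγm.ne'
    apply mul_left_cancel₀ hγc
    rw [← h2, ← mul_assoc]
    congr 1
    push_cast
    field_simp
  rw [h3, ← mul_assoc, ← Complex.ofReal_mul]
  congr 2
  have := Real.pi_pos
  field_simp
  norm_num

theorem tendsto_dampedRefractedWave (hγp : 0 < γp) (hγ : γp < γm) {τ : ℝ} (hτ : 0 < τ)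
    (x : EuclideanSpace ℝ (Fin 3)) (z : EuclideanSpace ℝ (Fin 2))
    (hw : x - boundaryPoint z ∈ lowerHalfSpace) :
    Tendsto (fun ε => dampedRefractedWave γp γm τ ε x z) (𝓝[>] (0 : ℝ))
      (𝓝 ((τ / (8 * π ^ 2 * γm ^ 2) : ℝ) * ∫ q : ℝ × ℝ, waveIntegrand (refractedAmplitude γp γm)
        ![1, 0, 0, 0] (τ / √γm) (x - boundaryPoint z) q)) := by
  have hγm : 0 < γm := hγp.trans hγ
  obtain ⟨M, hF⟩ := isAmplitude_refractedAmplitude hγp hγ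
  have hμ : 0 < τ / √γm := by positivity
  have hint := integrable_waveIntegrand ![1, 0, 0, 0] hF hμ hw
  have hcont := continuous_waveIntegrand (μ := τ / √γm) (w := x - boundaryPoint z)
    ![1, 0, 0, 0] hF
  have hev : (fun ε => (τ / (8 * π ^ 2 * γm ^ 2) : ℝ) *
      ∫ q : ℝ × ℝ, (Real.exp (-(ε / γm) * (q.1 ^ 2 + q.2 ^ 2)) : ℂ) *
        waveIntegrand (refractedAmplitude γp γm) ![1, 0, 0, 0] (τ / √γm) (x - boundaryPoint z) q)
      =ᶠ[𝓝[>] (0 : ℝ)] fun ε => dampedRefractedWave γp γm τ ε x z := by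
    filter_upwards [self_mem_nhdsWithin] with ε hε
    exact (dampedRefractedWave_eq hγp hγ hτ hε x z hw).symm
  refine Tendsto.congr' hev (Tendsto.const_mul _ ?_)
  refine tendsto_integral_filter_of_dominated_convergence _ (Eventually.of_forall fun ε => ?_) ?_
    hint.norm (Eventually.of_forall fun q => ?_)
  · exact Continuous.aestronglyMeasurable (by fun_prop)
  · filter_upwards [self_mem_nhdsWithin] with ε hε
    have hε : 0 < ε := hε
    refine Eventually.of_forall fun q => ?_
    rw [norm_mul, Complex.norm_real, Real.norm_of_nonneg (Real.exp_pos _).le]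
    refine mul_le_of_le_one_left (norm_nonneg _) ?_
    rw [Real.exp_le_one_iff, neg_mul, neg_nonpos]
    positivity
  · have hc : Continuous fun ε : ℝ => (Real.exp (-(ε / γm) * (q.1 ^ 2 + q.2 ^ 2)) : ℂ) *
        waveIntegrand (refractedAmplitude γp γm) ![1, 0, 0, 0] (τ / √γm) (x - boundaryPoint z) q := by
      fun_prop
    have := hc.tendsto 0
    simp only [zero_div, neg_zero, zero_mul, Real.exp_zero, Complex.ofReal_one, one_mul] at this
    exact this.mono_left nhdsWithin_le_nhds

theorem refractedWave_eq (hγp : 0 < γp) (hγ : γp < γm) {τ : ℝ} (hτ : 0 < τ)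
    (x : EuclideanSpace ℝ (Fin 3)) (z : EuclideanSpace ℝ (Fin 2))
    (hw : x - boundaryPoint z ∈ lowerHalfSpace) :
    refractedWave γp γm τ x z = (τ / (8 * π ^ 2 * γm ^ 2) : ℝ) * ∫ q : ℝ × ℝ,
      waveIntegrand (refractedAmplitude γp γm) ![1, 0, 0, 0] (τ / √γm) (x - boundaryPoint z) q :=
  (tendsto_dampedRefractedWave hγp hγ hτ x z hw).limUnder_eq

theorem sub_boundaryPoint_mem {x : EuclideanSpace ℝ (Fin 3)} (hx : x ∈ lowerHalfSpace)
    (z : EuclideanSpace ℝ (Fin 2)) : x - boundaryPoint z ∈ lowerHalfSpace := by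
  have hx : x 2 < 0 := hx
  simpa [lowerHalfSpace, boundaryPoint] using hx

theorem isOpen_lowerHalfSpace : IsOpen lowerHalfSpace :=
  isOpen_lt (EuclideanSpace.proj (𝕜 := ℝ) (2 : Fin 3)).continuous continuous_const

theorem differentiableAt_refractedWave (hγp : 0 < γp) (hγ : γp < γm) {τ : ℝ} (hτ : 0 < τ)
    {x : EuclideanSpace ℝ (Fin 3)} (hx : x ∈ lowerHalfSpace) (z : EuclideanSpace ℝ (Fin 2)) :
    DifferentiableAt ℝ (fun y => refractedWave γp γm τ y z) x ∧
    ∀ k, refractedWavePartial γp γm τ k x z = (τ / (8 * π ^ 2 * γm ^ 2) : ℝ) *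
      ((τ / √γm : ℝ) * ∫ q : ℝ × ℝ, waveIntegrand (refractedAmplitude γp γm) (gradientSymbol k)
        (τ / √γm) (x - boundaryPoint z) q) := by
  have hγm : 0 < γm := hγp.trans hγ
  obtain ⟨M, hF⟩ := isAmplitude_refractedAmplitude hγp hγ
  have hμ : 0 < τ / √γm := by positivity
  obtain ⟨L, hL, hLk⟩ := hasFDerivAt_integral_waveIntegrand hF hμ (sub_boundaryPoint_mem hx z)
  have h1 : HasFDerivAt (fun y => ((τ / (8 * π ^ 2 * γm ^ 2) : ℝ) : ℂ) * ∫ q : ℝ × ℝ,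
      waveIntegrand (refractedAmplitude γp γm) ![1, 0, 0, 0] (τ / √γm) (y - boundaryPoint z) q)
      (((τ / (8 * π ^ 2 * γm ^ 2) : ℝ) : ℂ) • L) x :=
    (hL.comp x ((hasFDerivAt_id x).sub_const (boundaryPoint z))).const_mul _
  have hev : (fun y => refractedWave γp γm τ y z) =ᶠ[𝓝 x]
      fun y => ((τ / (8 * π ^ 2 * γm ^ 2) : ℝ) : ℂ) * ∫ q : ℝ × ℝ,
        waveIntegrand (refractedAmplitude γp γm) ![1, 0, 0, 0] (τ / √γm) (y - boundaryPoint z) q := by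
    filter_upwards [isOpen_lowerHalfSpace.mem_nhds hx] with y hy
    exact refractedWave_eq hγp hγ hτ y z (sub_boundaryPoint_mem hy z)
  have h2 := h1.congr_of_eventuallyEq hev
  refine ⟨h2.differentiableAt, fun k => ?_⟩
  rw [refractedWavePartial, h2.fderiv, smul_apply, hLk, smul_eq_mul]

end Reduction

/-! ### Watson's lemma -/

/-- The unit vector in the direction of the tangential part; an arbitrary one if that part
vanishes. -/
noncomputable def tangentialDir (w : EuclideanSpace ℝ (Fin 3)) : ℝ × ℝ :=
  if ‖tangential w‖ = 0 then (1, 0) else (w 0 / ‖tangential w‖, w 1 / ‖tangential w‖)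

theorem tangentialDir_sq (w : EuclideanSpace ℝ (Fin 3)) :
    (tangentialDir w).1 ^ 2 + (tangentialDir w).2 ^ 2 = 1 := by
  unfold tangentialDir
  split_ifs with h
  · norm_num
  · simp only [div_pow]
    rw [← add_div, ← norm_tangential_sq, div_self (pow_ne_zero 2 h)]

theorem norm_mul_tangentialDir (w : EuclideanSpace ℝ (Fin 3)) :
    w 0 = ‖tangential w‖ * (tangentialDir w).1 ∧ w 1 = ‖tangential w‖ * (tangentialDir w).2 := by
  have hsq := norm_tangential_sq w
  unfold tangentialDir
  split_ifs with h
  · rw [h] at hsq ⊢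
    exact ⟨by nlinarith [sq_nonneg (w 0), sq_nonneg (w 1)],
      by nlinarith [sq_nonneg (w 0), sq_nonneg (w 1)]⟩
  · constructor <;> field_simp

theorem norm_tangentialDir_le (w : EuclideanSpace ℝ (Fin 3)) :
    ‖((tangentialDir w).1 : ℂ)‖ ≤ 1 ∧ ‖((tangentialDir w).2 : ℂ)‖ ≤ 1 := by
  have h := tangentialDir_sq w
  simp only [Complex.norm_real, Real.norm_eq_abs]
  exact ⟨abs_le_one_iff_mul_self_le_one.2 (by nlinarith [sq_nonneg (tangentialDir w).2]),
    abs_le_one_iff_mul_self_le_one.2 (by nlinarith [sq_nonneg (tangentialDir w).1])⟩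

theorem tangentialDir_mul_verticalSin (w : EuclideanSpace ℝ (Fin 3)) :
    ((tangentialDir w).1 : ℂ) * verticalSin w = ((w 0 / ‖w‖ : ℝ) : ℂ) ∧
    ((tangentialDir w).2 : ℂ) * verticalSin w = ((w 1 / ‖w‖ : ℝ) : ℂ) := by
  obtain ⟨h0, h1⟩ := norm_mul_tangentialDir w
  constructor
  · rw [← Complex.ofReal_mul, verticalSin, h0, mul_div_assoc', mul_comm]
  · rw [← Complex.ofReal_mul, verticalSin, h1, mul_div_assoc', mul_comm]

/-- The Laplace density of the plane integral with amplitude `f · affineSymbol l` at `w`. The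
tangential part of `l` is expressed in the frame given by `tangentialDir w`. -/
noncomputable def waveDensity (f : ℂ → ℂ) (l : Fin 4 → ℂ) (w : EuclideanSpace ℝ (Fin 3))
    (u : ℝ) : ℂ :=
  laplaceDensity f ![l 0, l 1, (tangentialDir w).1 * l 2 + (tangentialDir w).2 * l 3,
    -(tangentialDir w).2 * l 2 + (tangentialDir w).1 * l 3] (verticalCos w) (verticalSin w) u

/-- The Laplace transform of `waveDensity`, normalized by the factor `lam` so that its limit for
`lam → ∞` is the density at `0`. -/
noncomputable def waveLaplace (f : ℂ → ℂ) (l : Fin 4 → ℂ) (lam : ℝ)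
    (w : EuclideanSpace ℝ (Fin 3)) : ℂ :=
  lam * ∫ u in Set.Ioi (0 : ℝ), (Real.exp (-(lam * u)) : ℂ) * waveDensity f l w u

section Density

variable {f : ℂ → ℂ} {R M : ℝ} {p : ℕ} (l : Fin 4 → ℂ)

theorem integral_waveIntegrand (hf : IsAmplitude f R M p) {μ : ℝ} (hμ : 0 < μ)
    {w : EuclideanSpace ℝ (Fin 3)} (hw : w ∈ lowerHalfSpace) :
    ∫ q, waveIntegrand f l μ w q = ((2 * π * Real.exp (-(μ * ‖w‖)) / (μ * ‖w‖) : ℝ) : ℂ) *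
      waveLaplace f l (μ * ‖w‖) w := by
  have hr := norm_pos_of_mem_lowerHalfSpace hw
  have hlam : 0 < μ * ‖w‖ := mul_pos hμ hr
  obtain ⟨h0, h1⟩ := norm_mul_tangentialDir w
  rw [integral_waveIntegrand_eq_planeIntegrand l hw (tangentialDir_sq w) h0 h1,
    integral_planeIntegrand_eq_laplace _ hf hlam (verticalCos_pos hw) (verticalSin_nonneg w)
      (verticalCos_sq_add_verticalSin_sq hw), waveLaplace]
  have hne : ((μ * ‖w‖ : ℝ) : ℂ) ≠ 0 := by exact_mod_cast hlam.ne'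
  have hcast : ((2 * π * Real.exp (-(μ * ‖w‖)) / (μ * ‖w‖) : ℝ) : ℂ)
      = 2 * π * (Real.exp (-(μ * ‖w‖)) : ℂ) / ((μ * ‖w‖ : ℝ) : ℂ) := by push_cast; rfl
  rw [hcast, ← mul_assoc, div_mul_cancel₀ _ hne]
  rfl

/-- Only the smooth components `w i / ‖w‖` and the products of `tangentialDir w` with the angular mean
for `e = 1` occur, although `tangentialDir` itself is not continuous. -/
theorem waveDensity_eq (w : EuclideanSpace ℝ (Fin 3)) (u : ℝ) :
    waveDensity f l w u = l 0 * angularMean f 0 (verticalCos w) (verticalSin w) u +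
      l 1 * angularMean (fun t => f t * t) 0 (verticalCos w) (verticalSin w) u +
      (l 2 * ((w 0 / ‖w‖ : ℝ) : ℂ) + l 3 * ((w 1 / ‖w‖ : ℝ) : ℂ)) * Complex.I *
        (angularMean f 0 (verticalCos w) (verticalSin w) u +
          u * angularMean f 0 (verticalCos w) (verticalSin w) u) +
      (-Complex.I * verticalCos w) *
        (l 2 * ((tangentialDir w).1 * angularMean f 1 (verticalCos w) (verticalSin w) u) +
         l 3 * ((tangentialDir w).2 * angularMean f 1 (verticalCos w) (verticalSin w) u)) := by
  obtain ⟨h0, h1⟩ := tangentialDir_mul_verticalSin w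
  rw [waveDensity, laplaceDensity, ← h0, ← h1]
  simp
  ring

theorem hasUniformExpansion_waveDensity (hf : IsAmplitude f R M p) (N : ℕ) :
    HasUniformExpansion ((R / 12) ^ 2) N (waveDensity f l) := by
  have hpow : ∀ i, IsBoundedSmooth fun w => (verticalSin w : ℂ) ^ (2 * i) := fun i => by
    simpa only [pow_mul] using isBoundedSmooth_verticalSin_sq.pow i
  have h0 : ∀ {g : ℂ → ℂ} {M' : ℝ} {p' : ℕ}, IsAmplitude g R M' p' →
      HasUniformExpansion ((R / 12) ^ 2) N
        fun w u => angularMean g 0 (verticalCos w) (verticalSin w) u := fun hg =>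
    (hg.hasUniformExpansion_angularMean 0 (σ := fun _ => 1) (by simp) (fun k hk => by
      obtain ⟨i, hi⟩ := hk
      refine (hpow i).congr fun w _ => ?_
      rw [one_mul, show k = 2 * i by omega]) N).congr fun w _ u _ => by simp
  -- An odd power of the sine becomes smooth when one factor is absorbed by the direction.
  have hodd : ∀ {d : EuclideanSpace ℝ (Fin 3) → ℝ} (i : Fin 3),
      (∀ w, (d w : ℂ) * verticalSin w = ((w i / ‖w‖ : ℝ) : ℂ)) →
      ∀ k, Even (k + 1) → IsBoundedSmooth fun w => (d w : ℂ) * (verticalSin w : ℂ) ^ k := by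
    intro d i hd k hk
    obtain ⟨j, hj⟩ := hk
    refine ((isBoundedSmooth_coord_div_norm i).mul (hpow (j - 1))).congr fun w _ => ?_
    rw [← hd w, show k = 2 * (j - 1) + 1 by omega, pow_succ']
    ring
  have h1 := hf.hasUniformExpansion_angularMean 1 (σ := fun w => ((tangentialDir w).1 : ℂ))
    (fun w => (norm_tangentialDir_le w).1)
    (hodd 0 fun w => (tangentialDir_mul_verticalSin w).1) N
  have h2 := hf.hasUniformExpansion_angularMean 1 (σ := fun w => ((tangentialDir w).2 : ℂ))
    (fun w => (norm_tangentialDir_le w).2)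
    (hodd 1 fun w => (tangentialDir_mul_verticalSin w).2) N
  have e0 := (h0 hf).const_mul (.const (l 0))
  have e1 := (h0 hf.mul_id).const_mul (.const (l 1))
  have e2 := ((h0 hf).add (h0 hf).mul_u).const_mul
    ((((IsBoundedSmooth.const (l 2)).mul (isBoundedSmooth_coord_div_norm 0)).add
      ((IsBoundedSmooth.const (l 3)).mul (isBoundedSmooth_coord_div_norm 1))).mul
        (.const Complex.I))
  have e3 := ((h1.const_mul (.const (l 2))).add (h2.const_mul (.const (l 3)))).const_mul
    ((IsBoundedSmooth.const (-Complex.I)).mul isBoundedSmooth_verticalCos)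
  exact (((e0.add e1).add e2).add e3).congr fun w _ u _ => waveDensity_eq l w u

theorem waveDensity_zero (w : EuclideanSpace ℝ (Fin 3)) :
    waveDensity f l w 0 = f (verticalCos w) * (l 0 + l 1 * verticalCos w +
      (l 2 * ((w 0 / ‖w‖ : ℝ) : ℂ) + l 3 * ((w 1 / ‖w‖ : ℝ) : ℂ)) * Complex.I) := by
  have hT : ∀ c s θ : ℝ, obliqueArg c s 0 θ = c := fun c s θ => by simp [obliqueArg]
  have hpi : (π : ℂ) ≠ 0 := by exact_mod_cast Real.pi_ne_zero
  have h0 : ∀ (g : ℂ → ℂ) (c s : ℝ), angularMean g 0 c s 0 = g c := fun g c s => by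
    simp only [angularMean, hT, pow_zero, mul_one, intervalIntegral.integral_const,
      sub_neg_eq_add, Complex.real_smul]
    push_cast
    field_simp
    ring
  have h1 : ∀ c s : ℝ, angularMean f 1 c s 0 = 0 := fun c s => by simp [angularMean]
  rw [waveDensity_eq, h0, h0, h1]
  push_cast
  ring

theorem continuousOn_angularMean (hf : IsAmplitude f R M p) (e : ℕ) {c : ℝ} (hc : 0 < c)
    (s : ℝ) : ContinuousOn (angularMean f e c s) (Set.Ici 0) := by
  have hT : Continuous fun z : ℝ × ℝ => obliqueArg c s (max z.1 0) z.2 := by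
    unfold obliqueArg; fun_prop
  have hfT : Continuous fun z : ℝ × ℝ => f (obliqueArg c s (max z.1 0) z.2) :=
    hf.continuous_comp hT fun z => by
      rw [re_obliqueArg]
      have : 0 ≤ max z.1 0 := le_max_right _ _
      positivity
  have hg : Continuous fun u : ℝ => angularMean f e c s (max u 0) := by
    unfold angularMean
    refine continuous_const.mul (intervalIntegral.continuous_parametric_intervalIntegral_of_continuous'
      (f := fun u θ => f (obliqueArg c s (max u 0) θ) *
        (Complex.I * (√((max u 0) ^ 2 + 2 * (max u 0)) * Real.cos θ)) ^ e) ?_ _ _)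
    exact hfT.mul (by fun_prop)
  exact hg.continuousOn.congr fun u hu => by
    simp only [max_eq_left (show (0 : ℝ) ≤ u from hu)]

theorem continuousOn_waveDensity (hf : IsAmplitude f R M p) {w : EuclideanSpace ℝ (Fin 3)}
    (hw : w ∈ lowerHalfSpace) : ContinuousOn (waveDensity f l w) (Set.Ici 0) := by
  have h0 := continuousOn_angularMean hf 0 (verticalCos_pos hw) (verticalSin w)
  have h1 := continuousOn_angularMean hf 1 (verticalCos_pos hw) (verticalSin w)
  have h2 := continuousOn_angularMean hf.mul_id 0 (verticalCos_pos hw) (verticalSin w)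
  unfold waveDensity laplaceDensity
  fun_prop

theorem norm_waveDensity_le_of_wave (hf : IsAmplitude f R M p) {w : EuclideanSpace ℝ (Fin 3)}
    (hw : w ∈ lowerHalfSpace) {u : ℝ} (hu : 0 ≤ u) :
    ‖waveDensity f ![1, 0, 0, 0] w u‖ ≤ M * 3 ^ p * (1 + u) ^ p := by
  have h := hf.norm_angularMean_le 0 (c := verticalCos w) (s := verticalSin w)
    ⟨verticalCos_pos hw, verticalCos_le_one hw⟩ ⟨verticalSin_nonneg w, verticalSin_le_one hw⟩ hu
  rw [waveDensity_eq]
  simpa using h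

theorem exists_norm_waveDensity_le (hf : IsAmplitude f R M p) :
    ∃ B, 0 ≤ B ∧ ∀ w ∈ lowerHalfSpace, ∀ u, 0 ≤ u →
      ‖waveDensity f l w u‖ ≤ B * (1 + u) ^ (p + 1) := by
  have hM := hf.bound_nonneg
  set B₀ := 2 * M * 3 ^ (p + 1) with hB₀
  have hB₀0 : 0 ≤ B₀ := by positivity
  refine ⟨‖l 0‖ * B₀ + ‖l 1‖ * B₀ + (‖l 2‖ + ‖l 3‖) * B₀ + (‖l 2‖ * B₀ + ‖l 3‖ * B₀),
    by positivity, fun w hw u hu => ?_⟩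
  have hc : verticalCos w ∈ Set.Ioc (0 : ℝ) 1 := ⟨verticalCos_pos hw, verticalCos_le_one hw⟩
  have hs : verticalSin w ∈ Set.Icc (0 : ℝ) 1 := ⟨verticalSin_nonneg w, verticalSin_le_one hw⟩
  set Y := (1 + u) ^ (p + 1) with hY
  have hY0 : 0 ≤ Y := by positivity
  have hM3 : M * 3 ^ p ≤ B₀ := by
    rw [hB₀, pow_succ]
    nlinarith [show 0 ≤ M * 3 ^ p by positivity]
  have ha := hf.norm_angularMean_le 0 hc hs hu
  have hb := hf.mul_id.norm_angularMean_le 0 hc hs hu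
  have hd := hf.norm_angularMean_le 1 hc hs hu
  set A₀ := angularMean f 0 (verticalCos w) (verticalSin w) u
  set A₁ := angularMean f 1 (verticalCos w) (verticalSin w) u
  set A₂ := angularMean (fun t => f t * t) 0 (verticalCos w) (verticalSin w) u
  have ha2 : ‖A₀ + u * A₀‖ ≤ B₀ * Y := by
    have : A₀ + u * A₀ = ((1 + u : ℝ) : ℂ) * A₀ := by push_cast; ring
    rw [this, norm_mul, Complex.norm_real, Real.norm_of_nonneg (by positivity)]
    calc _ ≤ (1 + u) * (M * 3 ^ p * (1 + u) ^ (p + 0)) := by gcongr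
      _ = M * 3 ^ p * Y := by rw [hY]; ring
      _ ≤ _ := by gcongr
  have ha' : ‖A₀‖ ≤ B₀ * Y := by
    refine ha.trans (mul_le_mul hM3 ?_ (by positivity) hB₀0)
    exact pow_le_pow_right₀ (by linarith) (by omega)
  have hb' : ‖A₂‖ ≤ B₀ * Y := hb
  have hd' : ‖A₁‖ ≤ B₀ * Y := hd.trans (by gcongr)
  have hν : ∀ i : Fin 3, ‖((w i / ‖w‖ : ℝ) : ℂ)‖ ≤ 1 := fun i => by
    rw [Complex.norm_real, norm_div, norm_norm]
    exact div_le_one_of_le₀ (PiLp.norm_apply_le w i) (norm_nonneg _)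
  obtain ⟨hd1, hd2⟩ := norm_tangentialDir_le w
  rw [waveDensity_eq]
  have t0 : ‖l 0 * A₀‖ ≤ ‖l 0‖ * (B₀ * Y) := by rw [norm_mul]; gcongr
  have t1 : ‖l 1 * A₂‖ ≤ ‖l 1‖ * (B₀ * Y) := by rw [norm_mul]; gcongr
  have t2 : ‖(l 2 * ((w 0 / ‖w‖ : ℝ) : ℂ) + l 3 * ((w 1 / ‖w‖ : ℝ) : ℂ)) * Complex.I *
      (A₀ + u * A₀)‖ ≤ (‖l 2‖ + ‖l 3‖) * (B₀ * Y) := by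
    rw [norm_mul, norm_mul, Complex.norm_I, mul_one]
    gcongr
    refine norm_add_le_of_le ?_ ?_
    · rw [norm_mul]; exact mul_le_of_le_one_right (norm_nonneg _) (hν 0)
    · rw [norm_mul]; exact mul_le_of_le_one_right (norm_nonneg _) (hν 1)
  have t3 : ‖(-Complex.I * verticalCos w) * (l 2 * ((tangentialDir w).1 * A₁) +
      l 3 * ((tangentialDir w).2 * A₁))‖ ≤ ‖l 2‖ * (B₀ * Y) + ‖l 3‖ * (B₀ * Y) := by
    rw [norm_mul, norm_mul, norm_neg, Complex.norm_I, one_mul, Complex.norm_real,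
      Real.norm_of_nonneg hc.1.le]
    refine (mul_le_of_le_one_left (norm_nonneg _) hc.2).trans (norm_add_le_of_le ?_ ?_)
    · rw [norm_mul, norm_mul]
      exact mul_le_mul_of_nonneg_left
        ((mul_le_of_le_one_left (norm_nonneg _) hd1).trans hd') (norm_nonneg _)
    · rw [norm_mul, norm_mul]
      exact mul_le_mul_of_nonneg_left
        ((mul_le_of_le_one_left (norm_nonneg _) hd2).trans hd') (norm_nonneg _)
  have := norm_add_le_of_le (norm_add_le_of_le (norm_add_le_of_le t0 t1) t2) t3
  linarith

end Density

/-- The moments of the exponential weight. -/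
theorem integral_pow_mul_exp {lam : ℝ} (hl : 0 < lam) (j : ℕ) :
    ∫ u in Set.Ioi (0 : ℝ), u ^ j * Real.exp (-(lam * u)) = j.factorial / lam ^ (j + 1) := by
  have h := Real.integral_rpow_mul_exp_neg_mul_Ioi (a := (j : ℝ) + 1) (by positivity) hl
  rw [Real.Gamma_nat_eq_factorial] at h
  simp only [add_sub_cancel_right, Real.rpow_natCast] at h
  rw [h]
  have : (1 / lam) ^ ((j : ℝ) + 1) = (1 / lam) ^ (j + 1) := by
    rw [← Real.rpow_natCast]; push_cast; rfl
  rw [this, one_div, inv_pow]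
  field_simp

theorem integrableOn_pow_mul_exp {lam : ℝ} (hl : 0 < lam) (j : ℕ) :
    IntegrableOn (fun u : ℝ => u ^ j * Real.exp (-(lam * u))) (Set.Ioi 0) :=
  Integrable.of_integral_ne_zero (by
    rw [integral_pow_mul_exp hl]; positivity)

/-- Watson's lemma with an explicit remainder. -/
theorem norm_laplace_sub_le {H : ℝ → ℂ} (hH : ContinuousOn H (Set.Ici 0)) {κ : ℕ → ℂ} {C : ℝ}
    {N K : ℕ} (hb : ∀ u, 0 ≤ u →
      ‖H u - ∑ j ∈ Finset.range N, κ j * (u : ℂ) ^ j‖ ≤ C * (u ^ N + u ^ K))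
    {lam : ℝ} (hl : 0 < lam) :
    ‖(lam : ℂ) * (∫ u in Set.Ioi (0 : ℝ), (Real.exp (-(lam * u)) : ℂ) * H u)
      - ∑ j ∈ Finset.range N, κ j * j.factorial * ((1 / lam : ℝ) : ℂ) ^ j‖
      ≤ C * (N.factorial * (1 / lam) ^ N + K.factorial * (1 / lam) ^ K) := by
  have hlc : (lam : ℂ) ≠ 0 := by exact_mod_cast hl.ne'
  have hterm : ∀ j, IntegrableOn (fun u : ℝ => κ j * ((u ^ j * Real.exp (-(lam * u)) : ℝ) : ℂ))
      (Set.Ioi 0) := fun j => ((integrableOn_pow_mul_exp hl j).ofReal).const_mul _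
  have hsum : IntegrableOn (fun u : ℝ => ∑ j ∈ Finset.range N,
      κ j * ((u ^ j * Real.exp (-(lam * u)) : ℝ) : ℂ)) (Set.Ioi 0) :=
    integrable_finsetSum _ fun j _ => hterm j
  have hsumval : (lam : ℂ) * ∫ u in Set.Ioi (0 : ℝ), ∑ j ∈ Finset.range N,
      κ j * ((u ^ j * Real.exp (-(lam * u)) : ℝ) : ℂ)
      = ∑ j ∈ Finset.range N, κ j * j.factorial * ((1 / lam : ℝ) : ℂ) ^ j := by
    rw [integral_finsetSum _ fun j _ => hterm j, Finset.mul_sum]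
    refine Finset.sum_congr rfl fun j _ => ?_
    rw [integral_const_mul, integral_complex_ofReal, integral_pow_mul_exp hl]
    push_cast
    rw [one_div, inv_pow]
    field_simp
    ring
  have hdom : IntegrableOn (fun u : ℝ => C * (u ^ N * Real.exp (-(lam * u)) +
      u ^ K * Real.exp (-(lam * u)))) (Set.Ioi 0) :=
    ((integrableOn_pow_mul_exp hl N).add (integrableOn_pow_mul_exp hl K)).const_mul C
  have hcont : ContinuousOn (fun u : ℝ => (Real.exp (-(lam * u)) : ℂ) * H u -
      ∑ j ∈ Finset.range N, κ j * ((u ^ j * Real.exp (-(lam * u)) : ℝ) : ℂ)) (Set.Ioi 0) := by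
    have := hH.mono Set.Ioi_subset_Ici_self
    refine ContinuousOn.sub (ContinuousOn.mul (Continuous.continuousOn (by fun_prop)) this) ?_
    exact Continuous.continuousOn (by fun_prop)
  have hle : ∀ u ∈ Set.Ioi (0 : ℝ), ‖(Real.exp (-(lam * u)) : ℂ) * H u -
      ∑ j ∈ Finset.range N, κ j * ((u ^ j * Real.exp (-(lam * u)) : ℝ) : ℂ)‖
      ≤ C * (u ^ N * Real.exp (-(lam * u)) + u ^ K * Real.exp (-(lam * u))) := by
    intro u hu
    have hu : 0 < u := hu
    have e : (Real.exp (-(lam * u)) : ℂ) * H u -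
        ∑ j ∈ Finset.range N, κ j * ((u ^ j * Real.exp (-(lam * u)) : ℝ) : ℂ)
        = (Real.exp (-(lam * u)) : ℂ) * (H u - ∑ j ∈ Finset.range N, κ j * (u : ℂ) ^ j) := by
      rw [mul_sub, Finset.mul_sum]
      congr 1
      refine Finset.sum_congr rfl fun j _ => ?_
      push_cast; ring
    rw [e, norm_mul, Complex.norm_real, Real.norm_of_nonneg (Real.exp_pos _).le]
    calc _ ≤ Real.exp (-(lam * u)) * (C * (u ^ N + u ^ K)) := by gcongr; exact hb u hu.le
      _ = _ := by ring
  have hdiff : IntegrableOn (fun u : ℝ => (Real.exp (-(lam * u)) : ℂ) * H u -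
      ∑ j ∈ Finset.range N, κ j * ((u ^ j * Real.exp (-(lam * u)) : ℝ) : ℂ)) (Set.Ioi 0) :=
    hdom.mono' (hcont.aestronglyMeasurable measurableSet_Ioi)
      ((ae_restrict_iff' measurableSet_Ioi).2 (Eventually.of_forall hle))
  have hHi : IntegrableOn (fun u : ℝ => (Real.exp (-(lam * u)) : ℂ) * H u) (Set.Ioi 0) := by
    have := hdiff.add hsum
    refine this.congr (Eventually.of_forall fun u => ?_)
    simp
  rw [← hsumval, ← mul_sub, ← integral_sub hHi hsum, norm_mul, Complex.norm_real,
    Real.norm_of_nonneg hl.le]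
  have hint := norm_integral_le_of_norm_le hdom
    ((ae_restrict_iff' measurableSet_Ioi).2 (Eventually.of_forall hle))
  rw [integral_const_mul, integral_add (integrableOn_pow_mul_exp hl N)
    (integrableOn_pow_mul_exp hl K), integral_pow_mul_exp hl, integral_pow_mul_exp hl] at hint
  calc _ ≤ lam * _ := mul_le_mul_of_nonneg_left hint hl.le
    _ = _ := by
      rw [one_div, inv_pow, inv_pow]
      field_simp
      ring

/-- A local expansion together with polynomial growth is a global remainder estimate. -/
theorem exists_global_remainder {u₀ : ℝ} (hu₀ : 0 < u₀)
    {h : EuclideanSpace ℝ (Fin 3) → ℝ → ℂ} {κ : ℕ → EuclideanSpace ℝ (Fin 3) → ℂ}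
    (hκ : ∀ j, IsBoundedSmooth (κ j)) {N k K : ℕ} (hNK : N ≤ K) (hkK : k ≤ K) {B : ℝ} (hB : 0 ≤ B)
    (hloc : ∃ C : ℝ, 0 ≤ C ∧ ∀ w ∈ lowerHalfSpace, ∀ u ∈ Set.Icc 0 u₀,
      ‖h w u - ∑ j ∈ Finset.range N, κ j w * (u : ℂ) ^ j‖ ≤ C * u ^ N)
    (hgr : ∀ w ∈ lowerHalfSpace, ∀ u, 0 ≤ u → ‖h w u‖ ≤ B * (1 + u) ^ k) :
    ∃ C : ℝ, 0 ≤ C ∧ ∀ w ∈ lowerHalfSpace, ∀ u, 0 ≤ u →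
      ‖h w u - ∑ j ∈ Finset.range N, κ j w * (u : ℂ) ^ j‖ ≤ C * (u ^ N + u ^ K) := by
  obtain ⟨C, hC, hb⟩ := hloc
  choose D hD using fun j => (hκ j).2
  set C' := B * (1 / u₀ + 1) ^ k * (1 / u₀) ^ (K - k) +
    ∑ j ∈ Finset.range N, |D j| * (1 / u₀) ^ (K - j) with hC'
  have hC'0 : 0 ≤ C' := by positivity
  have hpow : ∀ {u : ℝ}, u₀ ≤ u → ∀ j ≤ K, u ^ j ≤ (1 / u₀) ^ (K - j) * u ^ K := by
    intro u hu j hj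
    have hu0 : 0 < u := hu₀.trans_le hu
    have h1 : 1 ≤ 1 / u₀ * u := by
      rw [one_div, ← div_eq_inv_mul, one_le_div hu₀]; exact hu
    calc u ^ j = 1 * u ^ j := (one_mul _).symm
      _ ≤ (1 / u₀ * u) ^ (K - j) * u ^ j := by gcongr; exact one_le_pow₀ h1
      _ = (1 / u₀) ^ (K - j) * (u ^ (K - j) * u ^ j) := by rw [mul_pow]; ring
      _ = _ := by rw [← pow_add, Nat.sub_add_cancel hj]
  refine ⟨C + C', by positivity, fun w hw u hu => ?_⟩
  rcases le_or_gt u u₀ with hle | hgt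
  · calc _ ≤ C * u ^ N := hb w hw u ⟨hu, hle⟩
      _ ≤ (C + C') * (u ^ N + u ^ K) := by
        gcongr
        · linarith
        · linarith [pow_nonneg hu K]
  · have hu0 : 0 < u := hu₀.trans hgt
    have h1 : ‖h w u‖ ≤ B * (1 / u₀ + 1) ^ k * (1 / u₀) ^ (K - k) * u ^ K := by
      have h2 : 1 + u ≤ (1 / u₀ + 1) * u := by
        have : 1 ≤ 1 / u₀ * u := by
          rw [one_div, ← div_eq_inv_mul, one_le_div hu₀]; exact hgt.le
        linarith
      calc _ ≤ B * (1 + u) ^ k := hgr w hw u hu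
        _ ≤ B * ((1 / u₀ + 1) * u) ^ k := by gcongr
        _ = B * (1 / u₀ + 1) ^ k * u ^ k := by rw [mul_pow]; ring
        _ ≤ B * (1 / u₀ + 1) ^ k * ((1 / u₀) ^ (K - k) * u ^ K) := by
          gcongr
          exact hpow hgt.le k hkK
        _ = _ := by ring
    have h2 : ‖∑ j ∈ Finset.range N, κ j w * (u : ℂ) ^ j‖
        ≤ (∑ j ∈ Finset.range N, |D j| * (1 / u₀) ^ (K - j)) * u ^ K := by
      rw [Finset.sum_mul]
      refine norm_sum_le_of_le _ fun j hj => ?_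
      rw [norm_mul, norm_pow, Complex.norm_real, Real.norm_of_nonneg hu, mul_assoc]
      have := hpow hgt.le j (by have := Finset.mem_range.1 hj; omega)
      gcongr
      exact (hD j w hw).trans (le_abs_self _)
    calc _ ≤ _ := norm_sub_le_of_le h1 h2
      _ = C' * u ^ K := by rw [hC']; ring
      _ ≤ (C + C') * (u ^ N + u ^ K) := by
        gcongr
        · linarith
        · linarith [pow_nonneg hu N]

/-- The uniform expansion of the Laplace transforms. The exponent `k` is the growth of the
density; a remainder of order `N < k` needs the additional power `K`. -/
theorem exists_expansion_waveLaplace {f : ℂ → ℂ} {R M : ℝ} {p : ℕ} (hf : IsAmplitude f R M p)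
    (l : Fin 4 → ℂ) {k : ℕ} {B : ℝ} (hB : 0 ≤ B)
    (hgr : ∀ w ∈ lowerHalfSpace, ∀ u, 0 ≤ u → ‖waveDensity f l w u‖ ≤ B * (1 + u) ^ k) :
    ∃ κ : ℕ → EuclideanSpace ℝ (Fin 3) → ℂ, (∀ j, ContDiffOn ℝ ∞ (κ j) lowerHalfSpace) ∧
      (∀ w ∈ lowerHalfSpace, κ 0 w = waveDensity f l w 0) ∧
      ∀ N K, N ≤ K → k ≤ K → ∃ C : ℝ, 0 ≤ C ∧ ∀ w ∈ lowerHalfSpace, ∀ lam : ℝ, 0 < lam →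
        ‖waveLaplace f l lam w - ∑ j ∈ Finset.range N, κ j w * ((1 / lam : ℝ) : ℂ) ^ j‖
          ≤ C * ((1 / lam) ^ N + (1 / lam) ^ K) := by
  have hR := hf.radius_pos
  have hR1 := hf.radius_le
  have hu₀ : 0 < (R / 12) ^ 2 := by positivity
  have hu₁ : (R / 12) ^ 2 ≤ 1 := pow_le_one₀ (by positivity) (by linarith)
  obtain ⟨κ, hκ, hκ0, hloc⟩ := exists_coeff_of_hasUniformExpansion hu₀ hu₁
    (hasUniformExpansion_waveDensity l hf)
  refine ⟨fun j w => κ j w * j.factorial, fun j => ((hκ j).mul (.const _)).1,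
    fun w hw => by simpa using hκ0 w hw, fun N K hNK hkK => ?_⟩
  obtain ⟨C, hC, hb⟩ := exists_global_remainder hu₀ hκ hNK hkK hB (hloc N) hgr
  refine ⟨C * (N.factorial + K.factorial), by positivity, fun w hw lam hl => ?_⟩
  refine (norm_laplace_sub_le (continuousOn_waveDensity l hf hw) (hb w hw) hl).trans ?_
  rw [mul_assoc]
  gcongr
  have h1 : 0 ≤ (1 / lam) ^ N := by positivity
  have h2 : 0 ≤ (1 / lam) ^ K := by positivity
  nlinarith [show (0 : ℝ) ≤ N.factorial by positivity, show (0 : ℝ) ≤ K.factorial by positivity,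
    mul_nonneg (show (0 : ℝ) ≤ N.factorial by positivity) h2,
    mul_nonneg (show (0 : ℝ) ≤ K.factorial by positivity) h1]

/-! ### The expansion of the refracted wave -/

section Expansion

variable {γp γm : ℝ}

theorem refractedWave_eq_waveLaplace (hγp : 0 < γp) (hγ : γp < γm) {τ : ℝ} (hτ : 0 < τ)
    {x : EuclideanSpace ℝ (Fin 3)} (hx : x ∈ lowerHalfSpace) (z : EuclideanSpace ℝ (Fin 2)) :
    refractedWave γp γm τ x z =
      ((Real.exp (-(τ * ‖x - boundaryPoint z‖ / √γm)) /
        (4 * π * γm * ‖x - boundaryPoint z‖) : ℝ) : ℂ) *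
      (waveLaplace (refractedAmplitude γp γm) ![1, 0, 0, 0] (τ * ‖x - boundaryPoint z‖ / √γm)
        (x - boundaryPoint z) / (√γm : ℂ)) := by
  have hγm : 0 < γm := hγp.trans hγ
  obtain ⟨M, hF⟩ := isAmplitude_refractedAmplitude hγp hγ
  have hw := sub_boundaryPoint_mem hx z
  have hr := norm_pos_of_mem_lowerHalfSpace hw
  rw [refractedWave_eq hγp hγ hτ x z hw, integral_waveIntegrand _ hF (by positivity) hw,
    show τ / √γm * ‖x - boundaryPoint z‖ = τ * ‖x - boundaryPoint z‖ / √γm by ring,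
    ← mul_assoc, ← Complex.ofReal_mul]
  have hs : √γm ^ 2 = γm := Real.sq_sqrt hγm.le
  have hs0 : 0 < √γm := Real.sqrt_pos.2 hγm
  generalize Real.exp (-(τ * ‖x - boundaryPoint z‖ / √γm)) = e
  have key : τ / (8 * π ^ 2 * γm ^ 2) * (2 * π * e / (τ * ‖x - boundaryPoint z‖ / √γm)) =
      e / (4 * π * γm * ‖x - boundaryPoint z‖) / √γm := by
    rw [← hs, Real.sqrt_sq hs0.le]
    field_simp
    ring
  rw [key, Complex.ofReal_div, div_mul_eq_mul_div, mul_div_assoc]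

theorem refractedWavePartial_eq_waveLaplace (hγp : 0 < γp) (hγ : γp < γm) {τ : ℝ} (hτ : 0 < τ)
    {x : EuclideanSpace ℝ (Fin 3)} (hx : x ∈ lowerHalfSpace) (z : EuclideanSpace ℝ (Fin 2))
    (k : Fin 3) :
    refractedWavePartial γp γm τ k x z =
      (((-τ) * Real.exp (-(τ * ‖x - boundaryPoint z‖ / √γm)) /
        (4 * π * γm ^ (3 / 2 : ℝ) * ‖x - boundaryPoint z‖) : ℝ) : ℂ) *
      (-waveLaplace (refractedAmplitude γp γm) (gradientSymbol k)
        (τ * ‖x - boundaryPoint z‖ / √γm) (x - boundaryPoint z) / (√γm : ℂ)) := by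
  have hγm : 0 < γm := hγp.trans hγ
  obtain ⟨M, hF⟩ := isAmplitude_refractedAmplitude hγp hγ
  have hw := sub_boundaryPoint_mem hx z
  have hr := norm_pos_of_mem_lowerHalfSpace hw
  have h32 : γm ^ (3 / 2 : ℝ) = √γm ^ 3 := by
    rw [Real.sqrt_eq_rpow, ← Real.rpow_mul_natCast hγm.le]
    norm_num
  rw [(differentiableAt_refractedWave hγp hγ hτ hx z).2 k,
    integral_waveIntegrand _ hF (by positivity) hw,
    show τ / √γm * ‖x - boundaryPoint z‖ = τ * ‖x - boundaryPoint z‖ / √γm by ring,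
    ← mul_assoc, ← mul_assoc, ← Complex.ofReal_mul, ← Complex.ofReal_mul, h32]
  have hs : √γm ^ 2 = γm := Real.sq_sqrt hγm.le
  have hs0 : 0 < √γm := Real.sqrt_pos.2 hγm
  generalize Real.exp (-(τ * ‖x - boundaryPoint z‖ / √γm)) = e
  have key : τ / (8 * π ^ 2 * γm ^ 2) * (τ / √γm) *
      (2 * π * e / (τ * ‖x - boundaryPoint z‖ / √γm)) =
      -((-τ) * e / (4 * π * √γm ^ 3 * ‖x - boundaryPoint z‖) / √γm) := by
    rw [← hs, Real.sqrt_sq hs0.le]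
    field_simp
    ring
  rw [key, Complex.ofReal_neg, Complex.ofReal_div, neg_mul, div_mul_eq_mul_div, neg_div, mul_neg,
    mul_div_assoc]

theorem waveDensity_gradientSymbol_zero (f : ℂ → ℂ) (k : Fin 3) (w : EuclideanSpace ℝ (Fin 3)) :
    waveDensity f (gradientSymbol k) w 0 = -(f (verticalCos w) * ((w k / ‖w‖ : ℝ) : ℂ)) := by
  rw [waveDensity_zero]
  fin_cases k
  · simp [gradientSymbol]
    linear_combination (f (verticalCos w) * (w 0 / ‖w‖)) * Complex.I_mul_I
  · simp [gradientSymbol]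
    linear_combination (f (verticalCos w) * (w 1 / ‖w‖)) * Complex.I_mul_I
  · simp [gradientSymbol, verticalCos, neg_div]

theorem refractedAmplitude_verticalCos (hγp : 0 < γp) (hγ : γp < γm)
    {w : EuclideanSpace ℝ (Fin 3)} (hw : w ∈ lowerHalfSpace) :
    refractedAmplitude γp γm (verticalCos w) / (√γm : ℂ) = (leadingAmplitude γp γm w : ℂ) := by
  have hγm : 0 < γm := hγp.trans hγ
  have hr := norm_pos_of_mem_lowerHalfSpace hw
  have hc := verticalCos_pos hw
  have hβ : 0 ≤ γm / γp - 1 := by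
    rw [sub_nonneg, one_le_div hγp]; exact hγ.le
  have hw2 : |w 2| = ‖w‖ * verticalCos w := by
    rw [abs_of_neg hw, verticalCos]; field_simp
  set c := verticalCos w with hcdef
  set q := √(c ^ 2 + (γm / γp - 1)) with hq
  have hq0 : 0 < q := Real.sqrt_pos.2 (by positivity)
  have hS : √(√(γm / γp) ^ 2 * ‖w‖ ^ 2 - ‖tangential w‖ ^ 2) = ‖w‖ * q := by
    rw [Real.sq_sqrt (by positivity), hq, ← Real.sqrt_sq hr.le, ← Real.sqrt_mul (by positivity),
      Real.sqrt_sq hr.le]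
    congr 1
    have h2 : w 2 ^ 2 = ‖w‖ ^ 2 * c ^ 2 := by rw [← sq_abs, hw2]; ring
    rw [norm_tangential_sq]
    linear_combination h2 + norm_sq_fin_three w
  rw [leadingAmplitude, hS, hw2, refractedAmplitude, shiftedSqrt_ofReal, Real.sq_sqrt hβ, ← hq,
    Real.sq_sqrt (by positivity)]
  norm_cast
  have hs : √γm ^ 2 = γm := Real.sq_sqrt hγm.le
  have hs0 : 0 < √γm := Real.sqrt_pos.2 hγm
  rw [div_eq_div_iff (by positivity) (by positivity)]
  field_simp
  rw [hs]

/-- The Laplace transforms expand in `σ / (τ ‖w‖)`; the normalization by `σ = √γ₋` and the sign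
`ε` are those of the coefficients of the wave and of its derivatives. -/
theorem exists_expansion_normalized {f : ℂ → ℂ} {R M : ℝ} {p : ℕ} (hf : IsAmplitude f R M p)
    (l : Fin 4 → ℂ) {k : ℕ} {B : ℝ} (hB : 0 ≤ B)
    (hgr : ∀ w ∈ lowerHalfSpace, ∀ u, 0 ≤ u → ‖waveDensity f l w u‖ ≤ B * (1 + u) ^ k) (ε : ℂ)
    {σ : ℝ} (hσ : 0 < σ) :
    ∃ κ : ℕ → EuclideanSpace ℝ (Fin 3) → ℂ, (∀ j, ContDiffOn ℝ ∞ (κ j) lowerHalfSpace) ∧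
      (∀ w ∈ lowerHalfSpace, κ 0 w = ε * waveDensity f l w 0 / (σ : ℂ)) ∧
      ∀ N K, N ≤ K → k ≤ K → ∃ C : ℝ, 0 ≤ C ∧ ∀ w ∈ lowerHalfSpace, ∀ τ : ℝ, 0 < τ →
        ‖ε * waveLaplace f l (τ * ‖w‖ / σ) w / (σ : ℂ) -
            ∑ j ∈ Finset.range N, κ j w * ((σ / (τ * ‖w‖) : ℝ) : ℂ) ^ j‖
          ≤ C * ((σ / (τ * ‖w‖)) ^ N + (σ / (τ * ‖w‖)) ^ K) := by
  obtain ⟨κ, hκ, hκ0, hexp⟩ := exists_expansion_waveLaplace hf l hB hgr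
  refine ⟨fun j w => ε / (σ : ℂ) * κ j w, fun j => contDiffOn_const.mul (hκ j),
    fun w hw => by simp only [hκ0 w hw]; ring, fun N K hNK hkK => ?_⟩
  obtain ⟨C, hC, hb⟩ := hexp N K hNK hkK
  refine ⟨‖ε / (σ : ℂ)‖ * C, by positivity, fun w hw τ hτ => ?_⟩
  have hr := norm_pos_of_mem_lowerHalfSpace hw
  have h := hb w hw (τ * ‖w‖ / σ) (by positivity)
  rw [one_div_div] at h
  simp only [mul_assoc, ← Finset.mul_sum]
  rw [mul_div_right_comm, ← mul_sub, norm_mul]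
  gcongr

end Expansion

theorem mainTheorem4 (γp γm : ℝ) (hγp : 0 < γp) (hγ : γp < γm) :
    -- the refracted wave is well defined and differentiable in `x`
    (∀ τ : ℝ, 0 < τ → ∀ x ∈ lowerHalfSpace, ∀ z : EuclideanSpace ℝ (Fin 2),
      (∀ ε : ℝ, 0 < ε → Integrable (refractedIntegrand γp γm τ ε x z)) ∧
      Tendsto (fun ε => dampedRefractedWave γp γm τ ε x z) (𝓝[>] (0 : ℝ))
        (𝓝 (refractedWave γp γm τ x z)) ∧
      DifferentiableAt ℝ (fun y => refractedWave γp γm τ y z) x) ∧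
    ∃ (E : ℕ → EuclideanSpace ℝ (Fin 3) → ℂ)
      (G : Fin 3 → ℕ → EuclideanSpace ℝ (Fin 3) → ℂ)
      (RE : ℕ → EuclideanSpace ℝ (Fin 3) → EuclideanSpace ℝ (Fin 2) → ℝ → ℂ)
      (RG : Fin 3 → ℕ → EuclideanSpace ℝ (Fin 3) → EuclideanSpace ℝ (Fin 2) → ℝ → ℂ),
      -- smoothness of the coefficients
      (∀ j, ContDiffOn ℝ ∞ (E j) lowerHalfSpace) ∧
      (∀ k j, ContDiffOn ℝ ∞ (G k j) lowerHalfSpace) ∧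
      -- the expansions
      (∀ N : ℕ, 1 ≤ N → ∀ τ : ℝ, 0 < τ → ∀ x ∈ lowerHalfSpace,
        ∀ z : EuclideanSpace ℝ (Fin 2),
        refractedWave γp γm τ x z =
          ((Real.exp (-(τ * ‖x - boundaryPoint z‖ / √γm)) /
            (4 * π * γm * ‖x - boundaryPoint z‖) : ℝ) : ℂ) *
          (∑ j ∈ Finset.range N, E j (x - boundaryPoint z) *
              ((√γm / (τ * ‖x - boundaryPoint z‖) : ℝ) : ℂ) ^ j
            + RE N x z τ)) ∧
      (∀ k : Fin 3, ∀ N : ℕ, 1 ≤ N → ∀ τ : ℝ, 0 < τ → ∀ x ∈ lowerHalfSpace,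
        ∀ z : EuclideanSpace ℝ (Fin 2),
        refractedWavePartial γp γm τ k x z =
          (((-τ) * Real.exp (-(τ * ‖x - boundaryPoint z‖ / √γm)) /
            (4 * π * γm ^ (3 / 2 : ℝ) * ‖x - boundaryPoint z‖) : ℝ) : ℂ) *
          (∑ j ∈ Finset.range N, G k j (x - boundaryPoint z) *
              ((√γm / (τ * ‖x - boundaryPoint z‖) : ℝ) : ℂ) ^ j
            + RG k N x z τ)) ∧
      -- for `N ≥ 2` the remainder estimate is uniform in all of `τ`, `x`, `z'`
      (∀ N : ℕ, 2 ≤ N → ∃ C : ℝ, 0 < C ∧ ∀ τ : ℝ, 0 < τ → ∀ x ∈ lowerHalfSpace,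
        ∀ z : EuclideanSpace ℝ (Fin 2),
        ‖RE N x z τ‖ + ∑ k : Fin 3, ‖RG k N x z τ‖ ≤
          C * (√γm / (τ * ‖x - boundaryPoint z‖)) ^ N) ∧
      -- for `N = 1` so is the estimate of the remainder of the wave itself
      (∃ C : ℝ, 0 < C ∧ ∀ τ : ℝ, 0 < τ → ∀ x ∈ lowerHalfSpace,
        ∀ z : EuclideanSpace ℝ (Fin 2),
        ‖RE 1 x z τ‖ ≤ C * (√γm / (τ * ‖x - boundaryPoint z‖))) ∧
      -- for `N = 1` the full estimate is uniform where `τ |x - (z', 0)| / √γ₋ ≥ δ`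
      (∀ δ : ℝ, 0 < δ → ∃ C : ℝ, 0 < C ∧ ∀ τ : ℝ, 0 < τ → ∀ x ∈ lowerHalfSpace,
        ∀ z : EuclideanSpace ℝ (Fin 2), δ ≤ τ * ‖x - boundaryPoint z‖ / √γm →
        ‖RE 1 x z τ‖ + ∑ k : Fin 3, ‖RG k 1 x z τ‖ ≤
          C * (√γm / (τ * ‖x - boundaryPoint z‖))) ∧
      -- the leading terms
      (∀ x ∈ lowerHalfSpace, ∀ z : EuclideanSpace ℝ (Fin 2),
        E 0 (x - boundaryPoint z) = (leadingAmplitude γp γm (x - boundaryPoint z) : ℂ) ∧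
        ∀ k : Fin 3, G k 0 (x - boundaryPoint z) =
          E 0 (x - boundaryPoint z) *
            (((x - boundaryPoint z) k / ‖x - boundaryPoint z‖ : ℝ) : ℂ)) := by
  have hγm : 0 < γm := hγp.trans hγ
  have hσ : 0 < √γm := Real.sqrt_pos.2 hγm
  obtain ⟨M, hF⟩ := isAmplitude_refractedAmplitude hγp hγ
  have hM := hF.bound_nonneg
  obtain ⟨E, hE, hE0, hEexp⟩ := exists_expansion_normalized hF ![1, 0, 0, 0] (by positivity)
    (fun w hw u hu => norm_waveDensity_le_of_wave hF hw hu) 1 hσ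
  choose B hB hgr using fun k => exists_norm_waveDensity_le (gradientSymbol k) hF
  choose G hG hG0 hGexp using fun k =>
    exists_expansion_normalized hF (gradientSymbol k) (hB k) (hgr k) (-1) hσ
  -- The density of the wave grows linearly, those of the derivatives quadratically, so that the
  -- remainders of order `N` are homogeneous for `N ≥ 1` and for `N ≥ 2`, respectively.
  choose CE hCE hCEb using fun N (hN : 1 ≤ N) => hEexp N N le_rfl hN
  choose CG hCG hCGb using fun k N (hN : 2 ≤ N) => hGexp k N N le_rfl hN
  choose DG hDG hDGb using fun k => hGexp k 1 2 one_le_two le_rfl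
  refine ⟨fun τ hτ x hx z => ⟨fun ε hε => integrable_refractedIntegrand hγp hγm τ hε x z, ?_,
    (differentiableAt_refractedWave hγp hγ hτ hx z).1⟩, E, G,
    fun N x z τ => 1 * waveLaplace (refractedAmplitude γp γm) ![1, 0, 0, 0]
        (τ * ‖x - boundaryPoint z‖ / √γm) (x - boundaryPoint z) / (√γm : ℂ) -
      ∑ j ∈ Finset.range N, E j (x - boundaryPoint z) *
        ((√γm / (τ * ‖x - boundaryPoint z‖) : ℝ) : ℂ) ^ j,
    fun k N x z τ => -1 * waveLaplace (refractedAmplitude γp γm) (gradientSymbol k)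
        (τ * ‖x - boundaryPoint z‖ / √γm) (x - boundaryPoint z) / (√γm : ℂ) -
      ∑ j ∈ Finset.range N, G k j (x - boundaryPoint z) *
        ((√γm / (τ * ‖x - boundaryPoint z‖) : ℝ) : ℂ) ^ j,
    hE, hG, ?_, ?_, ?_, ?_, ?_, ?_⟩
  · rw [refractedWave_eq hγp hγ hτ x z (sub_boundaryPoint_mem hx z)]
    exact tendsto_dampedRefractedWave hγp hγ hτ x z (sub_boundaryPoint_mem hx z)
  · intro N _ τ hτ x hx z
    rw [refractedWave_eq_waveLaplace hγp hγ hτ hx z, add_sub_cancel, one_mul]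
  · intro k N _ τ hτ x hx z
    rw [refractedWavePartial_eq_waveLaplace hγp hγ hτ hx z, add_sub_cancel, neg_one_mul]
  · intro N hN
    refine ⟨2 * CE N (one_le_two.trans hN) + ∑ k, 2 * CG k N hN + 1, ?_, fun τ hτ x hx z => ?_⟩
    · have := hCE N (one_le_two.trans hN)
      have : 0 ≤ ∑ k, 2 * CG k N hN := Finset.sum_nonneg fun k _ => by linarith [hCG k N hN]
      positivity
    have hw := sub_boundaryPoint_mem hx z
    have hr := norm_pos_of_mem_lowerHalfSpace hw
    have h1 := hCEb N (one_le_two.trans hN) _ hw τ hτ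
    have h2 := Finset.sum_le_sum fun k (_ : k ∈ Finset.univ) => hCGb k N hN _ hw τ hτ
    have h3 : 0 ≤ (√γm / (τ * ‖x - boundaryPoint z‖)) ^ N := by positivity
    refine (add_le_add h1 h2).trans ?_
    rw [add_mul, add_mul, Finset.sum_mul]
    have h4 : ∀ C : ℝ, C * ((√γm / (τ * ‖x - boundaryPoint z‖)) ^ N +
        (√γm / (τ * ‖x - boundaryPoint z‖)) ^ N) =
        2 * C * (√γm / (τ * ‖x - boundaryPoint z‖)) ^ N := fun C => by ring
    simp only [h4]
    linarith
  · refine ⟨2 * CE 1 le_rfl + 1, by linarith [hCE 1 le_rfl], fun τ hτ x hx z => ?_⟩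
    have hw := sub_boundaryPoint_mem hx z
    have hr := norm_pos_of_mem_lowerHalfSpace hw
    have h1 := hCEb 1 le_rfl _ hw τ hτ
    have h3 : 0 ≤ √γm / (τ * ‖x - boundaryPoint z‖) := by positivity
    rw [pow_one] at h1
    exact h1.trans (by linarith)
  · intro δ hδ
    refine ⟨2 * CE 1 le_rfl + ∑ k, DG k * (1 + 1 / δ) + 1, ?_, fun τ hτ x hx z hδx => ?_⟩
    · have := hCE 1 le_rfl
      have : 0 ≤ ∑ k, DG k * (1 + 1 / δ) := Finset.sum_nonneg fun k _ => by
        have := hDG k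
        positivity
      positivity
    have hw := sub_boundaryPoint_mem hx z
    have hr := norm_pos_of_mem_lowerHalfSpace hw
    have h1 := hCEb 1 le_rfl _ hw τ hτ
    have h2 := fun k => hDGb k _ hw τ hτ
    have hle : √γm / (τ * ‖x - boundaryPoint z‖) ≤ 1 / δ := by
      rw [← one_div_div (τ * ‖x - boundaryPoint z‖)]
      exact one_div_le_one_div_of_le hδ hδx
    have h3 : 0 ≤ √γm / (τ * ‖x - boundaryPoint z‖) := by positivity
    simp only [pow_one] at h1 h2 ⊢
    generalize √γm / (τ * ‖x - boundaryPoint z‖) = y at *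
    have h4 := Finset.sum_le_sum fun k (_ : k ∈ Finset.univ) =>
      (h2 k).trans (show DG k * (y + y ^ 2) ≤ DG k * (1 + 1 / δ) * y by
        rw [mul_assoc]
        refine mul_le_mul_of_nonneg_left ?_ (hDG k)
        nlinarith)
    refine (add_le_add h1 h4).trans ?_
    rw [add_mul, add_mul, Finset.sum_mul]
    linarith
  · intro x hx z
    have hw := sub_boundaryPoint_mem hx z
    have hlead := refractedAmplitude_verticalCos hγp hγ hw
    refine ⟨?_, fun k => ?_⟩
    · rw [hE0 _ hw, waveDensity_zero, ← hlead]
      simp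
    · rw [hG0 k _ hw, hE0 _ hw, waveDensity_gradientSymbol_zero, waveDensity_zero]
      simp
      ring
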